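/- **Setting.** Let $\nu>0$, $\eta>1$. Write $n=(\tilde n,n_4)\in\mathbb Z^3\times\mathbb Z$, $\tilde n^2=n_1^2+n_2^2+n_3^2$, $|n|_1=\sum_{i=1}^4|n_i|$, $|\tilde n|_\infty=\max_{i\le 3}|n_i|$, $\mathbb Z^4_*=\mathbb Z^4\setminus\{0\}$, $J=\mathbb Z^4_*\times\{1,2,3\}$; a sequence $\omega=(\omega_n^{(m)})_{(n,m)\in J}$ is extended by $\omega_0=0$. Let $(M\omega)_n=\frac{i}{\tilde n^2}\,\tilde n\times\omega_n$ if $\tilde n\ne0$, and $(M\omega)_n=0$ if $\tilde n=0$; $(D_ma)_n=n_ma_n$; $[(a\star\tilde D)b]^{(l)}=\sum_{m=1}^3a^{(m)}*(D_mb^{(l)})$ (convolution on $\mathbb Z^4$). *Forcing.* $f:\mathbb T^3\to\mathbb R^3$ is time independent, real analytic, with zero average, and $f^\omega=\nabla\times f$ satisfies $\sum_{n\in\mathbb Z^4_*}|f^{\omega,(l)}_n|\,\eta^{|n|_1}/\max(|\tilde n|_\infty^2,|n_4|)<\infty$ for $l=1,2,3$. For $n\in\mathbb Z^4_*$ put $$F_n(\Omega,\omega)=i\Omega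 n_4\omega_n+i[(M\omega\star\tilde D)\omega]_n-i[(\omega\star\tilde D)M\omega]_n+\nu\tilde n^2\omega_n-f^\omega_n .$$ *Symmetries.* $G$ is a finite group acting by $$[a_gu](x,t)=C_g^Tu(C_gx+2\pi\tilde C_g,\;t+2\pi D_g/\Omega),\qquad [a_gp](x,t)=p(C_gx+2\pi\tilde C_g,\;t+2\pi D_g/\Omega),$$ where $(C_g)_{mm'}=\rho_g(m')\delta_{m\,\tau_g(m')}$ is a signed permutation matrix, $\tilde C_g\in\mathbb R^3$, $D_g\in\mathbb R$, and $x\mapsto C_gx+2\pi\tilde C_g$, $t\mapsto t+2\pi D_g/\Omega$ are left actions of $G$ on $\mathbb T^3$ and on $\mathbb R/(2\pi/\Omega)\mathbb Z$. Assume $f$ is $G$-invariant. On coefficients of the vorticity, $(\gamma_g\omega)_j=\alpha_g(j)\,\omega_{\beta_g(j)}$ with $\beta_g(n,m)=((C_g\tilde n,n_4),\tau_g(m))$ and $\alpha_g(n,m)=\det(C_g)\rho_g(m)e^{2\pi i(\tilde n\cdot C_g^T\tilde C_g+n_4D_g)}$. Let $g.j=\beta_g(j)$, let $G.j$ be the orbit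 and $G_j$ the stabilizer of $j$, let $J^{\rm dom}\subset J$ contain exactly one element of each orbit, and let $J^{\rm red}=\{j\in J^{\rm dom}:\sum_{g\in G_j}\alpha_g(j)\neq0\}$. *Reduced spaces.* $\mathcal X^{\rm red}$ is the Banach space of $\varphi=(\Omega,\phi)\in\mathbb C\times\mathbb C^{J^{\rm red}}$ with $\|\varphi\|=|\Omega|+\sum_{j=(n,m)\in J^{\rm red}}|G.j|\,\eta^{|n|_1}|\phi_j|<\infty$; $\mathcal X^{\rm red}_{-2,-1}$ is defined likewise with $\eta^{|n|_1}$ replaced by $\eta^{|n|_1}/\max(|\tilde n|_\infty^2,|n_4|)$. Let $\Pi$ be the restriction of sequences to $J^{\rm red}$, $\Sigma\phi=\sum_{j\in J^{\rm red}}\phi_j\sum_{j'\in G.j}\tilde\alpha(j,j')\mathrm e_{j'}$ with $\tilde\alpha(j,g.j)=\alpha_g(j)^{-1}$, $(\gamma_*\omega)_n=\overline{\omega_{-n}}$, $\tilde\gamma_*(\Omega,\phi)=(\overline\Omega,\Pi\gamma_*\Sigma\phi)$, and let $\mathcal X^{\rm red}_{\rm div}$ be the set of $(\Omega,\Pi\omega)$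 with $\sum_{(n,m)\in J}\eta^{|n|_1}|\omega_n^{(m)}|<\infty$, $\gamma_g\omega=\omega$ for all $g\in G$ and $\sum_mD_m\omega^{(m)}=0$. Fix $\hat\phi$ with $\sum_{j=(n,m)\in J^{\rm red}}|G.j|\eta^{|n|_1}|\hat\phi_j|<\infty$ and $\Pi\gamma_*\Sigma\hat\phi=\hat\phi$, and define $\mathcal F^{\rm red}:\mathcal X^{\rm red}\to\mathcal X^{\rm red}_{-2,-1}$ by $$\mathcal F^{\rm red}(\Omega,\phi)=\Bigl(i\sum_{j\in J^{\rm red}}|G.j|\,n_4\,\phi_j\overline{\hat\phi_j},\ \Pi F(\Omega,\Sigma\phi)\Bigr).$$ *Approximate data.* Let $\bar\varphi=(\bar\Omega,\bar\phi)\in\mathcal X^{\rm red}_{\rm div}$ with $\tilde\gamma_*\bar\varphi=\bar\varphi$ and $\bar\Omega\in\mathbb R\setminus\{0\}$. Let $N^\dagger\in\mathbb N\setminus\{0\}$, let $\mathcal E$ be the finite index set consisting of the frequency index and all $j=(n,m)\in J^{\rm red}$ with $|\nu\tilde n^2+i\bar\Omega n_4|\le N^\dagger$, and let $\Pi^\dagger$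 be the projection onto the coordinates in $\mathcal E$. Let $\widehat A_{\rm red}:\mathcal X^{\rm red}\to\mathcal X^{\rm red}_{-2,-1}$ act as $\Pi^\dagger D\mathcal F^{\rm red}(\bar\varphi)\Pi^\dagger$ on $\Pi^\dagger\mathcal X^{\rm red}$ and as multiplication by $\nu\tilde n^2+i\bar\Omega n_4$ on the other coordinates; let $A_{\rm red}:\mathcal X^{\rm red}_{-2,-1}\to\mathcal X^{\rm red}$ act as an arbitrary given matrix on the coordinates in $\mathcal E$ and as multiplication by $(\nu\tilde n^2+i\bar\Omega n_4)^{-1}$ on the others. **Theorem.** Assume that there are constants $Y_0,Z_0,Z_1,Z_2\ge0$ such that $$\|A_{\rm red}\mathcal F^{\rm red}(\bar\varphi)\|\le Y_0,\qquad \|I-A_{\rm red}\widehat A_{\rm red}\|\le Z_0,\qquad \|A_{\rm red}(D\mathcal F^{\rm red}(\bar\varphi)-\widehat A_{\rm red})\|\le Z_1,$$ $$\|A_{\rm red}(D\mathcal F^{\rm red}(\varphi)-D\mathcal F^{\rm red}(\bar\varphi))\|\le Z_2\|\varphi-\bar\varphi\|\quad\text{for all }\varphi\in\mathcal X^{\rm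 red}$$ (norms of $\mathcal X^{\rm red}$ and of bounded operators on $\mathcal X^{\rm red}$). If $$Z_0+Z_1<1\qquad\text{and}\qquad 2Y_0Z_2<(1-(Z_0+Z_1))^2,$$ then there is a zero $\tilde\varphi=(\tilde\Omega,\tilde\phi)$ of $\mathcal F^{\rm red}$ which, for every $r\in[r_{\min},r_{\max})$, lies in the closed ball of $\mathcal X^{\rm red}$ of radius $r$ around $\bar\varphi$ and is the only zero of $\mathcal F^{\rm red}$ in that ball, where $$r_{\min}=\frac{1-(Z_0+Z_1)-\sqrt{(1-(Z_0+Z_1))^2-2Y_0Z_2}}{Z_2},\qquad r_{\max}=\frac{1-(Z_0+Z_1)}{Z_2}.$$ Moreover $\tilde\varphi\in\mathcal X^{\rm red}_{\rm div}$, $\tilde\gamma_*\tilde\varphi=\tilde\varphi$, and $\tilde\Omega$ is real and nonzero. Finally, with $u(x,t)=\sum_{n\in\mathbb Z^4}(M\Sigma\tilde\phi)_n\,e^{i(\tilde n\cdot x+n_4\tilde\Omega t)}$ there is a pressure $p$ such that $(u,p)$ is real valued, real analytic, $2\pi$-periodic in each space variable, $2\pi/\tilde\Omega$-periodic in $t$,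 $G$-invariant (that is, $a_gu=u$ and $a_gp=p$ for all $g\in G$, with $\Omega=\tilde\Omega$), and solves $$\partial_tu+(u\cdot\nabla)u-\nu\Delta u+\nabla p=f,\qquad \nabla\cdot u=0\qquad\text{on }\mathbb R^3\times\mathbb R .$$ -/

import Mathlib

open scoped ComplexConjugate Matrix

namespace NSOrbit

noncomputable section

-- ===== Fourier sequences on `ℤ⁴`; an index is `n = (ñ, n₄)` with `n₄ = n 3` =====

abbrev Z4 : Type := Fin 4 → ℤ

/-- Vector valued Fourier sequences. -/
abbrev FSeq : Type := Z4 → Fin 3 → ℂ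

/-- The spatial part `ñ` of `n`. -/
def sp (n : Z4) : Fin 3 → ℤ := fun l => n l.castSucc

/-- `ñ² = n₁² + n₂² + n₃²`. -/
def sqNorm (n : Z4) : ℤ := ∑ l, sp n l ^ 2

/-- `|n|₁`. -/
def norm1 (n : Z4) : ℕ := ∑ i, (n i).natAbs

/-- `|ñ|_∞`. -/
def spSup (n : Z4) : ℕ := Finset.univ.sup fun l => (sp n l).natAbs

/-- `max (|ñ|_∞², |n₄|)`. -/
def order21 (n : Z4) : ℝ := max ((spSup n : ℝ) ^ 2) |(n 3 : ℝ)|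

/-- The matrix `M_n` recovering the velocity from the vorticity. -/
def Mmat (n : Z4) : Matrix (Fin 3) (Fin 3) ℂ :=
  if sp n = 0 then 0 else
    (Complex.I / (sqNorm n : ℂ)) •
      !![0, -(n 2 : ℂ), (n 1 : ℂ);
         (n 2 : ℂ), 0, -(n 0 : ℂ);
         -(n 1 : ℂ), (n 0 : ℂ), 0]

def M (ω : FSeq) : FSeq := fun n => Mmat n *ᵥ ω n

/-- Convolution product. -/
def conv (a b : Z4 → ℂ) : Z4 → ℂ := fun n => ∑' k, a k * b (n - k)

/-- `(D_m a)_n = n_m a_n`. -/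
def Dx (m : Fin 3) (a : Z4 → ℂ) : Z4 → ℂ := fun n => (sp n m : ℂ) * a n

/-- `(a ⋆ D̃) b`, i.e. `(a · ∇) b` up to a factor `i`. -/
def starD (a b : FSeq) : FSeq := fun n l =>
  ∑ m, conv (fun k => a k m) (Dx m fun k => b k l) n

/-- Fourier coefficients of `∇ × f` for a time independent field `f` with coefficients `c`. -/
def curlCoeff (c : (Fin 3 → ℤ) → Fin 3 → ℂ) : FSeq := fun n =>
  if n 3 = 0 then Complex.I • crossProduct (fun l => (sp n l : ℂ)) (c (sp n)) else 0

/-- `F_n(Ω, ω)`, where `fω` is the curl of the forcing. -/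
def vortF (ν : ℝ) (fω : FSeq) (Ω : ℂ) (ω : FSeq) : FSeq := fun n l =>
  Complex.I * Ω * (n 3 : ℂ) * ω n l + Complex.I * starD (M ω) ω n l
    - Complex.I * starD ω (M ω) n l + (ν : ℂ) * (sqNorm n : ℂ) * ω n l - fω n l

/-- The Fourier mode `e^{i (ñ · x + n₄ Ω t)}`. -/
def mode (Ω : ℝ) (n : Z4) (x : Fin 3 → ℝ) (t : ℝ) : ℂ :=
  Complex.exp (Complex.I * ((∑ l, (sp n l : ℝ) * x l + (n 3 : ℝ) * Ω * t : ℝ) : ℂ))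

-- ===== Forcing: analytic, real valued, time independent, zero average =====

/-- A time independent forcing on the three-torus, given by its Fourier coefficients. -/
structure Forcing (η : ℝ) where
  coeff : (Fin 3 → ℤ) → Fin 3 → ℂ
  -- `f` is real valued
  coeff_neg : ∀ k l, coeff (-k) l = conj (coeff k l)
  -- `f` has zero average
  coeff_zero : coeff 0 = 0
  -- `f` is analytic
  analytic : ∃ θ : ℝ, 1 < θ ∧
    ∀ l, Summable fun k : Fin 3 → ℤ => θ ^ (∑ i, (k i).natAbs) * ‖coeff k l‖
  -- `∇ × f` belongs to `(ℓ¹_{η,-2,-1})³`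
  curl_summable : ∀ l, Summable fun n : {n : Z4 // n ≠ 0} =>
    η ^ norm1 n.1 / order21 n.1 * ‖curlCoeff coeff n.1 l‖

/-- The forcing as a function on `ℝ³`. -/
def Forcing.fn {η : ℝ} (f : Forcing η) (x : Fin 3 → ℝ) (l : Fin 3) : ℝ :=
  (∑' k : Fin 3 → ℤ,
    f.coeff k l * Complex.exp (Complex.I * ((∑ i, (k i : ℝ) * x i : ℝ) : ℂ))).re

-- ===== The Navier-Stokes equations =====

/-- `∂_j g` at the point `x`. -/
def pd (j : Fin 3) (g : (Fin 3 → ℝ) → ℝ) (x : Fin 3 → ℝ) : ℝ :=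
  fderiv ℝ g x (Pi.single j 1)

/-- `∂_t u + (u · ∇) u - ν Δ u + ∇ p = f` and `∇ · u = 0` on `ℝ³ × ℝ`. -/
def SolvesNS (ν : ℝ) (f : (Fin 3 → ℝ) → Fin 3 → ℝ)
    (u : (Fin 3 → ℝ) → ℝ → Fin 3 → ℝ) (p : (Fin 3 → ℝ) → ℝ → ℝ) : Prop :=
  ∀ x t,
    (∀ l, deriv (fun s => u x s l) t + ∑ m, u x t m * pd m (fun y => u y t l) x
        - ν * ∑ m, pd m (fun y => pd m (fun z => u z t l) y) x
        + pd l (fun y => p y t) x = f x l) ∧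
    ∑ m, pd m (fun y => u y t m) x = 0

-- ===== The symmetry group =====

/-- The signed permutation matrix with entries `ρ(m') δ_{m, τ(m')}`. -/
def signedPerm (τ : Equiv.Perm (Fin 3)) (ρ : Fin 3 → ℤˣ) : Matrix (Fin 3) (Fin 3) ℤ :=
  Matrix.of fun m m' => if m = τ m' then (ρ m' : ℤ) else 0

/-- Data of the actions `x ↦ C_g x + 2π C̃_g` of `G` on the torus and `t ↦ t + 2π D_g / Ω` of `G` on
the circle. The laws say that both are left actions. -/
structure SymAction (G : Type*) [Group G] where
  τ : G → Equiv.Perm (Fin 3)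
  ρ : G → Fin 3 → ℤˣ
  shift : G → Fin 3 → ℝ
  timeShift : G → ℝ
  mat_mul : ∀ g h, signedPerm (τ (g * h)) (ρ (g * h)) =
    signedPerm (τ g) (ρ g) * signedPerm (τ h) (ρ h)
  shift_mul : ∀ g h i, ∃ k : ℤ, shift (g * h) i =
    ((signedPerm (τ g) (ρ g)).map (Int.cast : ℤ → ℝ) *ᵥ shift h) i + shift g i + k
  timeShift_mul : ∀ g h, ∃ k : ℤ, timeShift (g * h) = timeShift g + timeShift h + k

/-- The index set `J = ℤ⁴_* × {1,2,3}`. -/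
abbrev J : Type := {n : Z4 // n ≠ 0} × Fin 3

/-- Extension of a sequence on `J` by `ω_0 = 0`. -/
def ext (ω : J → ℂ) : FSeq := fun n m =>
  open Classical in if h : n ≠ 0 then ω (⟨n, h⟩, m) else 0

/-- The weight `ξ_j = η^{|n|₁}`. -/
def xi (η : ℝ) (j : J) : ℝ := η ^ norm1 j.1.1

theorem signedPerm_mulVec (τ : Equiv.Perm (Fin 3)) (ρ : Fin 3 → ℤˣ) (v : Fin 3 → ℤ) (m : Fin 3) :
    (signedPerm τ ρ *ᵥ v) (τ m) = (ρ m : ℤ) * v m := by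
  simp [Matrix.mulVec, dotProduct, signedPerm]

namespace SymAction

variable {G : Type*} [Group G] (S : SymAction G)

/-- The matrix `C_g`. -/
def C (g : G) : Matrix (Fin 3) (Fin 3) ℤ := signedPerm (S.τ g) (S.ρ g)

/-- The matrix `C_g` with real entries. -/
def CR (g : G) : Matrix (Fin 3) (Fin 3) ℝ := (S.C g).map (Int.cast : ℤ → ℝ)

/-- `n ↦ (C_g ñ, n₄)`. -/
def moveIndex (g : G) (n : Z4) : Z4 := Fin.snoc (α := fun _ => ℤ) (S.C g *ᵥ sp n) (n 3)

theorem sp_moveIndex (g : G) (n : Z4) : sp (S.moveIndex g n) = S.C g *ᵥ sp n := by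
  funext l; simp [sp, moveIndex]

theorem moveIndex_last (g : G) (n : Z4) : S.moveIndex g n 3 = n 3 := by
  exact Fin.snoc_last (α := fun _ => ℤ) _ _

theorem moveIndex_ne_zero (g : G) {n : Z4} (hn : n ≠ 0) : S.moveIndex g n ≠ 0 := by
  intro h
  apply hn
  have h1 : sp (S.moveIndex g n) = 0 := by rw [h]; rfl
  rw [sp_moveIndex] at h1
  have h3 : n 3 = 0 := by rw [← S.moveIndex_last g n, h]; rfl
  funext i
  refine Fin.lastCases h3 (fun l => ?_) i
  have := signedPerm_mulVec (S.τ g) (S.ρ g) (sp n) l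
  have h2 := congrFun h1 (S.τ g l)
  rw [C, this] at h2
  simpa [sp] using h2

/-- The action `β_g` on `J`. -/
def beta (g : G) (j : J) : J := (⟨S.moveIndex g j.1.1, S.moveIndex_ne_zero g j.1.2⟩, S.τ g j.2)

/-- The unit complex numbers `α_g(j)`. -/
def alpha (g : G) (j : J) : ℂ :=
  ((S.C g).det : ℂ) * ((S.ρ g j.2 : ℤ) : ℂ) *
    Complex.exp (2 * Real.pi * Complex.I *
      ((∑ l, (sp j.1.1 l : ℝ) * ((S.CR g)ᵀ *ᵥ S.shift g) l
        + (j.1.1 3 : ℝ) * S.timeShift g : ℝ) : ℂ))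

/-- The action `γ_g` on Fourier coefficients of the vorticity. -/
def gam (g : G) (ω : J → ℂ) : J → ℂ := fun j => S.alpha g j * ω (S.beta g j)

/-- The action `[a_g u](x,t) = C_gᵀ u(C_g x + 2π C̃_g, t + 2π D_g / Ω)` on velocities. -/
def actVel (Ω : ℝ) (g : G) (u : (Fin 3 → ℝ) → ℝ → Fin 3 → ℝ) : (Fin 3 → ℝ) → ℝ → Fin 3 → ℝ :=
  fun x t => (S.CR g)ᵀ *ᵥ
    u (S.CR g *ᵥ x + (2 * Real.pi) • S.shift g) (t + 2 * Real.pi * S.timeShift g / Ω)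

/-- The action `[a_g p](x,t) = p(C_g x + 2π C̃_g, t + 2π D_g / Ω)` on pressures. -/
def actPres (Ω : ℝ) (g : G) (p : (Fin 3 → ℝ) → ℝ → ℝ) : (Fin 3 → ℝ) → ℝ → ℝ :=
  fun x t => p (S.CR g *ᵥ x + (2 * Real.pi) • S.shift g) (t + 2 * Real.pi * S.timeShift g / Ω)

/-- `G`-invariance of a time independent vector field. -/
def InvariantField (f : (Fin 3 → ℝ) → Fin 3 → ℝ) : Prop :=
  ∀ g x, (S.CR g)ᵀ *ᵥ f (S.CR g *ᵥ x + (2 * Real.pi) • S.shift g) = f x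

/-- The orbit `G.j`. -/
def orb (j : J) : Set J := Set.range fun g => S.beta g j

/-- `dom` contains precisely one element of each orbit. -/
def IsFundamentalDomain (dom : Set J) : Prop := ∀ j, ∃! j', j' ∈ dom ∧ j' ∈ S.orb j

/-- `α̃(j,j') = α_g(j)⁻¹` for any `g` with `g.j = j'`; it is set to zero off the orbit of `j`. -/
def alphaT (j j' : J) : ℂ :=
  open Classical in if h : ∃ g, S.beta g j = j' then (S.alpha h.choose j)⁻¹ else 0

variable [Fintype G]

/-- Indices with `∑_{g ∈ G_j} α_g(j) ≠ 0`, where `G_j` is the stabilizer of `j`. -/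
def Jsym : Set J := {j | open Classical in ∑ g : G with S.beta g j = j, S.alpha g j ≠ 0}

/-- Symmetry reduced indices. -/
def Jred (dom : Set J) : Set J := dom ∩ S.Jsym

/-- `|G.j|`. -/
def orbCard (j : J) : ℕ := (S.orb j).ncard

theorem orb_finite (j : J) : (S.orb j).Finite := Set.finite_range _

theorem orbCard_pos (j : J) : 0 < S.orbCard j :=
  (Set.ncard_pos (S.orb_finite j)).2 ⟨_, ⟨1, rfl⟩⟩

/-- `Σ φ = ∑_{j ∈ J^red} φ_j ∑_{j' ∈ G.j} α̃(j,j') e_{j'}`. -/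
def Sig {dom : Set J} (φ : S.Jred dom → ℂ) : J → ℂ := fun j' =>
  ∑' j : S.Jred dom, φ j * S.alphaT j j'

/-- The projection `Π`. -/
def Pr (dom : Set J) (ω : J → ℂ) : S.Jred dom → ℂ := fun j => ω j

end SymAction

/-- Complex conjugation symmetry `γ_*` on sequences: `(γ_* ω)_n = conj (ω_{-n})`. -/
def conjSym (ω : J → ℂ) : J → ℂ := fun j => conj (ω (⟨-j.1.1, neg_ne_zero.2 j.1.2⟩, j.2))

/-- `∑_m D_m ω^{(m)} = 0`. -/
def DivFree (ω : J → ℂ) : Prop := ∀ n : {n : Z4 // n ≠ 0}, ∑ m, (sp n.1 m : ℂ) * ω (n, m) = 0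

-- ===== Weighted `ℓ¹` spaces =====

def wl1Submodule {ι : Type*} (w : ι → {r : ℝ // 0 < r}) : Submodule ℂ (ι → ℂ) where
  carrier := {a | Summable fun i => (w i : ℝ) * ‖a i‖}
  zero_mem' := by simp [summable_zero]
  add_mem' := by
    intro a b ha hb
    refine Summable.of_nonneg_of_le (fun i => mul_nonneg (w i).2.le (norm_nonneg _)) (fun i => ?_)
      (Summable.add ha hb)
    rw [← mul_add]
    exact mul_le_mul_of_nonneg_left (norm_add_le _ _) (w i).2.le
  smul_mem' := by
    intro c a ha
    refine (Summable.mul_left ‖c‖ ha).congr (fun i => ?_)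
    simp only [Pi.smul_apply, smul_eq_mul, norm_mul]; ring

/-- Sequences `a` with `∑ w_i |a_i| < ∞`, normed by that sum. -/
def WL1 {ι : Type*} (w : ι → {r : ℝ // 0 < r}) : Type _ := wl1Submodule w

namespace WL1

variable {ι : Type*} {w w' : ι → {r : ℝ // 0 < r}}

instance : AddCommGroup (WL1 w) := inferInstanceAs (AddCommGroup (wl1Submodule w))
instance : Module ℂ (WL1 w) := inferInstanceAs (Module ℂ (wl1Submodule w))

instance : CoeFun (WL1 w) (fun _ => ι → ℂ) := ⟨fun a => Subtype.val a⟩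

def mk (a : ι → ℂ) (h : Summable fun i => (w i : ℝ) * ‖a i‖) : WL1 w := ⟨a, h⟩

@[simp] theorem mk_apply (a : ι → ℂ) (h : Summable fun i => (w i : ℝ) * ‖a i‖) (i : ι) :
    (mk a h : WL1 w) i = a i := rfl
@[simp] theorem add_apply (a b : WL1 w) (i : ι) : (a + b) i = a i + b i := rfl
@[simp] theorem smul_apply (c : ℂ) (a : WL1 w) (i : ι) : (c • a) i = c * a i := rfl
@[simp] theorem neg_apply (a : WL1 w) (i : ι) : (-a) i = - a i := rfl
@[simp] theorem zero_apply (i : ι) : (0 : WL1 w) i = 0 := rfl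

@[ext] theorem ext {a b : WL1 w} (h : ∀ i, a i = b i) : a = b := Subtype.ext (funext h)

theorem summable (a : WL1 w) : Summable fun i => (w i : ℝ) * ‖a i‖ := a.2

theorem term_nonneg (a : WL1 w) (i : ι) : 0 ≤ (w i : ℝ) * ‖a i‖ :=
  mul_nonneg (w i).2.le (norm_nonneg _)

instance : Norm (WL1 w) := ⟨fun a => ∑' i, (w i : ℝ) * ‖a i‖⟩

theorem norm_def (a : WL1 w) : ‖a‖ = ∑' i, (w i : ℝ) * ‖a i‖ := rfl

theorem core : NormedSpace.Core ℂ (WL1 w) where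
  norm_nonneg a := tsum_nonneg a.term_nonneg
  norm_smul c a := by
    rw [norm_def, norm_def, ← tsum_mul_left]
    refine tsum_congr fun i => ?_
    simp only [smul_apply, norm_mul]; ring
  norm_triangle a b := by
    rw [norm_def, norm_def, norm_def, ← a.summable.tsum_add b.summable]
    refine (a + b).summable.tsum_le_tsum (fun i => ?_) (a.summable.add b.summable)
    rw [← mul_add]
    exact mul_le_mul_of_nonneg_left (norm_add_le _ _) (w i).2.le
  norm_eq_zero_iff a := by
    constructor
    · intro h
      have h2 := (hasSum_zero_iff_of_nonneg a.term_nonneg).1 (by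
        have h3 := a.summable.hasSum
        rwa [← norm_def, h] at h3)
      ext i
      have := congrFun h2 i
      simpa [(w i).2.ne'] using this
    · rintro rfl
      simp [norm_def]

instance : NormedAddCommGroup (WL1 w) := NormedAddCommGroup.ofCore core
instance : NormedSpace ℂ (WL1 w) := NormedSpace.ofCore core

theorem le_norm (a : WL1 w) (i : ι) : (w i : ℝ) * ‖a i‖ ≤ ‖a‖ :=
  a.summable.le_tsum i fun j _ => a.term_nonneg j

/-- Evaluation of a coordinate. -/
def evalCLM (i : ι) : WL1 w →L[ℂ] ℂ :=
  LinearMap.mkContinuous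
    { toFun := fun a => a i, map_add' := fun _ _ => rfl, map_smul' := fun _ _ => rfl }
    ((w i : ℝ)⁻¹) (fun a => by
      have := a.le_norm i
      rw [inv_mul_eq_div, le_div_iff₀ (w i).2, mul_comm]
      exact this)

/-- The diagonal operator `a ↦ (d_i a_i)`. -/
def diag (w w' : ι → {r : ℝ // 0 < r}) (d : ι → ℂ)
    (h : ∃ K : ℝ, ∀ i, (w' i : ℝ) * ‖d i‖ ≤ K * (w i : ℝ)) : WL1 w →L[ℂ] WL1 w' :=
  have key : ∀ (K : ℝ), (∀ i, (w' i : ℝ) * ‖d i‖ ≤ K * (w i : ℝ)) → ∀ (a : WL1 w) i,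
      (w' i : ℝ) * ‖d i * a i‖ ≤ K * ((w i : ℝ) * ‖a i‖) := fun K hK a i => by
    rw [norm_mul, ← mul_assoc, ← mul_assoc]
    exact mul_le_mul_of_nonneg_right (hK i) (norm_nonneg _)
  have mem : ∀ a : WL1 w, Summable fun i => (w' i : ℝ) * ‖d i * a i‖ := fun a => by
    obtain ⟨K, hK⟩ := h
    exact Summable.of_nonneg_of_le (fun i => mul_nonneg (w' i).2.le (norm_nonneg _))
      (key K hK a) (a.summable.mul_left K)
  LinearMap.mkContinuousOfExistsBound
    { toFun := fun a => mk (fun i => d i * a i) (mem a)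
      map_add' := fun a b => by ext i; simp [mul_add]
      map_smul' := fun c a => by ext i; simp; ring }
    (by
      obtain ⟨K, hK⟩ := h
      refine ⟨K, fun a => ?_⟩
      rw [norm_def, norm_def, ← tsum_mul_left]
      exact (mem a).tsum_le_tsum (key K hK a) (a.summable.mul_left K))

/-- Extension by zero of a vector indexed by a finite subset. -/
def ofFinite (w : ι → {r : ℝ // 0 < r}) (s : Set ι) (hs : s.Finite) : (s → ℂ) →ₗ[ℂ] WL1 w where
  toFun v := mk (fun i => open Classical in if h : i ∈ s then v ⟨i, h⟩ else 0)
    (summable_of_ne_finset_zero (s := hs.toFinset) fun i hi => by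
      have : i ∉ s := by simpa using hi
      simp [this])
  map_add' u v := by
    ext i; by_cases h : i ∈ s <;> simp [h]
  map_smul' c v := by
    ext i; by_cases h : i ∈ s <;> simp [h]

/-- The coordinates in a subset. -/
def restrict (w : ι → {r : ℝ // 0 < r}) (s : Set ι) : WL1 w →L[ℂ] (s → ℂ) :=
  ContinuousLinearMap.pi fun i => evalCLM i.1

end WL1

-- ===== Summability of the terms of the equation =====

theorem xi_pos {η : ℝ} (hη : 1 < η) (j : J) : 0 < xi η j := pow_pos (zero_lt_one.trans hη) _

theorem order21_pos {n : Z4} (hn : n ≠ 0) : 0 < order21 n := by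
  by_contra h
  push Not at h
  apply hn
  have h1 : |(n 3 : ℝ)| ≤ 0 := (le_max_right _ _).trans h
  have h2 : (spSup n : ℝ) ^ 2 ≤ 0 := (le_max_left _ _).trans h
  have h3 : n 3 = 0 := by
    have := abs_nonpos_iff.1 h1
    exact_mod_cast this
  have h4 : spSup n = 0 := by
    have := pow_eq_zero_iff (two_ne_zero) |>.1 (le_antisymm h2 (sq_nonneg _))
    exact_mod_cast this
  funext i
  refine Fin.lastCases h3 (fun l => ?_) i
  have : (sp n l).natAbs ≤ spSup n := Finset.le_sup (f := fun l => (sp n l).natAbs) (Finset.mem_univ l)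
  have h5 : (sp n l).natAbs = 0 := by omega
  simpa [sp] using h5

theorem sp_le_spSup (n : Z4) (l : Fin 3) : |(sp n l : ℝ)| ≤ spSup n := by
  have : (sp n l).natAbs ≤ spSup n := Finset.le_sup (f := fun l => (sp n l).natAbs) (Finset.mem_univ l)
  have h : (((sp n l).natAbs : ℕ) : ℝ) = |(sp n l : ℝ)| := by
    rw [Nat.cast_natAbs]; push_cast; rfl
  rw [← h]; exact_mod_cast this

theorem sqNorm_le (n : Z4) : (sqNorm n : ℝ) ≤ 3 * (spSup n : ℝ) ^ 2 := by
  have h : ∀ l, (sp n l : ℝ) ^ 2 ≤ (spSup n : ℝ) ^ 2 := fun l => by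
    rw [← sq_abs]
    exact pow_le_pow_left₀ (abs_nonneg _) (sp_le_spSup n l) 2
  have : (sqNorm n : ℝ) = ∑ l, (sp n l : ℝ) ^ 2 := by simp [sqNorm]
  rw [this, Fin.sum_univ_three]
  linarith [h 0, h 1, h 2]

theorem spSup_sq_le_sqNorm (n : Z4) : (spSup n : ℝ) ^ 2 ≤ (sqNorm n : ℝ) := by
  obtain ⟨l, -, hl⟩ := Finset.exists_mem_eq_sup (Finset.univ : Finset (Fin 3))
    Finset.univ_nonempty (fun l => (sp n l).natAbs)
  have h : (spSup n : ℝ) ^ 2 = (sp n l : ℝ) ^ 2 := by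
    rw [spSup, hl, Nat.cast_natAbs]; push_cast; exact sq_abs _
  have h2 : (sqNorm n : ℝ) = ∑ l, (sp n l : ℝ) ^ 2 := by simp [sqNorm]
  rw [h, h2]
  exact Finset.single_le_sum (f := fun l => (sp n l : ℝ) ^ 2) (fun i _ => sq_nonneg _)
    (Finset.mem_univ l)

theorem norm1_add_le (n k : Z4) : norm1 n ≤ norm1 k + norm1 (n - k) := by
  rw [norm1, norm1, norm1, ← Finset.sum_add_distrib]
  refine Finset.sum_le_sum fun i _ => ?_
  simp only [Pi.sub_apply]; omega

theorem sp_le_norm1 (n : Z4) (l : Fin 3) : |(sp n l : ℝ)| ≤ norm1 n := by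
  have h : (((sp n l).natAbs : ℕ) : ℝ) = |(sp n l : ℝ)| := by
    rw [Nat.cast_natAbs]; push_cast; rfl
  rw [← h]
  exact_mod_cast Finset.single_le_sum (f := fun i => (n i).natAbs) (fun i _ => Nat.zero_le _)
    (Finset.mem_univ l.castSucc)

theorem last_le_norm1 (n : Z4) : |(n 3 : ℝ)| ≤ norm1 n := by
  have h : (((n 3).natAbs : ℕ) : ℝ) = |(n 3 : ℝ)| := by
    rw [Nat.cast_natAbs]; push_cast; rfl
  rw [← h]
  exact_mod_cast Finset.single_le_sum (f := fun i => (n i).natAbs) (fun i _ => Nat.zero_le _)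
    (Finset.mem_univ 3)

theorem nat_le_pow {η : ℝ} (hη : 1 < η) (k : ℕ) : (k : ℝ) ≤ η ^ k / (η - 1) := by
  rw [le_div_iff₀ (by linarith)]
  have := one_add_mul_le_pow (a := η - 1) (by linarith) k
  simp only [add_sub_cancel] at this
  linarith

theorem conv_summable {θ : ℝ} (hθ : 1 ≤ θ) {a b : Z4 → ℝ} (ha0 : ∀ n, 0 ≤ a n)
    (hb0 : ∀ n, 0 ≤ b n) (ha : Summable fun n => θ ^ norm1 n * a n)
    (hb : Summable fun n => θ ^ norm1 n * b n) :
    Summable fun q : Z4 × Z4 => θ ^ norm1 q.1 * (a q.2 * b (q.1 - q.2)) := by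
  have hp : ∀ n : Z4, 0 ≤ θ ^ norm1 n := fun n => pow_nonneg (by linarith) _
  have h := ha.mul_of_nonneg hb (fun n => mul_nonneg (hp n) (ha0 n))
    (fun n => mul_nonneg (hp n) (hb0 n))
  have hinj : Function.Injective fun q : Z4 × Z4 => (q.2, q.1 - q.2) := by
    rintro ⟨a, b⟩ ⟨c, d⟩ h
    simp only [Prod.mk.injEq] at h ⊢
    obtain ⟨rfl, h⟩ := h
    exact ⟨sub_left_injective h, rfl⟩
  refine Summable.of_nonneg_of_le (fun q => mul_nonneg (hp _) (mul_nonneg (ha0 _) (hb0 _)))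
    (fun q => ?_) (h.comp_injective hinj)
  have h1 : θ ^ norm1 q.1 ≤ θ ^ norm1 q.2 * θ ^ norm1 (q.1 - q.2) := by
    rw [← pow_add]; exact pow_le_pow_right₀ hθ (norm1_add_le _ _)
  calc θ ^ norm1 q.1 * (a q.2 * b (q.1 - q.2))
      ≤ (θ ^ norm1 q.2 * θ ^ norm1 (q.1 - q.2)) * (a q.2 * b (q.1 - q.2)) :=
        mul_le_mul_of_nonneg_right h1 (mul_nonneg (ha0 _) (hb0 _))
    _ = _ := by simp only [Function.comp]; ring

/-- Membership of `ω` in `(ℓ¹_η)³`. -/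
def InL1 (η : ℝ) (ω : FSeq) : Prop := ∀ l, Summable fun n => η ^ norm1 n * ‖ω n l‖

theorem M_apply (ω : FSeq) (n : Z4) (l : Fin 3) : M ω n l = if sp n = 0 then 0 else
    (Complex.I / (sqNorm n : ℂ)) * (crossProduct (fun m => (sp n m : ℂ)) (ω n)) l := by
  unfold M Mmat
  have e0 : sp n 0 = n 0 := rfl
  have e1 : sp n 1 = n 1 := rfl
  have e2 : sp n 2 = n 2 := rfl
  split_ifs with h
  · simp
  · fin_cases l <;>
      simp [Matrix.mulVec, dotProduct, Fin.sum_univ_three, crossProduct, e0, e1, e2] <;> ring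

theorem dot_M (ω : FSeq) (n : Z4) : ∑ m, (sp n m : ℂ) * M ω n m = 0 := by
  simp only [M_apply]
  split_ifs with h
  · simp
  · simp only [Fin.sum_univ_three, crossProduct]
    simp
    ring

theorem cross_le (v : Fin 3 → ℂ) (w : Fin 3 → ℂ) (K : ℝ) (hv : ∀ i, ‖v i‖ ≤ K) (l : Fin 3) :
    ‖crossProduct v w l‖ ≤ K * ∑ i, ‖w i‖ := by
  have hK : 0 ≤ K := (norm_nonneg _).trans (hv 0)
  have key : ∀ a b : Fin 3, ‖v a * w b - v b * w a‖ ≤ K * ‖w b‖ + K * ‖w a‖ := fun a b => by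
    refine (norm_sub_le _ _).trans ?_
    rw [norm_mul, norm_mul]
    exact add_le_add (mul_le_mul_of_nonneg_right (hv _) (norm_nonneg _))
      (mul_le_mul_of_nonneg_right (hv _) (norm_nonneg _))
  rw [Fin.sum_univ_three]
  have n0 := mul_nonneg hK (norm_nonneg (w 0))
  have n1 := mul_nonneg hK (norm_nonneg (w 1))
  have n2 := mul_nonneg hK (norm_nonneg (w 2))
  have k0 := key 1 2
  have k1 := key 2 0
  have k2 := key 0 1
  fin_cases l <;> simp [crossProduct] <;> nlinarith

theorem spSup_pos {n : Z4} (h : sp n ≠ 0) : 0 < spSup n := by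
  rcases Nat.eq_zero_or_pos (spSup n) with h0 | h0
  · exfalso; apply h; funext l
    have h1 := sp_le_spSup n l
    rw [h0, Nat.cast_zero] at h1
    have h2 := abs_nonpos_iff.1 h1
    exact_mod_cast h2
  · exact h0

/-- Weighted smoothing by `M`: one derivative of `M ω` is controlled by `ω`. -/
theorem spSup_mul_M_le (ω : FSeq) (n : Z4) (l : Fin 3) :
    spSup n * ‖M ω n l‖ ≤ ∑ i, ‖ω n i‖ := by
  have hs : 0 ≤ ∑ i, ‖ω n i‖ := Finset.sum_nonneg fun i _ => norm_nonneg _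
  rw [M_apply]
  split_ifs with h
  · simpa using hs
  · have hpos : 0 < (spSup n : ℝ) := by exact_mod_cast spSup_pos h
    have hsq : 0 < (sqNorm n : ℝ) := lt_of_lt_of_le (by positivity) (spSup_sq_le_sqNorm n)
    have hc := cross_le (fun m => (sp n m : ℂ)) (ω n) (spSup n)
      (fun i => by simpa using sp_le_spSup n i) l
    rw [norm_mul, norm_div, Complex.norm_I]
    have e : ‖((sqNorm n : ℤ) : ℂ)‖ = (sqNorm n : ℝ) := by
      rw [Complex.norm_intCast, abs_of_pos hsq]
    rw [e]
    calc (spSup n : ℝ) * (1 / (sqNorm n : ℝ) * ‖crossProduct (fun m => (sp n m : ℂ)) (ω n) l‖)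
        ≤ (spSup n : ℝ) * (1 / (sqNorm n : ℝ) * (spSup n * ∑ i, ‖ω n i‖)) := by gcongr
      _ = ((spSup n : ℝ) ^ 2 / (sqNorm n : ℝ)) * ∑ i, ‖ω n i‖ := by ring
      _ ≤ 1 * ∑ i, ‖ω n i‖ := by
          gcongr
          exact (div_le_one hsq).2 (spSup_sq_le_sqNorm n)
      _ = _ := one_mul _

theorem M_le (ω : FSeq) (n : Z4) (l : Fin 3) : ‖M ω n l‖ ≤ ∑ i, ‖ω n i‖ := by
  by_cases h : sp n = 0
  · rw [M_apply, if_pos h]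
    simpa using Finset.sum_nonneg fun i _ => norm_nonneg (ω n i)
  · refine le_trans ?_ (spSup_mul_M_le ω n l)
    have h1 : 1 ≤ spSup n := spSup_pos h
    have : (1 : ℝ) ≤ spSup n := by exact_mod_cast h1
    nlinarith [norm_nonneg (M ω n l)]

theorem InL1.sum {η : ℝ} {ω : FSeq} (h : InL1 η ω) :
    Summable fun n => η ^ norm1 n * ∑ i, ‖ω n i‖ := by
  simp_rw [Finset.mul_sum]
  exact summable_sum fun i _ => h i

theorem InL1.M {η : ℝ} (hη : 1 < η) {ω : FSeq} (h : InL1 η ω) : InL1 η (M ω) := fun l =>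
  Summable.of_nonneg_of_le (fun n => mul_nonneg (pow_nonneg (by linarith) _) (norm_nonneg _))
    (fun n => mul_le_mul_of_nonneg_left (M_le ω n l) (pow_nonneg (by linarith) _)) h.sum

theorem abs_sp_le_order21 (n : Z4) (l : Fin 3) : |(sp n l : ℝ)| ≤ order21 n := by
  refine (sp_le_spSup n l).trans (le_trans ?_ (le_max_left _ _))
  have : spSup n ≤ spSup n ^ 2 := Nat.le_self_pow two_ne_zero _
  exact_mod_cast this

theorem one_le_order21 {n : Z4} (hn : n ≠ 0) : 1 ≤ order21 n := by
  have h := order21_pos hn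
  rcases lt_max_iff.1 h with h | h
  · refine le_trans ?_ (le_max_left _ _)
    have : 0 < spSup n ^ 2 := by exact_mod_cast h
    exact_mod_cast this
  · refine le_trans ?_ (le_max_right _ _)
    have : 0 < |n 3| := by exact_mod_cast h
    exact_mod_cast this

/-- The transport term loses at most one space derivative in total. -/
theorem starD_M_le {η : ℝ} (hη : 1 < η) {ω : FSeq} (h : InL1 η ω) (n : Z4)
    (l : Fin 3) : ‖starD (M ω) ω n l‖ ≤
      order21 n * ∑ m, ∑' k, ‖M ω k m‖ * ‖ω (n - k) l‖ := by
  have hM := h.M hη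
  have hone : ∀ {a : Z4 → ℂ}, (Summable fun n => η ^ norm1 n * ‖a n‖) →
      Summable fun n => (1 : ℝ) ^ norm1 n * ‖a n‖ := fun {a} ha =>
    Summable.of_nonneg_of_le (fun n => by positivity) (fun n => by
      rw [one_pow]
      exact mul_le_mul_of_nonneg_right (one_le_pow₀ hη.le) (norm_nonneg _)) ha
  have hD : ∀ m, Summable fun k => (1 : ℝ) ^ norm1 k * ‖Dx m (fun k => ω k l) k‖ := fun m => by
    refine Summable.of_nonneg_of_le (fun n => by positivity) (fun k => ?_)
      ((h l).mul_left (1 / (η - 1)))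
    rw [one_pow, one_mul, Dx, norm_mul, Complex.norm_intCast, ← mul_assoc]
    refine mul_le_mul_of_nonneg_right ?_ (norm_nonneg _)
    have := (sp_le_norm1 k m).trans (nat_le_pow hη (norm1 k))
    rw [one_div_mul_eq_div]; exact this
  have hs : ∀ m, Summable fun k => M ω k m * Dx m (fun k => ω k l) (n - k) := fun m => by
    refine Summable.of_norm ?_
    have := (conv_summable le_rfl (fun k => norm_nonneg (M ω k m))
      (fun k => norm_nonneg (Dx m (fun k => ω k l) k)) (hone (hM m)) (hD m)).prod_factor n
    refine this.congr fun k => ?_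
    rw [one_pow, one_mul, norm_mul]
  have hs2 : ∀ m, Summable fun k => ‖M ω k m‖ * ‖ω (n - k) l‖ := fun m => by
    have := (conv_summable le_rfl (fun k => norm_nonneg (M ω k m))
      (fun k => norm_nonneg (ω k l)) (hone (hM m)) (hone (h l))).prod_factor n
    refine this.congr fun k => ?_
    rw [one_pow, one_mul]
  have e : starD (M ω) ω n l = ∑' k, ∑ m, (sp n m : ℂ) * (M ω k m * ω (n - k) l) := by
    rw [starD]
    simp only [conv]
    rw [← Summable.tsum_finsetSum fun m _ => hs m]
    refine tsum_congr fun k => ?_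
    have h1 : ∑ m, M ω k m * Dx m (fun k => ω k l) (n - k)
        = ∑ m, (sp n m : ℂ) * (M ω k m * ω (n - k) l)
          - (∑ m, (sp k m : ℂ) * M ω k m) * ω (n - k) l := by
      rw [Finset.sum_mul, ← Finset.sum_sub_distrib]
      refine Finset.sum_congr rfl fun m _ => ?_
      have : (sp (n - k) m : ℂ) = sp n m - sp k m := by simp [sp]
      rw [Dx, this]; ring
    rw [h1, dot_M]; ring
  have hs3 : Summable fun k => ∑ m, order21 n * (‖M ω k m‖ * ‖ω (n - k) l‖) :=
    summable_sum fun m _ => (hs2 m).mul_left _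
  have hle : ∀ k, ‖∑ m, (sp n m : ℂ) * (M ω k m * ω (n - k) l)‖
      ≤ ∑ m, order21 n * (‖M ω k m‖ * ‖ω (n - k) l‖) := fun k => by
    refine (norm_sum_le _ _).trans (Finset.sum_le_sum fun m _ => ?_)
    rw [norm_mul, norm_mul, Complex.norm_intCast]
    exact mul_le_mul_of_nonneg_right (abs_sp_le_order21 n m) (by positivity)
  rw [e]
  refine (tsum_of_norm_bounded hs3.hasSum hle).trans (le_of_eq ?_)
  rw [Summable.tsum_finsetSum fun m _ => (hs2 m).mul_left _, Finset.mul_sum]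
  exact Finset.sum_congr rfl fun m _ => tsum_mul_left

theorem starD_le {η : ℝ} (hη : 1 < η) {ω : FSeq} (h : InL1 η ω) (n : Z4) (l : Fin 3) :
    ‖starD ω (M ω) n l‖ ≤ ∑ m, ∑' k, ‖ω k m‖ * ∑ i, ‖ω (n - k) i‖ := by
  have hone : ∀ {a : Z4 → ℝ}, (∀ n, 0 ≤ a n) → (Summable fun n => η ^ norm1 n * a n) →
      Summable fun n => (1 : ℝ) ^ norm1 n * a n := fun {a} ha0 ha =>
    Summable.of_nonneg_of_le (fun n => by rw [one_pow, one_mul]; exact ha0 n) (fun n => by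
      rw [one_pow]
      exact mul_le_mul_of_nonneg_right (one_le_pow₀ hη.le) (ha0 n)) ha
  have h0 : ∀ n, 0 ≤ ∑ i, ‖ω n i‖ := fun n => Finset.sum_nonneg fun i _ => norm_nonneg _
  rw [starD]
  refine (norm_sum_le _ _).trans (Finset.sum_le_sum fun m _ => ?_)
  have hs := (conv_summable le_rfl (fun k => norm_nonneg (ω k m)) h0
    (hone (fun n => norm_nonneg _) (h m)) (hone h0 h.sum)).prod_factor n
  refine tsum_of_norm_bounded (g := fun k => ‖ω k m‖ * ∑ i, ‖ω (n - k) i‖)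
    (Summable.hasSum (hs.congr fun k => by rw [one_pow, one_mul])) fun k => ?_
  rw [norm_mul, Dx, norm_mul, Complex.norm_intCast]
  refine mul_le_mul_of_nonneg_left ?_ (norm_nonneg _)
  exact (mul_le_mul_of_nonneg_right (sp_le_spSup _ m) (norm_nonneg _)).trans
    (spSup_mul_M_le ω (n - k) l)

/-- `F` maps `ℂ × (ℓ¹_η)³` into `(ℓ¹_{η,-2,-1})³`. -/
theorem vortF_summable {η : ℝ} (hη : 1 < η) (ν : ℝ) (f : Forcing η) (Ω : ℂ) {ω : FSeq}
    (h : InL1 η ω) (l : Fin 3) : Summable fun n : {n : Z4 // n ≠ 0} =>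
      η ^ norm1 n.1 / order21 n.1 * ‖vortF ν (curlCoeff f.coeff) Ω ω n.1 l‖ := by
  have hp : ∀ n : Z4, 0 ≤ η ^ norm1 n := fun n => pow_nonneg (by linarith) _
  have hM := h.M hη
  have h0 : ∀ n, 0 ≤ ∑ i, ‖ω n i‖ := fun n => Finset.sum_nonneg fun i _ => norm_nonneg _
  have A1 : Summable fun n => η ^ norm1 n * ∑ m, ∑' k, ‖M ω k m‖ * ‖ω (n - k) l‖ := by
    simp_rw [Finset.mul_sum]
    refine summable_sum fun m _ => ?_
    have := (conv_summable hη.le (fun k => norm_nonneg (M ω k m))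
      (fun k => norm_nonneg (ω k l)) (hM m) (h l)).prod
    exact this.congr fun n => by dsimp only; rw [tsum_mul_left]
  have A2 : Summable fun n => η ^ norm1 n * ∑ m, ∑' k, ‖ω k m‖ * ∑ i, ‖ω (n - k) i‖ := by
    simp_rw [Finset.mul_sum (s := Finset.univ) (f := fun m => ∑' k, ‖ω k m‖ * _)]
    refine summable_sum fun m _ => ?_
    have := (conv_summable hη.le (fun k => norm_nonneg (ω k m)) h0 (h m) h.sum).prod
    exact this.congr fun n => by dsimp only; rw [tsum_mul_left]
  have A3 := (h l).mul_left (‖Ω‖ + 3 * |ν|)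
  have inj : Function.Injective (Subtype.val : {n : Z4 // n ≠ 0} → Z4) := Subtype.val_injective
  refine Summable.of_nonneg_of_le (fun n => ?_) (fun n => ?_)
    ((((A3.comp_injective inj).add (A1.comp_injective inj)).add (A2.comp_injective inj)).add
      (f.curl_summable l))
  · exact mul_nonneg (div_nonneg (hp _) (order21_pos n.2).le) (norm_nonneg _)
  obtain ⟨n, hn⟩ := n
  have hpos := order21_pos hn
  simp only [Function.comp]
  have b1 : ‖Complex.I * Ω * (n 3 : ℂ) * ω n l‖ ≤ order21 n * (‖Ω‖ * ‖ω n l‖) := by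
    rw [norm_mul, norm_mul, norm_mul, Complex.norm_I, one_mul, Complex.norm_intCast]
    have : |(n 3 : ℝ)| ≤ order21 n := le_max_right _ _
    have h2 : 0 ≤ ‖Ω‖ * ‖ω n l‖ := by positivity
    nlinarith
  have b2 : ‖(ν : ℂ) * (sqNorm n : ℂ) * ω n l‖ ≤ order21 n * (3 * |ν| * ‖ω n l‖) := by
    have h3 : (sqNorm n : ℝ) ≤ 3 * order21 n :=
      (sqNorm_le n).trans (mul_le_mul_of_nonneg_left (le_max_left _ _) (by norm_num))
    have h4 : 0 ≤ (sqNorm n : ℝ) := (sq_nonneg _).trans (spSup_sq_le_sqNorm n)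
    rw [norm_mul, norm_mul, Complex.norm_real, Complex.norm_intCast, Real.norm_eq_abs,
      abs_of_nonneg h4]
    have h5 : 0 ≤ |ν| * ‖ω n l‖ := by positivity
    nlinarith
  have b3 := starD_M_le hη h n l
  have b4 : ‖starD ω (M ω) n l‖ ≤
      order21 n * ∑ m, ∑' k, ‖ω k m‖ * ∑ i, ‖ω (n - k) i‖ := by
    refine (starD_le hη h n l).trans ?_
    refine le_mul_of_one_le_left ?_ (one_le_order21 hn)
    exact Finset.sum_nonneg fun m _ => tsum_nonneg fun k => mul_nonneg (norm_nonneg _) (h0 _)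
  have tot : ‖vortF ν (curlCoeff f.coeff) Ω ω n l‖ ≤
      order21 n * (‖Ω‖ * ‖ω n l‖) + order21 n * (∑ m, ∑' k, ‖M ω k m‖ * ‖ω (n - k) l‖)
      + order21 n * (∑ m, ∑' k, ‖ω k m‖ * ∑ i, ‖ω (n - k) i‖)
      + order21 n * (3 * |ν| * ‖ω n l‖) + ‖curlCoeff f.coeff n l‖ := by
    rw [vortF]
    refine (norm_sub_le _ _).trans (add_le_add ?_ le_rfl)
    refine (norm_add_le _ _).trans (add_le_add ?_ b2)
    refine (norm_sub_le _ _).trans (add_le_add ?_ ?_)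
    · refine (norm_add_le _ _).trans (add_le_add b1 ?_)
      rw [norm_mul, Complex.norm_I, one_mul]; exact b3
    · rw [norm_mul, Complex.norm_I, one_mul]; exact b4
  refine (mul_le_mul_of_nonneg_left tot (div_nonneg (hp n) hpos.le)).trans (le_of_eq ?_)
  field_simp
  ring

-- ===== Symmetry reduced spaces =====

namespace SymAction

variable {G : Type*} [Group G] (S : SymAction G)

theorem norm1_moveIndex (g : G) (n : Z4) : norm1 (S.moveIndex g n) = norm1 n := by
  have split : ∀ n : Z4, norm1 n = ∑ l, (sp n l).natAbs + (n 3).natAbs := fun n => by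
    rw [norm1, Fin.sum_univ_castSucc]; rfl
  rw [split, split, sp_moveIndex, moveIndex_last]
  congr 1
  rw [← Equiv.sum_comp (S.τ g)]
  refine Finset.sum_congr rfl fun l _ => ?_
  rw [C, signedPerm_mulVec, Int.natAbs_mul, Int.units_natAbs, one_mul]

theorem one_le_norm_alpha (g : G) (j : J) : 1 ≤ ‖S.alpha g j‖ := by
  have hdet : (S.C g).det ≠ 0 := by
    intro h
    obtain ⟨v, hv, h0⟩ := Matrix.exists_mulVec_eq_zero_iff.2 h
    apply hv
    funext l
    have := congrFun h0 (S.τ g l)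
    rw [C, signedPerm_mulVec] at this
    simpa using this
  have h1 : (1 : ℝ) ≤ ‖((S.C g).det : ℂ)‖ := by
    rw [Complex.norm_intCast]
    exact_mod_cast Int.one_le_abs hdet
  have h2 : ‖((S.ρ g j.2 : ℤ) : ℂ)‖ = 1 := by
    rw [Complex.norm_intCast]
    rcases Int.units_eq_one_or (S.ρ g j.2) with h | h <;> simp [h]
  rw [alpha, norm_mul, norm_mul, h2, mul_one]
  have h3 : ∀ r : ℝ, ‖Complex.exp (2 * Real.pi * Complex.I * (r : ℂ))‖ = 1 := fun r => by
    have : (2 * Real.pi * Complex.I * (r : ℂ) : ℂ) = ((2 * Real.pi * r : ℝ) : ℂ) * Complex.I := by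
      push_cast; ring
    rw [this, Complex.norm_exp_ofReal_mul_I]
  rw [h3, mul_one]
  exact h1

theorem norm_alphaT_le (j i : J) : ‖S.alphaT j i‖ ≤ 1 := by
  unfold alphaT
  split_ifs with h
  · rw [norm_inv]; exact inv_le_one_of_one_le₀ (S.one_le_norm_alpha _ _)
  · simp

theorem alphaT_eq_zero {j i : J} (h : i ∉ S.orb j) : S.alphaT j i = 0 := by
  unfold alphaT
  rw [dif_neg]
  simpa [orb] using h

theorem xi_orb (η : ℝ) {j i : J} (h : i ∈ S.orb j) : xi η i = xi η j := by
  obtain ⟨g, rfl⟩ := h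
  simp [xi, beta, norm1_moveIndex]

variable [Fintype G] {dom : Set J} {η : ℝ}

theorem orbCard_le (j : J) : S.orbCard j ≤ Fintype.card G := by
  rw [orbCard, orb, ← Set.image_univ, ← Nat.card_eq_fintype_card, ← Set.ncard_univ]
  exact Set.ncard_image_le

theorem Sig_summable (hη : 1 < η) (φ : S.Jred dom → ℂ)
    (h : Summable fun j : S.Jred dom => (S.orbCard j * xi η j) * ‖φ j‖) :
    Summable fun i : J => xi η i * ‖S.Sig φ i‖ := by
  have hx : ∀ i, 0 ≤ xi η i := fun i => (xi_pos hη i).le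
  let T : S.Jred dom × J → ℝ := fun q => xi η q.2 * ‖φ q.1 * S.alphaT q.1 q.2‖
  have hT0 : 0 ≤ T := fun q => mul_nonneg (hx _) (norm_nonneg _)
  have hz : ∀ (j : S.Jred dom) (i : J), i ∉ (S.orb_finite j).toFinset → T (j, i) = 0 := by
    intro j i hi
    have : i ∉ S.orb j := by simpa using hi
    simp [T, S.alphaT_eq_zero this]
  have hT : Summable T := by
    refine (summable_prod_of_nonneg hT0).2
      ⟨fun j => summable_of_ne_finset_zero (hz j), ?_⟩
    refine Summable.of_nonneg_of_le (fun j => tsum_nonneg fun i => hT0 _) (fun j => ?_) h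
    rw [tsum_eq_sum (hz j)]
    have hle : ∀ i ∈ (S.orb_finite j).toFinset, T (j, i) ≤ xi η j * ‖φ j‖ := fun i hi => by
      have hi2 : i ∈ S.orb j := by simpa using hi
      simp only [T]
      rw [S.xi_orb η hi2, norm_mul]
      refine mul_le_mul_of_nonneg_left ?_ (hx _)
      exact mul_le_of_le_one_right (norm_nonneg _) (S.norm_alphaT_le _ _)
    refine (Finset.sum_le_card_nsmul _ _ _ hle).trans (le_of_eq ?_)
    rw [nsmul_eq_mul, orbCard, Set.ncard_eq_toFinset_card _ (S.orb_finite j), mul_assoc]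
  have hT2 : Summable fun q : J × S.Jred dom => T (q.2, q.1) := hT.prod_symm
  refine Summable.of_nonneg_of_le (fun i => mul_nonneg (hx _) (norm_nonneg _)) (fun i => ?_)
    hT2.prod
  have hi : Summable fun j : S.Jred dom => T (j, i) := hT2.prod_factor i
  have hi2 : Summable fun j : S.Jred dom => ‖φ j * S.alphaT j i‖ :=
    (summable_mul_left_iff (xi_pos hη i).ne').1 hi
  show _ ≤ ∑' j : S.Jred dom, xi η i * ‖φ j * S.alphaT j i‖
  rw [tsum_mul_left]
  exact mul_le_mul_of_nonneg_left (norm_tsum_le_tsum_norm hi2) (hx _)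

theorem ext_inL1 {ω : J → ℂ} (h : Summable fun i : J => xi η i * ‖ω i‖) : InL1 η (ext ω) := by
  intro l
  have inj : Function.Injective (Subtype.val : {n : Z4 // n ≠ 0} → Z4) := Subtype.val_injective
  refine (inj.summable_iff fun n hn => ?_).1 ?_
  · have : n = 0 := by
      by_contra h0
      exact hn ⟨⟨n, h0⟩, rfl⟩
    simp [ext, this]
  · have inj2 : Function.Injective fun n : {n : Z4 // n ≠ 0} => ((n, l) : J) :=
      fun a b hab => (Prod.mk.injEq .. ▸ hab).1
    refine (h.comp_injective inj2).congr fun n => ?_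
    simp [ext, xi, n.2]

variable (dom)

/-- The weights `ξ^s_j = |G.j| ξ_j` on `J^red`. -/
def wRed (hη : 1 < η) (j : S.Jred dom) : {r : ℝ // 0 < r} :=
  ⟨S.orbCard j * xi η j, mul_pos (by exact_mod_cast S.orbCard_pos j) (xi_pos hη j)⟩

/-- The weights of `𝒳^red`; the index `none` stands for the frequency and has weight one. -/
def wX (hη : 1 < η) : Option (S.Jred dom) → {r : ℝ // 0 < r}
  | none => ⟨1, one_pos⟩
  | some j => S.wRed dom hη j

/-- The weights of `𝒳^red_{-2,-1}`. -/
def wY (hη : 1 < η) : Option (S.Jred dom) → {r : ℝ // 0 < r}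
  | none => ⟨1, one_pos⟩
  | some j => ⟨(S.wRed dom hη j : ℝ) / order21 j.1.1.1,
      div_pos (S.wRed dom hη j).2 (order21_pos j.1.1.2)⟩

/-- The space `X^red` of symmetry reduced Fourier coefficients. -/
abbrev RedSeq (hη : 1 < η) : Type := WL1 (S.wRed dom hη)

/-- The space `𝒳^red = ℂ × X^red`, with norm `|Ω| + ∑_j ξ^s_j |φ_j|`. -/
abbrev XRed (hη : 1 < η) : Type := WL1 (S.wX dom hη)

/-- The space `𝒳^red_{-2,-1}`. -/
abbrev YRed (hη : 1 < η) : Type := WL1 (S.wY dom hη)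

variable {dom}

/-- The sequence part `φ` of `(Ω, φ)`. -/
def seqPart (φ : Option (S.Jred dom) → ℂ) : S.Jred dom → ℂ := fun j => φ (some j)

/-- The components of `𝓕^red(Ω, φ)`: the phase condition and `Π F(Ω, Σ φ)`. -/
def redMap (ν : ℝ) (f : Forcing η) (φhat : S.Jred dom → ℂ) (φ : Option (S.Jred dom) → ℂ) :
    Option (S.Jred dom) → ℂ
  | none => Complex.I * ∑' j : S.Jred dom,
      (S.orbCard j : ℂ) * (j.1.1.1 3 : ℂ) * φ (some j) * conj (φhat j)
  | some j => S.Pr dom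
      (fun i => vortF ν (curlCoeff f.coeff) (φ none) (ext (S.Sig (S.seqPart φ))) i.1.1 i.2) j

theorem summable_option {w : Option (S.Jred dom) → ℝ} :
    Summable w ↔ Summable fun j => w (some j) := by
  constructor
  · exact fun h => h.comp_injective (Option.some_injective _)
  · intro h
    have h1 : Summable fun i : Option (S.Jred dom) => i.elim 0 fun j => w (some j) := by
      refine ((Option.some_injective _).summable_iff fun i hi => ?_).1 h
      rcases i with _ | j
      · rfl
      · exact absurd ⟨j, rfl⟩ hi
    have h2 : Summable fun i : Option (S.Jred dom) => i.elim (w none) fun _ => (0 : ℝ) :=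
      summable_of_ne_finset_zero (s := {none}) fun i hi => by
        rcases i with _ | j
        · simp at hi
        · rfl
    refine (h1.add h2).congr fun i => ?_
    rcases i with _ | j <;> simp

theorem redMap_summable (hη : 1 < η) (ν : ℝ) (f : Forcing η) (φhat : S.Jred dom → ℂ)
    (φ : S.XRed dom hη) :
    Summable fun i => (S.wY dom hη i : ℝ) * ‖S.redMap ν f φhat φ i‖ := by
  have h1 : Summable fun j : S.Jred dom => (S.orbCard j * xi η j) * ‖S.seqPart φ j‖ :=
    φ.summable.comp_injective (Option.some_injective _)
  have h2 := ext_inL1 (S.Sig_summable hη _ h1)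
  have h3 : Summable fun i : J => xi η i / order21 i.1.1 *
      ‖vortF ν (curlCoeff f.coeff) (φ none) (ext (S.Sig (S.seqPart φ))) i.1.1 i.2‖ := by
    have h0 : ∀ i : J, 0 ≤ xi η i / order21 i.1.1 *
      ‖vortF ν (curlCoeff f.coeff) (φ none) (ext (S.Sig (S.seqPart φ))) i.1.1 i.2‖ := fun i =>
        mul_nonneg (div_nonneg (xi_pos hη i).le (order21_pos i.1.2).le) (norm_nonneg _)
    refine (summable_prod_of_nonneg h0).2 ⟨fun n => Summable.of_finite, ?_⟩
    simp_rw [tsum_fintype]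
    exact summable_sum fun l _ => vortF_summable hη ν f (φ none) h2 l
  rw [summable_option]
  refine Summable.of_nonneg_of_le (fun j => mul_nonneg (S.wY dom hη _).2.le (norm_nonneg _))
    (fun j => ?_) ((h3.comp_injective Subtype.val_injective).mul_left (Fintype.card G : ℝ))
  have hc : (S.orbCard j : ℝ) ≤ Fintype.card G := by exact_mod_cast S.orbCard_le j
  have hnn : 0 ≤ xi η j / order21 j.1.1.1 * ‖S.redMap ν f φhat φ (some j)‖ :=
    mul_nonneg (div_nonneg (xi_pos hη _).le (order21_pos j.1.1.2).le) (norm_nonneg _)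
  refine le_trans (le_of_eq ?_) (mul_le_mul_of_nonneg_right hc hnn)
  change (S.orbCard j * xi η j / order21 j.1.1.1) * ‖S.redMap ν f φhat φ (some j)‖ =
    S.orbCard j * (xi η j / order21 j.1.1.1 * ‖S.redMap ν f φhat φ (some j)‖)
  ring

/-- `𝓕^red : 𝒳^red → 𝒳^red_{-2,-1}`. -/
def Fred (hη : 1 < η) (ν : ℝ) (f : Forcing η) (φhat : S.RedSeq dom hη) (φ : S.XRed dom hη) :
    S.YRed dom hη :=
  WL1.mk (S.redMap ν f φhat φ) (S.redMap_summable hη ν f φhat φ)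

/-- `γ̃_* (Ω, φ) = (Ω^*, Π γ_* Σ φ)`. -/
def redConj (φ : Option (S.Jred dom) → ℂ) : Option (S.Jred dom) → ℂ
  | none => conj (φ none)
  | some j => S.Pr dom (conjSym (S.Sig (S.seqPart φ))) j

/-- The set `𝒳^red_div = Π {W ∈ 𝒳^sym : ∑_m D_m ω^{(m)} = 0}`. -/
def XRedDiv (dom : Set J) (hη : 1 < η) : Set (S.XRed dom hη) :=
  {φ | ∃ ω : J → ℂ, (Summable fun i => xi η i * ‖ω i‖) ∧ (∀ g, S.gam g ω = ω) ∧ DivFree ω ∧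
    S.seqPart φ = S.Pr dom ω}

-- ===== The operators `Â_red` and `A_red` =====

/-- `ν ñ² + i Ω̄ n₄`. -/
def symb (ν Ωbar : ℝ) (n : Z4) : ℂ := (ν : ℂ) * (sqNorm n : ℂ) + Complex.I * Ωbar * (n 3 : ℂ)

theorem symb_eq (ν Ωbar : ℝ) (n : Z4) :
    symb ν Ωbar n = ((ν * sqNorm n : ℝ) : ℂ) + ((Ωbar * n 3 : ℝ) : ℂ) * Complex.I := by
  simp only [symb]; push_cast; ring

theorem le_norm_symb {ν Ωbar : ℝ} (hν : 0 < ν) (n : Z4) :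
    min ν |Ωbar| * order21 n ≤ ‖symb ν Ωbar n‖ := by
  have hre : |ν * sqNorm n| ≤ ‖symb ν Ωbar n‖ := by
    have := Complex.abs_re_le_norm (symb ν Ωbar n)
    rw [symb_eq] at this ⊢
    simpa using this
  have him : |Ωbar * n 3| ≤ ‖symb ν Ωbar n‖ := by
    have := Complex.abs_im_le_norm (symb ν Ωbar n)
    rw [symb_eq] at this ⊢
    simpa using this
  have hm : 0 ≤ min ν |Ωbar| := le_min hν.le (abs_nonneg _)
  rw [order21, mul_max_of_nonneg _ _ hm]
  refine max_le ?_ ?_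
  · refine le_trans ?_ ((le_abs_self _).trans hre)
    exact mul_le_mul (min_le_left _ _) (spSup_sq_le_sqNorm n) (by positivity) hν.le
  · refine le_trans ?_ him
    rw [abs_mul]
    exact mul_le_mul_of_nonneg_right (min_le_right _ _) (abs_nonneg _)

theorem norm_symb_le (ν Ωbar : ℝ) (n : Z4) :
    ‖symb ν Ωbar n‖ ≤ (3 * |ν| + |Ωbar|) * order21 n := by
  have h3 : (sqNorm n : ℝ) ≤ 3 * order21 n :=
    (sqNorm_le n).trans (mul_le_mul_of_nonneg_left (le_max_left _ _) (by norm_num))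
  have h4 : 0 ≤ (sqNorm n : ℝ) := (sq_nonneg _).trans (spSup_sq_le_sqNorm n)
  have h5 : |(n 3 : ℝ)| ≤ order21 n := le_max_right _ _
  rw [symb]
  refine (norm_add_le _ _).trans ?_
  rw [norm_mul, norm_mul, norm_mul, Complex.norm_I, one_mul, Complex.norm_intCast,
    Complex.norm_intCast, Complex.norm_real, Complex.norm_real, Real.norm_eq_abs, Real.norm_eq_abs,
    abs_of_nonneg h4]
  nlinarith [abs_nonneg ν, abs_nonneg Ωbar, mul_le_mul_of_nonneg_left h3 (abs_nonneg ν),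
    mul_le_mul_of_nonneg_left h5 (abs_nonneg Ωbar)]

variable (dom)

/-- Indices of the Galerkin projection: the frequency and the `j = (n,m) ∈ J^red` with
`|ν ñ² + i Ω̄ n₄| ≤ N`. -/
def Edag (ν Ωbar : ℝ) (N : ℕ) : Set (Option (S.Jred dom)) :=
  {i | ∀ j, i = some j → ‖symb ν Ωbar j.1.1.1‖ ≤ N}

theorem Edag_finite {ν Ωbar : ℝ} (hν : 0 < ν) (hΩ : Ωbar ≠ 0) (N : ℕ) :
    (S.Edag dom ν Ωbar N).Finite := by
  have hm : 0 < min ν |Ωbar| := lt_min hν (abs_pos.2 hΩ)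
  obtain ⟨K, hK⟩ := exists_nat_ge ((N : ℝ) / min ν |Ωbar|)
  have hfin : (Set.Icc (fun _ => -(K : ℤ)) (fun _ => (K : ℤ)) : Set Z4).Finite := Set.finite_Icc _ _
  have hfin2 : ((Set.Icc (fun _ => -(K : ℤ)) (fun _ => (K : ℤ)) : Set Z4) ×ˢ
    (Set.univ : Set (Fin 3))).Finite := hfin.prod Set.finite_univ
  have inj : Function.Injective fun j : S.Jred dom => ((j.1.1.1, j.1.2) : Z4 × Fin 3) := by
    rintro ⟨⟨⟨a, _⟩, b⟩, _⟩ ⟨⟨⟨c, _⟩, d⟩, _⟩ h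
    simp only [Prod.mk.injEq] at h
    obtain ⟨rfl, rfl⟩ := h
    rfl
  refine (((hfin2.preimage inj.injOn).image some).insert none).subset ?_
  intro i hi
  rcases i with _ | j
  · exact Set.mem_insert _ _
  · refine Set.mem_insert_of_mem _ ⟨j, ⟨?_, trivial⟩, rfl⟩
    have h1 := (le_norm_symb (Ωbar := Ωbar) hν j.1.1.1).trans (hi j rfl)
    have h2 : order21 j.1.1.1 ≤ K := by
      refine le_trans ?_ hK
      rw [le_div_iff₀ hm]; linarith
    have hall : ∀ i, |(j.1.1.1 i : ℝ)| ≤ K := fun i =>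
      Fin.lastCases (motive := fun i => |(j.1.1.1 i : ℝ)| ≤ K) ((le_max_right _ _).trans h2)
        (fun l => (abs_sp_le_order21 _ l).trans h2) i
    have hall2 : ∀ i, |j.1.1.1 i| ≤ (K : ℤ) := fun i => by exact_mod_cast hall i
    exact ⟨fun i => (abs_le.1 (hall2 i)).1, fun i => (abs_le.1 (hall2 i)).2⟩

/-- `ν ñ² + i Ω̄ n₄` outside the Galerkin indices, and zero on them. -/
def tailSymb (ν Ωbar : ℝ) (N : ℕ) (i : Option (S.Jred dom)) : ℂ :=
  open Classical in if i ∈ S.Edag dom ν Ωbar N then 0 else i.elim 0 fun j => symb ν Ωbar j.1.1.1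

theorem exists_bound_ind (w : Option (S.Jred dom) → {r : ℝ // 0 < r})
    (s : Set (Option (S.Jred dom))) :
    ∃ K : ℝ, ∀ i, (w i : ℝ) * ‖s.indicator (fun _ => (1 : ℂ)) i‖ ≤ K * (w i : ℝ) := by
  refine ⟨1, fun i => ?_⟩
  rw [mul_comm]
  refine mul_le_mul_of_nonneg_right ?_ (w i).2.le
  by_cases h : i ∈ s <;> simp [h]

/-- The projection `Π^†` onto the Galerkin indices. -/
def projDag (w : Option (S.Jred dom) → {r : ℝ // 0 < r}) (ν Ωbar : ℝ) (N : ℕ) :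
    WL1 w →L[ℂ] WL1 w :=
  WL1.diag w w ((S.Edag dom ν Ωbar N).indicator fun _ => 1) (exists_bound_ind S dom w _)

theorem exists_bound_tail (hη : 1 < η) (ν Ωbar : ℝ) (N : ℕ) : ∃ K : ℝ, ∀ i,
    (S.wY dom hη i : ℝ) * ‖S.tailSymb dom ν Ωbar N i‖ ≤ K * (S.wX dom hη i : ℝ) := by
  refine ⟨3 * |ν| + |Ωbar|, fun i => ?_⟩
  have hK : 0 ≤ 3 * |ν| + |Ωbar| := by positivity
  unfold tailSymb
  split_ifs with h
  · rw [norm_zero, mul_zero]; exact mul_nonneg hK (S.wX dom hη i).2.le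
  rcases i with _ | j
  · simpa using mul_nonneg hK (S.wX dom hη none).2.le
  · have h1 := norm_symb_le ν Ωbar j.1.1.1
    have hp := order21_pos j.1.1.2
    have hw := (S.wRed dom hη j).2
    simp only [wY, wX, Option.elim]
    rw [div_mul_eq_mul_div, div_le_iff₀ hp]
    nlinarith [mul_le_mul_of_nonneg_left h1 hw.le]

theorem exists_bound_inv (hη : 1 < η) {ν Ωbar : ℝ} (hν : 0 < ν) (hΩ : Ωbar ≠ 0) (N : ℕ) :
    ∃ K : ℝ, ∀ i,
    (S.wX dom hη i : ℝ) * ‖(S.tailSymb dom ν Ωbar N i)⁻¹‖ ≤ K * (S.wY dom hη i : ℝ) := by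
  have hm : 0 < min ν |Ωbar| := lt_min hν (abs_pos.2 hΩ)
  refine ⟨(min ν |Ωbar|)⁻¹, fun i => ?_⟩
  unfold tailSymb
  split_ifs with h
  · rw [inv_zero, norm_zero, mul_zero]; exact mul_nonneg (inv_pos.2 hm).le (S.wY dom hη i).2.le
  rcases i with _ | j
  · simpa using mul_nonneg (inv_pos.2 hm).le (S.wY dom hη none).2.le
  · have h1 := le_norm_symb (Ωbar := Ωbar) hν j.1.1.1
    have hp := order21_pos j.1.1.2
    have hw := (S.wRed dom hη j).2
    have h2 : ‖(symb ν Ωbar j.1.1.1)⁻¹‖ ≤ (min ν |Ωbar|)⁻¹ / order21 j.1.1.1 := by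
      rw [norm_inv, div_eq_mul_inv, ← mul_inv]
      exact inv_anti₀ (mul_pos hm hp) h1
    simp only [wY, wX, Option.elim]
    refine (mul_le_mul_of_nonneg_left h2 hw.le).trans (le_of_eq ?_)
    ring

variable {dom}

/-- `Â_red`, the approximation of `D𝓕^red(φ̄)`: it equals `Π^† D𝓕^red(φ̄) Π^†` on the Galerkin
indices and multiplication by `ν ñ² + i Ω̄ n₄` on the others. -/
def Ahat (hη : 1 < η) (ν : ℝ) (f : Forcing η) (φhat : S.RedSeq dom hη) (N : ℕ)
    (Ωbar : ℝ) (φbar : S.XRed dom hη) : S.XRed dom hη →L[ℂ] S.YRed dom hη :=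
  S.projDag dom (S.wY dom hη) ν Ωbar N ∘L fderiv ℂ (S.Fred hη ν f φhat) φbar ∘L
      S.projDag dom (S.wX dom hη) ν Ωbar N
    + WL1.diag (S.wX dom hη) (S.wY dom hη) (S.tailSymb dom ν Ωbar N)
        (S.exists_bound_tail dom hη ν Ωbar N)

/-- `A_red`: a given matrix on the Galerkin indices, and multiplication by
`λ_n = (ν ñ² + i Ω̄ n₄)⁻¹` on the others. -/
def Aapp (hη : 1 < η) {ν Ωbar : ℝ} (hν : 0 < ν) (hΩ : Ωbar ≠ 0) (N : ℕ)
    (AN : (S.Edag dom ν Ωbar N → ℂ) →ₗ[ℂ] (S.Edag dom ν Ωbar N → ℂ)) :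
    S.YRed dom hη →L[ℂ] S.XRed dom hη :=
  have : Finite (S.Edag dom ν Ωbar N) := S.Edag_finite dom hν hΩ N
  LinearMap.toContinuousLinearMap
      (WL1.ofFinite (S.wX dom hη) _ (S.Edag_finite dom hν hΩ N) ∘ₗ AN) ∘L
      WL1.restrict (S.wY dom hη) (S.Edag dom ν Ωbar N)
    + WL1.diag (S.wY dom hη) (S.wX dom hη) (fun i => (S.tailSymb dom ν Ωbar N i)⁻¹)
        (S.exists_bound_inv dom hη hν hΩ N)

end SymAction

/-- The radius `r_min`. -/
def rMin (Y₀ Z₀ Z₁ Z₂ : ℝ) : ℝ :=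
  (1 - (Z₀ + Z₁) - Real.sqrt ((1 - (Z₀ + Z₁)) ^ 2 - 2 * Y₀ * Z₂)) / Z₂

/-- The radius `r_max`. -/
def rMax (Z₀ Z₁ Z₂ : ℝ) : ℝ := (1 - (Z₀ + Z₁)) / Z₂

end

end NSOrbit

open NSOrbit

open scoped ComplexConjugate Matrix
namespace NSOrbit
noncomputable section

/-! ### Weighted `ℓ¹` spaces: completeness and coordinate vectors. -/

namespace WL1

variable {ι : Type*} {w w' : ι → {r : ℝ // 0 < r}}

/-! Existence is a Newton-Kantorovich argument. `𝓕^red` is the sum of a continuous bilinear, a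
continuous linear and a constant part (`Fred_eq`), so the mean value formula with the derivative at
the midpoint is exact (`Fred_sub`). With `q = Z₀ + Z₁` the bounds give `‖I - A D𝓕(φ)‖ ≤ q + Z₂ ‖φ -
φ̄‖`. Hence `I - A𝓕` has Lipschitz constant `q + Z₂ R` on the ball of radius `R`, and it maps the
ball of radius `r` into itself once `Y₀ + q r + Z₂ r² / 2 ≤ r` (`exists_zero_of_quadratic`). Its
fixed point is a zero because `A` is injective: `A D𝓕(φ̄)` is invertible, so `A` is onto, its finite
block is onto and therefore invertible, and the rest of `A` is diagonal without zeros
(`Aapp_injective`).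

Continuity of the bilinear part uses that transport costs one space derivative, while the target
weights allow two space derivatives or one time derivative. The surplus is a factor of order
`|n₄|^(-1/2)` (`le_order21_mul_gain`, `bilF_sum_le`).

The same surplus shows that the frequency of the zero does not vanish (`freq_ne_zero`). If it did,
the derivative at the zero would lose its only term of full order in `n₄`; on coordinate vectors
with `n₄ → ∞` and fixed `ñ²` it would then be small relative to their norms, whereas `‖I - A D𝓕‖ <
1` bounds it from below.

`Σ` and `Π` are inverse isometries between reduced and `G`-invariant sequences (`Pr_Sig`, `Sig_Pr`,
`hasSum_norm_red`). Since `F` is `G`-equivariant, the reduced equations imply all the equations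
(`vortF_eq_zero`). Complex conjugation is an isometry that fixes `φ̄` and maps zeros to zeros, so
local uniqueness makes the zero real (`Fred_conjX_eq_zero`).

The reduced problem does not impose the divergence constraint; it follows from an energy estimate.
The divergence `d` of a real solution is transported by the real divergence free field `Mω` and
damped by viscosity. Pairing with `d` removes the transport and leaves `∑ ν ñ² |d_n|² = 0`
(`div_eq_zero`). As the frequency is nonzero, the coefficients with `ñ = 0` vanish too
(`eq_zero_of_sp_eq_zero`), so `ω` is the curl of `u = Mω` (`curl_M`). The momentum residual then has
zero curl, hence is a gradient, and this defines the pressure (`momentum`). Exponential decay of the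
coefficients makes all series real analytic and justifies termwise calculus
(`hasFPowerSeriesOnBall_synth`, `solvesNS`). -/

instance : CompleteSpace (WL1 w) := by
  have norm_one : ∀ b : lp (fun _ : ι => ℂ) 1, ‖b‖ = ∑' i, ‖b i‖ := fun b => by
    rw [lp.norm_eq_tsum_rpow (by simp)]; simp
  have norm_w : ∀ (i : ι) (z : ℂ), ‖((w i : ℝ) : ℂ) * z‖ = w i * ‖z‖ := fun i z => by
    rw [norm_mul, Complex.norm_real, Real.norm_eq_abs, abs_of_pos (w i).2]
  -- Multiplication by the weights is an isometry onto the unweighted `ℓ¹`, whose completeness is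
  -- known.
  let T : WL1 w → lp (fun _ : ι => ℂ) 1 := fun a =>
    ⟨fun i => ((w i : ℝ) : ℂ) * a i, memℓp_gen (by
      simpa only [ENNReal.toReal_one, Real.rpow_one, norm_w] using a.summable)⟩
  have hT : Isometry T := by
    refine Isometry.of_dist_eq fun a b => ?_
    rw [dist_eq_norm, dist_eq_norm, norm_one, norm_def]
    refine tsum_congr fun i => ?_
    change ‖((w i : ℝ) : ℂ) * a i - ((w i : ℝ) : ℂ) * b i‖ = _
    rw [← mul_sub, norm_w]; rfl
  have hs : Function.Surjective T := fun b => by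
    have hb : Summable fun i => ‖b i‖ := by simpa using (lp.memℓp b).summable (by simp)
    have hw : ∀ i, ((w i : ℝ) : ℂ) ≠ 0 := fun i => by exact_mod_cast (w i).2.ne'
    have e : ∀ i, ((w i : ℝ) : ℂ) * (((w i : ℝ) : ℂ)⁻¹ * b i) = b i := fun i => by
      rw [← mul_assoc, mul_inv_cancel₀ (hw i), one_mul]
    refine ⟨mk (fun i => ((w i : ℝ) : ℂ)⁻¹ * b i) (hb.congr fun i => by rw [← norm_w, e]), ?_⟩
    ext i
    exact e i
  exact (IsometryEquiv.mk' T (Function.surjInv hs) (Function.surjInv_eq hs) hT).completeSpace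

theorem ofFinite_apply (s : Set ι) (hs : s.Finite) (v : s → ℂ) (i : s) :
    ofFinite w s hs v i = v i := by
  change (open Classical in if h : (i : ι) ∈ s then v ⟨i, h⟩ else 0) = v i
  simp

theorem ofFinite_apply_of_notMem (s : Set ι) (hs : s.Finite) (v : s → ℂ) {i : ι} (hi : i ∉ s) :
    ofFinite w s hs v i = 0 := by
  change (open Classical in if h : (i : ι) ∈ s then v ⟨i, h⟩ else 0) = 0
  simp [hi]

open Classical in
/-- The coordinate vectors. -/
def single (w : ι → {r : ℝ // 0 < r}) (i : ι) : WL1 w :=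
  mk (fun k => if k = i then 1 else 0)
    (summable_of_ne_finset_zero (s := {i}) fun k hk => by simp [by simpa using hk])

open Classical in
theorem single_apply (i k : ι) : single w i k = if k = i then 1 else 0 := rfl

theorem norm_single (i : ι) : ‖single w i‖ = w i := by
  rw [norm_def, tsum_eq_single i fun k hk => by simp [single_apply, hk]]
  simp [single_apply]

end WL1

/-! ### Newton-Kantorovich for quadratic maps. -/

section Newton

variable {E F : Type*} [NormedAddCommGroup E] [NormedSpace ℂ E] [CompleteSpace E]
  [NormedAddCommGroup F] [NormedSpace ℂ F]

/-- A Newton-Kantorovich theorem for quadratic maps. -/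
theorem exists_zero_of_quadratic {f : E → F} {f' : E → E →L[ℂ] F} {A : F →L[ℂ] E}
    (hquad : ∀ x y, f x - f y = f' ((2 : ℂ)⁻¹ • (x + y)) (x - y))
    (hA : Function.Injective A) {x₀ : E} {Y q Z : ℝ} (hZ : 0 ≤ Z)
    (bY : ‖A (f x₀)‖ ≤ Y)
    (bq : ∀ x, ‖ContinuousLinearMap.id ℂ E - A ∘L f' x‖ ≤ q + Z * ‖x - x₀‖)
    {r : ℝ} (hr : Y + q * r + Z * r ^ 2 / 2 ≤ r) (hr0 : 0 ≤ r) (hr1 : q + Z * r < 1) :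
    ∃ x ∈ Metric.closedBall x₀ r, f x = 0 ∧
      ∀ R, r ≤ R → q + Z * R < 1 → ∀ y ∈ Metric.closedBall x₀ R, f y = 0 → y = x := by
  let T : E → E := fun x => x - A (f x)
  have hT : ∀ x y, T x - T y =
      (ContinuousLinearMap.id ℂ E - A ∘L f' ((2 : ℂ)⁻¹ • (x + y))) (x - y) := fun x y => by
    have : T x - T y = (x - y) - A (f x - f y) := by simp only [T, map_sub]; abel
    rw [this, hquad]; rfl
  have hmid : ∀ x y, (2 : ℂ)⁻¹ • (x + y) - x₀ = (2 : ℂ)⁻¹ • ((x - x₀) + (y - x₀)) := fun x y => by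
    module
  have h2 : ‖(2 : ℂ)⁻¹‖ = 1 / 2 := by simp
  -- The midpoint is no farther from `x₀` than the average of the two distances. With `y = x₀` this
  -- yields the factor `1/2` in `Z * r ^ 2 / 2`; on a ball of radius `R` it yields the rate `q + Z *
  -- R`.
  have hlip : ∀ x y, ‖T x - T y‖ ≤ (q + Z * ((‖x - x₀‖ + ‖y - x₀‖) / 2)) * ‖x - y‖ := fun x y => by
    rw [hT]
    refine (ContinuousLinearMap.le_opNorm _ _).trans
      (mul_le_mul_of_nonneg_right ((bq _).trans ?_) (norm_nonneg _))
    rw [hmid, norm_smul, h2]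
    have := norm_add_le (x - x₀) (y - x₀)
    nlinarith
  have hball : ∀ R, ∀ x ∈ Metric.closedBall x₀ R, ∀ y ∈ Metric.closedBall x₀ R,
      ‖T x - T y‖ ≤ (q + Z * R) * ‖x - y‖ := fun R x hx y hy => by
    rw [mem_closedBall_iff_norm] at hx hy
    refine (hlip x y).trans (mul_le_mul_of_nonneg_right ?_ (norm_nonneg _))
    nlinarith
  have hq : 0 ≤ q := by
    have := (norm_nonneg _).trans (bq x₀)
    simpa using this
  have hmaps : Set.MapsTo T (Metric.closedBall x₀ r) (Metric.closedBall x₀ r) := fun x hx => by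
    rw [mem_closedBall_iff_norm] at hx ⊢
    have e : T x - x₀ = (T x - T x₀) - A (f x₀) := by simp only [T]; abel
    rw [e]
    refine (norm_sub_le _ _).trans ((add_le_add (hlip x x₀) bY).trans (le_trans ?_ hr))
    rw [sub_self, norm_zero, add_zero]
    have h1 : q * ‖x - x₀‖ ≤ q * r := mul_le_mul_of_nonneg_left hx hq
    have h3 : ‖x - x₀‖ * ‖x - x₀‖ ≤ r * r := mul_self_le_mul_self (norm_nonneg _) hx
    nlinarith [mul_le_mul_of_nonneg_left h3 hZ]
  have hc : ContractingWith ⟨q + Z * r, by positivity⟩ (hmaps.restrict T _ _) := by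
    refine ⟨by exact_mod_cast hr1, LipschitzWith.of_dist_le_mul fun x y => ?_⟩
    rw [Subtype.dist_eq, Subtype.dist_eq, dist_eq_norm, dist_eq_norm]
    exact hball r _ x.2 _ y.2
  obtain ⟨x, hx, hfix, -⟩ := hc.exists_fixedPoint' Metric.isClosed_closedBall.isComplete hmaps
    (x := x₀) (Metric.mem_closedBall_self hr0) (edist_ne_top _ _)
  refine ⟨x, hx, ?_, fun R hR hR1 y hy hy0 => ?_⟩
  · have h : A (f x) = 0 := by
      have : x - A (f x) = x := hfix
      simpa using this
    exact hA (h.trans (map_zero A).symm)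
  · have hx0 : T x = x := hfix
    have hy1 : T y = y := by simp [T, hy0]
    have h := hball R y hy x (Metric.closedBall_subset_closedBall hR hx)
    rw [hx0, hy1] at h
    by_contra hne
    have : 0 < ‖y - x‖ := norm_pos_iff.2 (sub_ne_zero.2 hne)
    nlinarith

end Newton

/-- An admissible radius for the Newton-Kantorovich theorem. -/
theorem exists_radius {Y q Z : ℝ} (hY : 0 ≤ Y) (hZ : 0 ≤ Z) (hq : q < 1)
    (hdisc : 2 * Y * Z < (1 - q) ^ 2) : ∃ r, 0 ≤ r ∧ Y + q * r + Z * r ^ 2 / 2 ≤ r ∧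
      q + Z * r < 1 ∧ (Z ≠ 0 → r = (1 - q - Real.sqrt ((1 - q) ^ 2 - 2 * Y * Z)) / Z) := by
  -- For `Z = 0` the inequality is linear and `Y / (1 - q)` is its smallest solution.
  rcases hZ.eq_or_lt with rfl | hZ
  · refine ⟨Y / (1 - q), div_nonneg hY (by linarith), ?_, by linarith, fun h => absurd rfl h⟩
    have h : Y / (1 - q) * (1 - q) = Y := div_mul_cancel₀ _ (by linarith)
    linarith
  · set s := Real.sqrt ((1 - q) ^ 2 - 2 * Y * Z) with hs
    have hs0 : 0 < s := Real.sqrt_pos.2 (by linarith)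
    have hss : s ^ 2 = (1 - q) ^ 2 - 2 * Y * Z := Real.sq_sqrt (by linarith)
    have hle : s ≤ 1 - q := Real.sqrt_le_iff.2 ⟨by linarith, by nlinarith⟩
    -- The radius is the smaller root of `Z r² / 2 - (1 - q) r + Y`, so the required inequality is
    -- an equality and `q + Z r = 1 - s < 1`.
    have hr : Z * ((1 - q - s) / Z) = 1 - q - s := mul_div_cancel₀ _ hZ.ne'
    refine ⟨(1 - q - s) / Z, div_nonneg (by linarith) hZ.le, ?_, by rw [hr]; linarith, fun _ => rfl⟩
    set r := (1 - q - s) / Z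
    have h1 : Z * (Y + q * r + Z * r ^ 2 / 2 - r) = 0 := by
      have : Z * (Y + q * r + Z * r ^ 2 / 2 - r) =
        Z * Y + q * (Z * r) + (Z * r) ^ 2 / 2 - Z * r := by ring
      rw [this, hr]; nlinarith
    have := (mul_eq_zero.1 h1).resolve_left hZ.ne'
    linarith

/-! ### Injectivity of `A_red`. -/

namespace SymAction

variable {G : Type*} [Group G] (S : SymAction G) [Fintype G] {dom : Set J} {η : ℝ}

/-- An index whose symbol vanishes satisfies `0 ≤ N` and so lies in the Galerkin set, as does the
frequency index. -/
theorem tailSymb_ne_zero {ν Ωbar : ℝ} {N : ℕ} {i : Option (S.Jred dom)}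
    (hi : i ∉ S.Edag dom ν Ωbar N) : S.tailSymb dom ν Ωbar N i ≠ 0 := by
  unfold tailSymb
  rw [if_neg hi]
  rcases i with _ | j
  · exact absurd (fun j hj => by simp at hj) hi
  · intro h
    refine hi fun k hk => ?_
    obtain rfl : j = k := by simpa using hk
    have h0 : symb ν Ωbar j.1.1.1 = 0 := h
    rw [h0, norm_zero]
    positivity

theorem Aapp_apply_of_mem (hη : 1 < η) {ν Ωbar : ℝ} (hν : 0 < ν) (hΩ : Ωbar ≠ 0) (N : ℕ)
    (AN : (S.Edag dom ν Ωbar N → ℂ) →ₗ[ℂ] (S.Edag dom ν Ωbar N → ℂ)) (y : S.YRed dom hη)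
    (i : S.Edag dom ν Ωbar N) : S.Aapp hη hν hΩ N AN y i = AN (fun k => y k) i := by
  change WL1.ofFinite (S.wX dom hη) _ (S.Edag_finite dom hν hΩ N) (AN fun k => y k) i +
    (S.tailSymb dom ν Ωbar N i)⁻¹ * y i = _
  rw [WL1.ofFinite_apply]
  simp [tailSymb]

theorem Aapp_apply_of_notMem (hη : 1 < η) {ν Ωbar : ℝ} (hν : 0 < ν) (hΩ : Ωbar ≠ 0) (N : ℕ)
    (AN : (S.Edag dom ν Ωbar N → ℂ) →ₗ[ℂ] (S.Edag dom ν Ωbar N → ℂ)) (y : S.YRed dom hη)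
    {i : Option (S.Jred dom)} (hi : i ∉ S.Edag dom ν Ωbar N) :
    S.Aapp hη hν hΩ N AN y i = (S.tailSymb dom ν Ωbar N i)⁻¹ * y i := by
  change WL1.ofFinite (S.wX dom hη) _ (S.Edag_finite dom hν hΩ N) (AN fun k => y k) i +
    (S.tailSymb dom ν Ωbar N i)⁻¹ * y i = _
  rw [WL1.ofFinite_apply_of_notMem _ _ _ hi, zero_add]

/-- `A_red` is injective as soon as it is an approximate left inverse of some operator. -/
theorem Aapp_injective (hη : 1 < η) {ν Ωbar : ℝ} (hν : 0 < ν) (hΩ : Ωbar ≠ 0) (N : ℕ)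
    (AN : (S.Edag dom ν Ωbar N → ℂ) →ₗ[ℂ] (S.Edag dom ν Ωbar N → ℂ))
    {B : S.XRed dom hη →L[ℂ] S.YRed dom hη}
    (hB : ‖ContinuousLinearMap.id ℂ (S.XRed dom hη) - S.Aapp hη hν hΩ N AN ∘L B‖ < 1) :
    Function.Injective (S.Aapp hη hν hΩ N AN) := by
  have hfin : Finite (S.Edag dom ν Ωbar N) := S.Edag_finite dom hν hΩ N
  have hsurj : ∀ x, ∃ y, S.Aapp hη hν hΩ N AN (B y) = x := by
    intro x
    -- `A ∘ B = I - (I - A ∘ B)` is invertible by the Neumann series.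
    let U := Units.oneSub (ContinuousLinearMap.id ℂ (S.XRed dom hη) -
      S.Aapp hη hν hΩ N AN ∘L B) hB
    have hU : (U : S.XRed dom hη →L[ℂ] S.XRed dom hη) = S.Aapp hη hν hΩ N AN ∘L B :=
      sub_sub_cancel _ _
    have h1 : (U : S.XRed dom hη →L[ℂ] S.XRed dom hη) *
      (↑U⁻¹ : S.XRed dom hη →L[ℂ] S.XRed dom hη) = 1 := U.mul_inv
    refine ⟨(↑U⁻¹ : S.XRed dom hη →L[ℂ] S.XRed dom hη) x, ?_⟩
    rw [hU] at h1
    exact congrArg (fun L : S.XRed dom hη →L[ℂ] S.XRed dom hη => L x) h1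
  -- The Galerkin coordinates of `A y` depend only on those of `y`, so `AN` inherits surjectivity;
  -- being an endomorphism of a finite dimensional space it is then injective.
  have hAN : Function.Injective AN := by
    rw [LinearMap.injective_iff_surjective]
    intro v
    obtain ⟨y, hy⟩ := hsurj (WL1.ofFinite (S.wX dom hη) _ (S.Edag_finite dom hν hΩ N) v)
    refine ⟨fun k => B y k, funext fun i => ?_⟩
    rw [← S.Aapp_apply_of_mem hη hν hΩ N AN, hy, WL1.ofFinite_apply]
  refine (injective_iff_map_eq_zero _).2 fun y hy => ?_
  ext i
  by_cases hi : i ∈ S.Edag dom ν Ωbar N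
  · have h0 : AN (fun k => y k) = 0 := funext fun i => by
      rw [← S.Aapp_apply_of_mem hη hν hΩ N AN, hy]; rfl
    have := congrFun (hAN (h0.trans (map_zero AN).symm)) ⟨i, hi⟩
    exact this
  · have h := S.Aapp_apply_of_notMem hη hν hΩ N AN y hi
    rw [hy] at h
    exact (mul_eq_zero.1 h.symm).resolve_left (inv_ne_zero (S.tailSymb_ne_zero hi))

end SymAction

/-! ### Group laws for index maps, phases and multipliers. -/

namespace SymAction

variable {G : Type*} [Group G] (S : SymAction G)

theorem C_mulVec_tau (g : G) (v : Fin 3 → ℤ) (m : Fin 3) :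
    (S.C g *ᵥ v) (S.τ g m) = (S.ρ g m : ℤ) * v m := signedPerm_mulVec _ _ _ _

theorem C_mul (g h : G) : S.C (g * h) = S.C g * S.C h := S.mat_mul g h

theorem rho_sq (g : G) (m : Fin 3) : (S.ρ g m : ℤ) * (S.ρ g m : ℤ) = 1 := Int.units_coe_mul_self _

/-- A signed permutation matrix determines its permutation: column `m` of `C (g * h)` has its only
nonzero entry in row `τ (g * h) m`, while the product of the matrices has a unit in row `τ g (τ h
m)`. -/
theorem tau_mul (g h : G) (m : Fin 3) : S.τ (g * h) m = S.τ g (S.τ h m) := by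
  have h1 : (S.C (g * h) *ᵥ Pi.single m 1) (S.τ g (S.τ h m)) = S.ρ g (S.τ h m) * S.ρ h m := by
    rw [C_mul, ← Matrix.mulVec_mulVec, C_mulVec_tau, C_mulVec_tau]; simp
  by_contra hne
  rw [Matrix.mulVec_single_one] at h1
  have h2 : (S.C (g * h)).col m (S.τ g (S.τ h m)) = 0 := by
    simp [C, signedPerm, Matrix.col, Ne.symm hne]
  rw [h2] at h1
  have := (S.ρ g (S.τ h m) * S.ρ h m).ne_zero
  exact this (by exact_mod_cast h1.symm)

theorem rho_mul (g h : G) (m : Fin 3) :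
    (S.ρ (g * h) m : ℤ) = S.ρ g (S.τ h m) * S.ρ h m := by
  have h1 := S.C_mulVec_tau (g * h) (Pi.single m 1) m
  rw [S.tau_mul, C_mul, ← Matrix.mulVec_mulVec, C_mulVec_tau, C_mulVec_tau] at h1
  simpa using h1.symm

theorem transpose_mul_C (g : G) : (S.C g)ᵀ * S.C g = 1 := by
  ext i k
  rw [Matrix.mul_apply, ← Equiv.sum_comp (S.τ g)]
  simp only [Matrix.transpose_apply, C, signedPerm, Matrix.of_apply, EmbeddingLike.apply_eq_iff_eq]
  rw [Finset.sum_eq_single i (fun b _ hb => by simp [hb]) (by simp)]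
  by_cases h : i = k
  · subst h; simp [S.rho_sq g i]
  · simp [h]

theorem det_sq (g : G) : (S.C g).det * (S.C g).det = 1 := by
  have := congrArg Matrix.det (S.transpose_mul_C g)
  simpa using this

theorem ext_Z4 {n k : Z4} (h : sp n = sp k) (h3 : n 3 = k 3) : n = k := by
  funext i
  exact Fin.lastCases h3 (fun l => congrFun h l) i

theorem sp_add (n k : Z4) : sp (n + k) = sp n + sp k := rfl
theorem sp_sub (n k : Z4) : sp (n - k) = sp n - sp k := rfl
theorem sp_neg (n : Z4) : sp (-n) = -sp n := rfl

theorem moveIndex_sub (g : G) (n k : Z4) :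
    S.moveIndex g (n - k) = S.moveIndex g n - S.moveIndex g k :=
  ext_Z4 (by simp only [sp_moveIndex, sp_sub, Matrix.mulVec_sub])
    (by simp only [Pi.sub_apply, moveIndex_last])

theorem moveIndex_neg (g : G) (n : Z4) : S.moveIndex g (-n) = -S.moveIndex g n :=
  ext_Z4 (by simp only [sp_moveIndex, sp_neg, Matrix.mulVec_neg])
    (by simp only [Pi.neg_apply, moveIndex_last])

theorem moveIndex_mul (g h : G) (n : Z4) :
    S.moveIndex (g * h) n = S.moveIndex g (S.moveIndex h n) :=
  ext_Z4 (by simp only [sp_moveIndex, C_mul, Matrix.mulVec_mulVec])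
    (by simp only [moveIndex_last])

/-- The laws of `SymAction` do not mention the unit; `C 1` is idempotent and orthogonal, hence the
identity. -/
theorem C_one : S.C 1 = 1 := by
  have h := S.C_mul 1 1
  rw [mul_one] at h
  have h2 := congrArg ((S.C 1)ᵀ * ·) h
  simp only [← Matrix.mul_assoc, transpose_mul_C, Matrix.one_mul] at h2
  exact h2.symm

theorem moveIndex_one (n : Z4) : S.moveIndex 1 n = n :=
  ext_Z4 (by rw [sp_moveIndex, C_one, Matrix.one_mulVec]) (S.moveIndex_last _ _)

theorem tau_one (m : Fin 3) : S.τ 1 m = m := by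
  have := S.tau_mul 1 1 m
  rw [mul_one] at this
  exact ((S.τ 1).injective this).symm

/-- The permutation `n ↦ (C_g ñ, n₄)` of `ℤ⁴`. -/
def moveEquiv (g : G) : Z4 ≃ Z4 where
  toFun := S.moveIndex g
  invFun := S.moveIndex g⁻¹
  left_inv n := by rw [← moveIndex_mul, inv_mul_cancel, moveIndex_one]
  right_inv n := by rw [← moveIndex_mul, mul_inv_cancel, moveIndex_one]

theorem sp_moveIndex_tau (g : G) (n : Z4) (m : Fin 3) :
    sp (S.moveIndex g n) (S.τ g m) = S.ρ g m * sp n m := by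
  rw [sp_moveIndex, C_mulVec_tau]

theorem sqNorm_moveIndex (g : G) (n : Z4) : sqNorm (S.moveIndex g n) = sqNorm n := by
  rw [sqNorm, sqNorm, ← Equiv.sum_comp (S.τ g)]
  refine Finset.sum_congr rfl fun m _ => ?_
  rw [sp_moveIndex_tau, mul_pow, sq, S.rho_sq, one_mul]

theorem sp_moveIndex_eq_zero (g : G) (n : Z4) : sp (S.moveIndex g n) = 0 ↔ sp n = 0 := by
  constructor
  · intro h
    funext m
    have := congrFun h (S.τ g m)
    rw [sp_moveIndex_tau] at this
    simpa using this
  · intro h; rw [sp_moveIndex, h, Matrix.mulVec_zero]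

theorem CR_mulVec_tau (g : G) (v : Fin 3 → ℝ) (m : Fin 3) :
    (S.CR g *ᵥ v) (S.τ g m) = ((S.ρ g m : ℤ) : ℝ) * v m := by
  simp [Matrix.mulVec, dotProduct, CR, C, signedPerm, apply_ite]

theorem CR_transpose_mulVec (g : G) (v : Fin 3 → ℝ) (m : Fin 3) :
    ((S.CR g)ᵀ *ᵥ v) m = ((S.ρ g m : ℤ) : ℝ) * v (S.τ g m) := by
  simp [Matrix.mulVec, dotProduct, CR, C, signedPerm, apply_ite]

/-- The phase `2π (ñ · C_gᵀ C̃_g + n₄ D_g)`, divided by `2π`. -/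
def phase (g : G) (n : Z4) : ℝ :=
  ∑ l, (sp n l : ℝ) * ((S.CR g)ᵀ *ᵥ S.shift g) l + (n 3 : ℝ) * S.timeShift g

/-- The factor by which the shifts multiply the Fourier mode `n`. -/
def twist (g : G) (n : Z4) : ℂ := Complex.exp (2 * Real.pi * Complex.I * (S.phase g n : ℂ))

theorem alpha_eq (g : G) (j : J) :
    S.alpha g j = ((S.C g).det : ℂ) * ((S.ρ g j.2 : ℤ) : ℂ) * S.twist g j.1.1 := rfl

theorem sum_sp_mul_transpose (g : G) (n : Z4) (v : Fin 3 → ℝ) :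
    ∑ l, (sp n l : ℝ) * ((S.CR g)ᵀ *ᵥ v) l = ∑ l, (sp (S.moveIndex g n) l : ℝ) * v l := by
  rw [← Equiv.sum_comp (S.τ g) fun l => (sp (S.moveIndex g n) l : ℝ) * v l]
  refine Finset.sum_congr rfl fun l _ => ?_
  rw [CR_transpose_mulVec, sp_moveIndex_tau]; push_cast; ring

theorem sum_sp_mul_CR (g : G) (n : Z4) (v : Fin 3 → ℝ) :
    ∑ l, (sp (S.moveIndex g n) l : ℝ) * (S.CR g *ᵥ v) l = ∑ l, (sp n l : ℝ) * v l := by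
  rw [← Equiv.sum_comp (S.τ g)]
  refine Finset.sum_congr rfl fun l _ => ?_
  have h : ((S.ρ g l : ℤ) : ℝ) * ((S.ρ g l : ℤ) : ℝ) = 1 := by exact_mod_cast S.rho_sq g l
  rw [CR_mulVec_tau, sp_moveIndex_tau]; push_cast
  linear_combination (sp n l : ℝ) * v l * h

theorem twist_add (g : G) (n k : Z4) : S.twist g (n + k) = S.twist g n * S.twist g k := by
  rw [twist, twist, twist, ← Complex.exp_add, ← mul_add]
  congr 2
  rw [← Complex.ofReal_add, phase, phase, phase]
  congr 1
  simp only [sp_add, Pi.add_apply, Int.cast_add, add_mul, Finset.sum_add_distrib]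
  ring

theorem twist_eq (g : G) (n : Z4) :
    S.twist g n = Complex.exp (((2 * Real.pi * S.phase g n : ℝ) : ℂ) * Complex.I) := by
  rw [twist]; congr 1; push_cast; ring

theorem twist_neg (g : G) (n : Z4) : S.twist g (-n) = conj (S.twist g n) := by
  rw [twist_eq, twist_eq, ← Complex.exp_conj, map_mul, Complex.conj_I, Complex.conj_ofReal]
  have : S.phase g (-n) = - S.phase g n := by
    simp only [phase, sp_neg, Pi.neg_apply, Int.cast_neg, neg_mul, Finset.sum_neg_distrib]
    ring
  rw [this]
  congr 1
  push_cast; ring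

theorem norm_twist (g : G) (n : Z4) : ‖S.twist g n‖ = 1 := by
  rw [twist_eq, Complex.norm_exp_ofReal_mul_I]

/-- The shifts compose only modulo integers. Paired with integer frequencies, these defects change
the phase by an integer, which the exponential does not see. -/
theorem twist_mul (g h : G) (n : Z4) :
    S.twist (g * h) n = S.twist h n * S.twist g (S.moveIndex h n) := by
  choose k hk using S.shift_mul g h
  obtain ⟨k4, hk4⟩ := S.timeShift_mul g h
  have e : S.phase (g * h) n = S.phase h n + S.phase g (S.moveIndex h n) +
      ((∑ l, sp (S.moveIndex (g * h) n) l * k l + n 3 * k4 : ℤ) : ℝ) := by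
    simp only [phase, sum_sp_mul_transpose, ← moveIndex_mul, moveIndex_last]
    have h1 : ∑ l, (sp (S.moveIndex (g * h) n) l : ℝ) * S.shift (g * h) l
      = ∑ l, (sp (S.moveIndex h n) l : ℝ) * S.shift h l
        + ∑ l, (sp (S.moveIndex (g * h) n) l : ℝ) * S.shift g l
        + ∑ l, (sp (S.moveIndex (g * h) n) l : ℝ) * k l := by
      rw [← S.sum_sp_mul_CR g (S.moveIndex h n), ← moveIndex_mul, ← Finset.sum_add_distrib,
        ← Finset.sum_add_distrib]
      refine Finset.sum_congr rfl fun l _ => ?_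
      rw [hk]
      change _ * ((S.CR g *ᵥ S.shift h) l + _ + _) = _
      ring
    rw [h1, hk4]
    push_cast
    ring
  rw [twist, twist, twist, e, ← Complex.exp_add]
  rw [Complex.exp_eq_exp_iff_exists_int]
  refine ⟨∑ l, sp (S.moveIndex (g * h) n) l * k l + n 3 * k4, ?_⟩
  push_cast
  ring

theorem beta_mul (g h : G) (j : J) : S.beta (g * h) j = S.beta g (S.beta h j) :=
  Prod.ext (Subtype.ext (S.moveIndex_mul g h _)) (S.tau_mul g h _)

theorem beta_one (j : J) : S.beta 1 j = j :=
  Prod.ext (Subtype.ext (S.moveIndex_one _)) (S.tau_one _)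

theorem beta_inv_beta (g : G) (j : J) : S.beta g⁻¹ (S.beta g j) = j := by
  rw [← beta_mul, inv_mul_cancel, beta_one]

/-- This cocycle law makes `g ↦ γ_g` compatible with products. On the stabilizer of `j` it says that
`g ↦ alpha g j` is a character. -/
theorem alpha_mul (g h : G) (j : J) :
    S.alpha (g * h) j = S.alpha h j * S.alpha g (S.beta h j) := by
  have h1 : (((S.C (g * h)).det : ℤ) : ℂ) = (S.C g).det * (S.C h).det := by
    rw [C_mul, Matrix.det_mul]; push_cast; rfl
  have h2 : ((S.ρ (g * h) j.2 : ℤ) : ℂ) = (S.ρ g (S.τ h j.2) : ℤ) * (S.ρ h j.2 : ℤ) := by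
    rw [rho_mul]; push_cast; rfl
  rw [alpha_eq, alpha_eq, alpha_eq, h1, h2, twist_mul]
  change _ = _ * ((S.C g).det * ((S.ρ g (S.τ h j.2) : ℤ) : ℂ) * S.twist g (S.moveIndex h j.1.1))
  ring

theorem norm_alpha (g : G) (j : J) : ‖S.alpha g j‖ = 1 := by
  have h1 : |(S.C g).det| = 1 := by
    rcases Int.isUnit_iff.1 (IsUnit.of_mul_eq_one _ (S.det_sq g)) with h | h <;> simp [h]
  have h2 : |(S.ρ g j.2 : ℤ)| = 1 := by
    rcases Int.units_eq_one_or (S.ρ g j.2) with h | h <;> simp [h]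
  rw [alpha_eq, norm_mul, norm_mul, norm_twist, Complex.norm_intCast, Complex.norm_intCast]
  rw [← Int.cast_abs, ← Int.cast_abs, h1, h2]
  simp

theorem alpha_ne_zero (g : G) (j : J) : S.alpha g j ≠ 0 := fun h => by
  have := S.norm_alpha g j
  simp [h] at this

/-- The reflected index `(-n, m)`. -/
def negJ (j : J) : J := (⟨-j.1.1, neg_ne_zero.2 j.1.2⟩, j.2)

theorem negJ_negJ (j : J) : negJ (negJ j) = j :=
  Prod.ext (Subtype.ext (neg_neg _)) rfl

theorem beta_negJ (g : G) (j : J) : S.beta g (negJ j) = negJ (S.beta g j) :=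
  Prod.ext (Subtype.ext (S.moveIndex_neg g _)) rfl

theorem alpha_negJ (g : G) (j : J) : S.alpha g (negJ j) = conj (S.alpha g j) := by
  rw [alpha_eq, alpha_eq, map_mul, map_mul, map_intCast, map_intCast]
  change _ * _ * S.twist g (-j.1.1) = _
  rw [twist_neg]; rfl

/-- Reflection of the index commutes with `β_g` and conjugates `α_g`. -/
theorem gam_conjSym {ω : J → ℂ} (h : ∀ g, S.gam g ω = ω) (g : G) :
    S.gam g (conjSym ω) = conjSym ω := by
  funext j
  have := congrFun (h g) (negJ j)
  change S.alpha g j * conj (ω (negJ (S.beta g j))) = conj (ω (negJ j))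
  rw [← this, ← beta_negJ, gam, map_mul, alpha_negJ, Complex.conj_conj]

theorem mem_orb_symm {i j : J} (h : i ∈ S.orb j) : j ∈ S.orb i := by
  obtain ⟨g, rfl⟩ := h
  exact ⟨g⁻¹, S.beta_inv_beta g j⟩

/-! ### Reduced indices, and the bijection between reduced and invariant sequences. -/

variable [Fintype G]

/-- The sum of a character over a finite group vanishes unless the character is trivial, in which
case it is the order of the group. -/
theorem mem_Jsym_iff {j : J} : j ∈ S.Jsym ↔ ∀ g, S.beta g j = j → S.alpha g j = 1 := by
  classical
  constructor
  · intro hj h hh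
    by_contra hne
    apply hj
    set s := ∑ g : G with S.beta g j = j, S.alpha g j with hs
    -- Translation by a stabilizing `h` permutes the summands and multiplies each by `alpha h j`.
    have e : s = S.alpha h j * s := by
      conv_lhs => rw [hs]
      rw [hs, Finset.mul_sum]
      symm
      refine Finset.sum_equiv (Equiv.mulRight h) (fun g => ?_) (fun g hg => ?_)
      · simp [beta_mul, hh]
      · simp [alpha_mul, hh]
    have : (1 - S.alpha h j) * s = 0 := by linear_combination e
    have h0 := (mul_eq_zero.1 this).resolve_left (sub_ne_zero.2 (Ne.symm hne))
    convert h0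
  · intro h
    change (∑ g : G with S.beta g j = j, S.alpha g j) ≠ 0
    rw [Finset.sum_congr rfl fun g hg => h g (by simpa using hg)]
    simp only [Finset.sum_const, nsmul_eq_mul, mul_one, ne_eq, Nat.cast_eq_zero,
      Finset.card_eq_zero]
    exact Finset.Nonempty.ne_empty ⟨1, by simp [beta_one]⟩

/-- Stabilizers along an orbit are conjugate, and the cocycle law carries triviality of the
character along. -/
theorem beta_mem_Jsym {j : J} (hj : j ∈ S.Jsym) (h : G) : S.beta h j ∈ S.Jsym := by
  rw [mem_Jsym_iff] at hj ⊢
  intro g hg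
  have hk : S.beta (h⁻¹ * g * h) j = j := by
    rw [mul_assoc, beta_mul, beta_mul, hg, beta_inv_beta]
  have h1 := S.alpha_mul h (h⁻¹ * g * h) j
  have e : h * (h⁻¹ * g * h) = g * h := by group
  rw [hj _ hk, hk, one_mul, e, alpha_mul] at h1
  exact mul_left_cancel₀ (S.alpha_ne_zero h j) (h1.trans (mul_one _).symm)

/-- The choice made in `alphaT` is immaterial here: two elements that send `j` to the same index
differ by a stabilizing one, on which `alpha` equals one. -/
theorem alphaT_beta {j : J} (hj : j ∈ S.Jsym) (g : G) :
    S.alphaT j (S.beta g j) = (S.alpha g j)⁻¹ := by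
  have hex : ∃ g', S.beta g' j = S.beta g j := ⟨g, rfl⟩
  unfold alphaT
  rw [dif_pos hex]
  set g' := hex.choose
  have hg' : S.beta g' j = S.beta g j := hex.choose_spec
  have hk : S.beta (g⁻¹ * g') j = j := by rw [beta_mul, hg', beta_inv_beta]
  have h1 := S.alpha_mul g (g⁻¹ * g') j
  rw [mul_inv_cancel_left, hk, (S.mem_Jsym_iff.1 hj) _ hk, one_mul] at h1
  rw [h1]

variable {dom : Set J} {η : ℝ} (hdom : S.IsFundamentalDomain dom)
include hdom

omit [Fintype G] in
theorem eq_of_mem_orb {j k : J} (hj : j ∈ dom) (hk : k ∈ dom) {i : J} (hij : i ∈ S.orb j)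
    (hik : i ∈ S.orb k) : j = k := by
  obtain ⟨l, -, hl⟩ := hdom i
  rw [hl j ⟨hj, S.mem_orb_symm hij⟩, hl k ⟨hk, S.mem_orb_symm hik⟩]

theorem exists_red {i : J} (hi : i ∈ S.Jsym) : ∃ (j : S.Jred dom) (g : G), S.beta g j = i := by
  obtain ⟨j, ⟨hj, ⟨g, rfl⟩⟩, -⟩ := hdom i
  refine ⟨⟨_, hj, S.beta_mem_Jsym hi g⟩, g⁻¹, ?_⟩
  exact S.beta_inv_beta g i

/-- Distinct elements of the fundamental domain have disjoint orbits, so one term of the series for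
`Σ` survives. -/
theorem Sig_beta (φ : S.Jred dom → ℂ) (j : S.Jred dom) (g : G) :
    S.Sig φ (S.beta g j) = φ j * (S.alpha g j)⁻¹ := by
  rw [Sig, tsum_eq_single j, S.alphaT_beta j.2.2]
  intro k hk
  rw [S.alphaT_eq_zero, mul_zero]
  exact fun h => hk (Subtype.ext (S.eq_of_mem_orb hdom k.2.1 j.2.1 h ⟨g, rfl⟩))

theorem Pr_Sig (φ : S.Jred dom → ℂ) : S.Pr dom (S.Sig φ) = φ := by
  funext j
  have h := S.Sig_beta hdom φ j 1
  rw [beta_one, (S.mem_Jsym_iff.1 j.2.2) 1 (S.beta_one _), inv_one, mul_one] at h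
  exact h

omit hdom in
theorem Sig_of_notMem (φ : S.Jred dom → ℂ) {i : J} (hi : i ∉ S.Jsym) : S.Sig φ i = 0 := by
  rw [Sig]
  convert tsum_zero with j
  rw [S.alphaT_eq_zero, mul_zero]
  rintro ⟨g, rfl⟩
  exact hi (S.beta_mem_Jsym j.2.2 g)

theorem gam_Sig (φ : S.Jred dom → ℂ) (g : G) : S.gam g (S.Sig φ) = S.Sig φ := by
  funext i
  rw [gam]
  by_cases hi : i ∈ S.Jsym
  · obtain ⟨j, h, rfl⟩ := S.exists_red hdom hi
    rw [← beta_mul, S.Sig_beta hdom, S.Sig_beta hdom, alpha_mul]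
    have h1 := S.alpha_ne_zero h j
    have h2 := S.alpha_ne_zero g (S.beta h j)
    field_simp
  · rw [S.Sig_of_notMem φ hi, S.Sig_of_notMem, mul_zero]
    intro h
    exact hi (by simpa [beta_inv_beta] using S.beta_mem_Jsym h g⁻¹)

omit hdom in
-- Some stabilizing `g` has `alpha g i ≠ 1`, and invariance under it reads `alpha g i * ω i = ω i`.
theorem eq_zero_of_gam {ω : J → ℂ} (h : ∀ g, S.gam g ω = ω) {i : J} (hi : i ∉ S.Jsym) :
    ω i = 0 := by
  rw [mem_Jsym_iff] at hi
  push Not at hi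
  obtain ⟨g, hg, hne⟩ := hi
  have h1 := congrFun (h g) i
  rw [gam, hg] at h1
  have : (S.alpha g i - 1) * ω i = 0 := by linear_combination h1
  exact (mul_eq_zero.1 this).resolve_left (sub_ne_zero.2 hne)

/-- With `Pr_Sig` and `gam_Sig` this makes `Σ` a bijection onto the invariant sequences, with
inverse `Π`. -/
theorem Sig_Pr {ω : J → ℂ} (h : ∀ g, S.gam g ω = ω) : S.Sig (S.Pr dom ω) = ω := by
  funext i
  by_cases hi : i ∈ S.Jsym
  · obtain ⟨j, g, rfl⟩ := S.exists_red hdom hi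
    have h1 := congrFun (h g) j
    rw [gam] at h1
    rw [S.Sig_beta hdom, Pr, ← h1]
    have := S.alpha_ne_zero g j
    field_simp
  · rw [S.Sig_of_notMem _ hi, S.eq_zero_of_gam h hi]

/-- `Jsym` is the disjoint union of the orbits of reduced indices, and an invariant summand is
constant on each orbit. -/
theorem hasSum_red {E : Type*} [NormedAddCommGroup E] [CompleteSpace E] {h : J → E}
    (h0 : ∀ i ∉ S.Jsym, h i = 0) (hinv : ∀ g i, h (S.beta g i) = h i) {s : E} (hs : HasSum h s) :
    HasSum (fun j : S.Jred dom => S.orbCard j • h j) s := by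
  let ψ : (Σ j : S.Jred dom, S.orb j) → J := fun q => q.2
  have hψ : Function.Injective ψ := by
    rintro ⟨j, i, hi⟩ ⟨k, i', hi'⟩ hq
    obtain rfl : i = i' := hq
    obtain rfl : j = k := Subtype.ext (S.eq_of_mem_orb hdom j.2.1 k.2.1 hi hi')
    rfl
  have hr : ∀ i ∉ Set.range ψ, h i = 0 := fun i hi => by
    refine h0 i fun hs => hi ?_
    obtain ⟨j, g, hg⟩ := S.exists_red hdom hs
    exact ⟨⟨j, i, g, hg⟩, rfl⟩
  refine ((hψ.hasSum_iff hr).2 hs).sigma fun j => ?_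
  have : Finite (S.orb j) := S.orb_finite j
  have := Fintype.ofFinite (S.orb (j : J))
  have e : ∀ i : S.orb (j : J), (h ∘ ψ) ⟨j, i⟩ = h j := by
    rintro ⟨_, g, rfl⟩
    exact hinv g j
  have h2 := hasSum_fintype fun i : S.orb (j : J) => (h ∘ ψ) ⟨j, i⟩
  simp only [e, Finset.sum_const, Finset.card_univ] at h2
  rw [orbCard, ← Nat.card_coe_set_eq, Nat.card_eq_fintype_card]
  simpa only [e] using h2

omit hdom [Fintype G] in
theorem norm_beta_of_gam {ω : J → ℂ} (h : ∀ g, S.gam g ω = ω) (g : G) (i : J) :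
    ‖ω (S.beta g i)‖ = ‖ω i‖ := by
  have h1 := congrFun (h g) i
  rw [gam] at h1
  rw [← h1, norm_mul, norm_alpha, one_mul]

omit hdom [Fintype G] in
theorem xi_beta (g : G) (i : J) : xi η (S.beta g i) = xi η i := S.xi_orb η ⟨g, rfl⟩

/-- The factor `|G.j|` in the reduced weights makes `Π` isometric on invariant sequences. -/
theorem hasSum_norm_red (hη : 1 < η) {ω : J → ℂ} (h : ∀ g, S.gam g ω = ω) {s : ℝ}
    (hs : HasSum (fun i => xi η i * ‖ω i‖) s) :
    HasSum (fun j : S.Jred dom => (S.wRed dom hη j : ℝ) * ‖S.Pr dom ω j‖) s := by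
  refine (S.hasSum_red hdom (fun i hi => ?_) (fun g i => ?_) hs).congr_fun fun j => ?_
  · rw [S.eq_zero_of_gam h hi, norm_zero, mul_zero]
  · rw [xi_beta, S.norm_beta_of_gam h]
  · rw [nsmul_eq_mul]
    exact mul_assoc (S.orbCard j : ℝ) (xi η j) ‖ω j‖

end SymAction

/-! ### Equivariance of the vorticity equation under complex conjugation. -/

/-- The spatial part of `n` as a complex vector. -/
def spC (n : Z4) : Fin 3 → ℂ := fun l => (sp n l : ℂ)

theorem spC_sub (n k : Z4) : spC (n - k) = spC n - spC k := by
  funext l; simp [spC, SymAction.sp_sub]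

theorem spC_neg (n : Z4) : spC (-n) = -spC n := by
  funext l; simp [spC, SymAction.sp_neg]

theorem M_eq (ω : FSeq) (n : Z4) (h : sp n ≠ 0) :
    M ω n = (Complex.I / (sqNorm n : ℂ)) • crossProduct (spC n) (ω n) := by
  funext l
  rw [M_apply, if_neg h]; rfl

theorem M_eq_zero (ω : FSeq) (n : Z4) (h : sp n = 0) : M ω n = 0 := by
  funext l
  rw [M_apply, if_pos h]; rfl

theorem M_smul (c : ℂ) (ω : FSeq) : M (c • ω) = c • M ω := by
  funext n
  exact Matrix.mulVec_smul (Mmat n) c (ω n)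

theorem M_add (ω ω' : FSeq) : M (ω + ω') = M ω + M ω' := by
  funext n
  exact Matrix.mulVec_add (Mmat n) (ω n) (ω' n)

theorem starD_smul_left (c : ℂ) (a b : FSeq) : starD (c • a) b = c • starD a b := by
  funext n l
  simp only [starD, conv, Pi.smul_apply, smul_eq_mul, Finset.mul_sum, ← tsum_mul_left, mul_assoc]

theorem starD_smul_right (c : ℂ) (a b : FSeq) : starD a (c • b) = c • starD a b := by
  funext n l
  simp only [starD, conv, Dx, Pi.smul_apply, smul_eq_mul, Finset.mul_sum, ← tsum_mul_left]
  refine Finset.sum_congr rfl fun m _ => tsum_congr fun k => ?_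
  ring

/-- The reflection `a ↦ (conj a_{-n})` on vector valued sequences. -/
def cjSeq (a : FSeq) : FSeq := fun n m => conj (a (-n) m)

theorem ext_conjSym (ω : J → ℂ) : ext (conjSym ω) = cjSeq (ext ω) := by
  funext n m
  by_cases h : n = 0
  · subst h; simp [ext, cjSeq]
  · simp [ext, cjSeq, h, conjSym]

theorem conj_cross (v w : Fin 3 → ℂ) (l : Fin 3) :
    conj (crossProduct v w l) = crossProduct (fun i => conj (v i)) (fun i => conj (w i)) l := by
  fin_cases l <;> simp [crossProduct]

theorem conj_spC_neg (n : Z4) (l : Fin 3) : conj (spC (-n) l) = -spC n l := by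
  rw [spC_neg, Pi.neg_apply, map_neg, spC, map_intCast]

theorem M_cjSeq (ω : FSeq) : M (cjSeq ω) = cjSeq (M ω) := by
  funext n l
  have hsp : sp (-n) = 0 ↔ sp n = 0 := by rw [SymAction.sp_neg, neg_eq_zero]
  by_cases h : sp n = 0
  · rw [M_eq_zero _ _ h, cjSeq, M_eq_zero _ _ (hsp.2 h)]; simp
  · rw [M_eq _ _ h, cjSeq, M_eq _ _ (hsp.not.2 h)]
    have e : sqNorm (-n) = sqNorm n := by simp [sqNorm, SymAction.sp_neg]
    simp only [Pi.smul_apply, smul_eq_mul, map_mul, map_div₀, Complex.conj_I, map_intCast, conj_cross,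
      conj_spC_neg, e]
    have : (fun i => -spC n i) = -spC n := rfl
    have h2 : (fun i => conj (ω (-n) i)) = cjSeq ω n := rfl
    rw [this, h2]
    simp only [map_neg, LinearMap.neg_apply, Pi.neg_apply]
    ring

/-- The sign comes from the derivative, whose symbol is odd. In `vortF` it is compensated by the
conjugate of the prefactor `i`. -/
theorem starD_cjSeq (a b : FSeq) : starD (cjSeq a) (cjSeq b) = -cjSeq (starD a b) := by
  funext n l
  simp only [starD, conv, Dx, cjSeq, Pi.neg_apply, map_sum, Complex.conj_tsum, map_mul,
    map_intCast, ← Finset.sum_neg_distrib, ← tsum_neg]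
  refine Finset.sum_congr rfl fun m _ => ?_
  rw [← (Equiv.neg Z4).tsum_eq]
  refine tsum_congr fun k => ?_
  have e1 : -(n - -k) = -n - k := by abel
  have e2 : sp (n - -k) m = -sp (-n - k) m := by simp [sp]; ring
  simp only [Equiv.neg_apply, neg_neg, e1, e2]
  push_cast; ring

theorem vortF_cjSeq (ν : ℝ) {fω : FSeq} (hf : cjSeq fω = fω) (Ω : ℂ) (ω : FSeq) :
    vortF ν fω (conj Ω) (cjSeq ω) = cjSeq (vortF ν fω Ω ω) := by
  funext n l
  have h1 := congrFun₂ hf n l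
  have e : sqNorm (-n) = sqNorm n := by simp [sqNorm, SymAction.sp_neg]
  rw [vortF, M_cjSeq, starD_cjSeq, starD_cjSeq, ← h1]
  simp only [cjSeq, vortF, map_sub, map_add, map_mul, Complex.conj_I, map_intCast, Pi.neg_apply,
    Complex.conj_ofReal, e]
  push_cast
  ring

theorem curlCoeff_cjSeq {c : (Fin 3 → ℤ) → Fin 3 → ℂ} (hc : ∀ k l, c (-k) l = conj (c k l)) :
    cjSeq (curlCoeff c) = curlCoeff c := by
  funext n l
  simp only [cjSeq, curlCoeff, Pi.neg_apply, neg_eq_zero]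
  split_ifs with h
  · have h2 : (fun i => conj (c (sp (-n)) i)) = c (sp n) := by
      funext i; rw [SymAction.sp_neg, hc, Complex.conj_conj]
    have h3 := conj_cross (spC (-n)) (c (sp (-n))) l
    rw [h2] at h3
    simp only [conj_spC_neg] at h3
    have : (fun i => -spC n i) = -spC n := rfl
    rw [this] at h3
    change conj (Complex.I * crossProduct (spC (-n)) (c (sp (-n))) l) =
      Complex.I * crossProduct (spC n) (c (sp n)) l
    rw [map_mul, h3, Complex.conj_I]
    simp
  · simp

/-! ### Equivariance of the vorticity equation under `G`. -/

namespace SymAction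

variable {G : Type*} [Group G] (S : SymAction G)

/-- `det C_g`. -/
def detC (g : G) : ℂ := ((S.C g).det : ℂ)

theorem detC_mul_self (g : G) : S.detC g * S.detC g = 1 := by
  rw [detC]; exact_mod_cast S.det_sq g

theorem rhoC_mul_self (g : G) (m : Fin 3) :
    ((S.ρ g m : ℤ) : ℂ) * ((S.ρ g m : ℤ) : ℂ) = 1 := by exact_mod_cast S.rho_sq g m

/-- The action of `g` on Fourier coefficients of velocity fields. -/
def vact (g : G) (a : FSeq) : FSeq := fun n m =>
  ((S.ρ g m : ℤ) : ℂ) * S.twist g n * a (S.moveIndex g n) (S.τ g m)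

/-- Vorticity is a pseudovector: its action differs from that on velocities by the determinant. -/
theorem ext_gam (g : G) (ω : J → ℂ) : ext (S.gam g ω) = S.detC g • S.vact g (ext ω) := by
  funext n m
  by_cases h : n = 0
  · subst h
    have : S.moveIndex g 0 = 0 := by simpa using S.moveIndex_sub g 0 0
    simp [ext, vact, this]
  · have h2 := S.moveIndex_ne_zero g h
    simp only [ext, ne_eq, h, not_false_eq_true, dite_true, Pi.smul_apply, vact, h2, gam, alpha_eq,
      smul_eq_mul, beta, detC]
    ring

/-- The hypotheses say `a' = C a` and `b' = C b`. Pairing with `C e_m` turns the cross product into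
a determinant, and determinants are multiplicative. -/
theorem cross_move (g : G) {a b a' b' : Fin 3 → ℂ}
    (ha : ∀ i, a' (S.τ g i) = ((S.ρ g i : ℤ) : ℂ) * a i)
    (hb : ∀ i, b' (S.τ g i) = ((S.ρ g i : ℤ) : ℂ) * b i) (m : Fin 3) :
    crossProduct a' b' (S.τ g m) = S.detC g * ((S.ρ g m : ℤ) : ℂ) * crossProduct a b m := by
  let CC : Matrix (Fin 3) (Fin 3) ℂ := (S.C g).map (Int.castRingHom ℂ)
  have hCC : ∀ v i, (CC *ᵥ v) (S.τ g i) = ((S.ρ g i : ℤ) : ℂ) * v i := fun v i => by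
    simp [CC, Matrix.mulVec, dotProduct, C, signedPerm, apply_ite]
  have hdet : CC.det = S.detC g := (Int.castRingHom ℂ).map_det (S.C g) |>.symm
  have ha2 : a' = CC *ᵥ a := funext fun i => by
    obtain ⟨i, rfl⟩ := (S.τ g).surjective i
    rw [ha, hCC]
  have hb2 : b' = CC *ᵥ b := funext fun i => by
    obtain ⟨i, rfl⟩ := (S.τ g).surjective i
    rw [hb, hCC]
  have key : CC *ᵥ Pi.single m 1 ⬝ᵥ crossProduct a' b' =
      S.detC g * (Pi.single m 1 ⬝ᵥ crossProduct a b) := by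
    have e : (Matrix.of ![CC *ᵥ Pi.single m 1, CC *ᵥ a, CC *ᵥ b]) =
        Matrix.of ![Pi.single m 1, a, b] * CCᵀ := by
      ext i j
      fin_cases i <;>
        simp [Matrix.mul_apply, Matrix.mulVec, dotProduct, mul_comm, Pi.single_apply]
    have e2 := congrArg Matrix.det e
    rw [Matrix.det_mul, Matrix.det_transpose, hdet, mul_comm] at e2
    rw [triple_product_eq_det, triple_product_eq_det, ha2, hb2]
    exact e2
  have h1 : CC *ᵥ Pi.single m 1 = Pi.single (S.τ g m) ((S.ρ g m : ℤ) : ℂ) := funext fun i => by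
    obtain ⟨i, rfl⟩ := (S.τ g).surjective i
    rw [hCC]
    by_cases h : i = m
    · subst h; simp
    · simp [h]
  rw [h1] at key
  simp only [single_dotProduct, one_mul] at key
  rw [mul_assoc, mul_left_comm, ← key, ← mul_assoc, rhoC_mul_self, one_mul]

theorem spC_moveIndex_tau (g : G) (n : Z4) (m : Fin 3) :
    spC (S.moveIndex g n) (S.τ g m) = ((S.ρ g m : ℤ) : ℂ) * spC n m := by
  simp only [spC]
  rw [sp_moveIndex_tau]; push_cast; rfl

theorem cross_vact (g : G) (a : FSeq) (n : Z4) (m : Fin 3) :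
    crossProduct (spC n) (S.vact g a n) m = S.detC g * (((S.ρ g m : ℤ) : ℂ) * S.twist g n *
      crossProduct (spC (S.moveIndex g n)) (a (S.moveIndex g n)) (S.τ g m)) := by
  rw [S.cross_move g (a := spC n) (b := fun i => ((S.ρ g i : ℤ) : ℂ) * a (S.moveIndex g n) (S.τ g i))
    (S.spC_moveIndex_tau g n) (fun i => by rw [← mul_assoc, rhoC_mul_self, one_mul])]
  have e : S.vact g a n = S.twist g n •
      (fun i => ((S.ρ g i : ℤ) : ℂ) * a (S.moveIndex g n) (S.τ g i)) := by
    funext i; simp only [vact, Pi.smul_apply, smul_eq_mul]; ring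
  rw [e, map_smul, Pi.smul_apply, smul_eq_mul]
  have h1 := S.rhoC_mul_self g m
  have h2 := S.detC_mul_self g
  set X := (crossProduct (spC n)) (fun i => ((S.ρ g i : ℤ) : ℂ) * a (S.moveIndex g n) (S.τ g i)) m
  calc _ = (S.detC g * S.detC g) * (((S.ρ g m : ℤ) : ℂ) * ((S.ρ g m : ℤ) : ℂ)) *
        (S.twist g n * X) := by rw [h1, h2]; ring
    _ = _ := by ring

/-- `M` is a cross product with `ñ` divided by the invariant `ñ²`, so it exchanges vectors and
pseudovectors. -/
theorem M_vact (g : G) (a : FSeq) : M (S.vact g a) = S.detC g • S.vact g (M a) := by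
  funext n m
  by_cases h : sp n = 0
  · rw [M_eq_zero _ _ h]
    simp [vact, M_eq_zero _ _ ((S.sp_moveIndex_eq_zero g n).2 h)]
  · have h2 := (S.sp_moveIndex_eq_zero g n).not.2 h
    rw [M_eq _ _ h]
    simp only [Pi.smul_apply, vact, M_eq _ _ h2, smul_eq_mul, sqNorm_moveIndex]
    rw [cross_vact]
    ring

/-- Reindexing the summation by `τ_g` and the convolution by `moveIndex` suffices: the signs of the
contracted component cancel in pairs, and the phases multiply because `twist` is additive in the
exponent. -/
theorem starD_vact (g : G) (a b : FSeq) :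
    starD (S.vact g a) (S.vact g b) = S.vact g (starD a b) := by
  funext n l
  simp only [starD, vact, conv, Finset.mul_sum]
  symm
  rw [← Equiv.sum_comp (S.τ g)]
  refine Finset.sum_congr rfl fun m _ => ?_
  rw [← tsum_mul_left, ← (S.moveEquiv g).tsum_eq]
  refine tsum_congr fun k => ?_
  change _ * (a (S.moveIndex g k) _ * _) = _
  have e : S.moveIndex g n - (S.moveEquiv g) k = S.moveIndex g (n - k) :=
    (S.moveIndex_sub g n k).symm
  have ht : S.twist g n = S.twist g k * S.twist g (n - k) := by
    rw [← twist_add, add_sub_cancel]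
  rw [e, Dx, Dx, sp_moveIndex_tau, ht]
  push_cast
  ring

theorem curlCoeff_vact (g : G) {c : (Fin 3 → ℤ) → Fin 3 → ℂ}
    (hc : S.vact g (fun n l => if n 3 = 0 then c (sp n) l else 0) =
      fun n l => if n 3 = 0 then c (sp n) l else 0) :
    S.detC g • S.vact g (curlCoeff c) = curlCoeff c := by
  have e : ∀ n l, curlCoeff c n l =
      Complex.I * crossProduct (spC n) (fun l => if n 3 = 0 then c (sp n) l else 0) l := by
    intro n l
    by_cases h : n 3 = 0
    · simp only [curlCoeff, h, if_true]; rfl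
    · have : (fun _ : Fin 3 => (0 : ℂ)) = 0 := rfl
      simp [curlCoeff, h, this]
  funext n m
  have h1 := S.cross_vact g (fun n l => if n 3 = 0 then c (sp n) l else 0) n m
  have h2 := congrFun hc n
  rw [h2] at h1
  simp only [Pi.smul_apply, smul_eq_mul, vact]
  rw [e, e, h1]
  ring

theorem vortF_vact (ν : ℝ) {fω : FSeq} {g : G} (hf : S.detC g • S.vact g fω = fω) (Ω : ℂ)
    (ω : FSeq) : vortF ν fω Ω (S.detC g • S.vact g ω) =
      S.detC g • S.vact g (vortF ν fω Ω ω) := by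
  have hd := S.detC_mul_self g
  have hM : M (S.detC g • S.vact g ω) = S.vact g (M ω) := by
    rw [M_smul, M_vact, smul_smul, hd, one_smul]
  funext n m
  have h1 := congrFun₂ hf n m
  rw [vortF, hM, starD_smul_left, starD_smul_right, starD_vact, starD_vact, ← h1]
  simp only [Pi.smul_apply, smul_eq_mul, vact, vortF, sqNorm_moveIndex, moveIndex_last]
  ring

end SymAction

/-! ### Exponentially decaying sequences, their convolutions and derivatives. -/

theorem summable_antidiagonal {θ : ℝ} (hθ : 1 ≤ θ) {a b : Z4 → ℝ} (ha0 : ∀ n, 0 ≤ a n)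
    (hb0 : ∀ n, 0 ≤ b n) (ha : Summable fun n => θ ^ norm1 n * a n)
    (hb : Summable fun n => θ ^ norm1 n * b n) (n : Z4) : Summable fun k => a k * b (n - k) := by
  have h1 : Summable fun k => θ ^ norm1 n * (a k * b (n - k)) :=
    (conv_summable hθ ha0 hb0 ha hb).prod_factor n
  have h2 : θ ^ norm1 n ≠ 0 := pow_ne_zero _ (by linarith)
  refine (h1.mul_left (θ ^ norm1 n)⁻¹).congr fun k => ?_
  rw [inv_mul_cancel_left₀ h2]

/-- Exponentially decaying scalar sequences. -/
def ExpDecay (θ : ℝ) (a : Z4 → ℂ) : Prop := Summable fun n => θ ^ norm1 n * ‖a n‖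

namespace ExpDecay

variable {θ θ' : ℝ} {a b : Z4 → ℂ}

theorem of_le (hb : ExpDecay θ b) (hθ : 0 ≤ θ') {K : ℝ}
    (h : ∀ n, θ' ^ norm1 n * ‖a n‖ ≤ K * (θ ^ norm1 n * ‖b n‖)) : ExpDecay θ' a :=
  Summable.of_nonneg_of_le (fun _ => mul_nonneg (pow_nonneg hθ _) (norm_nonneg _)) h
    (Summable.mul_left K hb)

theorem mono (ha : ExpDecay θ a) (h0 : 0 ≤ θ') (h : θ' ≤ θ) : ExpDecay θ' a :=
  ha.of_le h0 (K := 1) fun n => by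
    rw [one_mul]
    exact mul_le_mul_of_nonneg_right (pow_le_pow_left₀ h0 h _) (norm_nonneg _)

theorem add (ha : ExpDecay θ a) (hb : ExpDecay θ b) (hθ : 0 ≤ θ) :
    ExpDecay θ fun n => a n + b n :=
  Summable.of_nonneg_of_le (fun n => mul_nonneg (pow_nonneg hθ _) (norm_nonneg _))
    (fun n => by
      rw [← mul_add]
      exact mul_le_mul_of_nonneg_left (norm_add_le _ _) (pow_nonneg hθ _)) (Summable.add ha hb)

theorem const_mul (ha : ExpDecay θ a) (c : ℂ) (hθ : 0 ≤ θ) : ExpDecay θ fun n => c * a n :=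
  ha.of_le hθ (K := ‖c‖) fun n => by rw [norm_mul]; exact le_of_eq (by ring)

theorem zero : ExpDecay θ fun _ => 0 := by simp [ExpDecay, summable_zero]

theorem finset_sum {ι : Type*} (s : Finset ι) {f : ι → Z4 → ℂ} (hf : ∀ i ∈ s, ExpDecay θ (f i))
    (hθ : 0 ≤ θ) : ExpDecay θ fun n => ∑ i ∈ s, f i n := by
  classical
  induction s using Finset.induction_on with
  | empty => simpa using zero
  | insert i s hi ih =>
    simp only [Finset.sum_insert hi]
    exact (hf i (Finset.mem_insert_self _ _)).add
      (ih fun k hk => hf k (Finset.mem_insert_of_mem hk)) hθ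

/-- Multiplication by a function of linear growth. -/
theorem mul_linear (ha : ExpDecay θ a) (h0 : 0 < θ') (h : θ' < θ) {c : Z4 → ℂ} {K : ℝ}
    (hK : 0 ≤ K) (hc : ∀ n, ‖c n‖ ≤ K * norm1 n) : ExpDecay θ' fun n => c n * a n := by
  have hρ : 1 < θ / θ' := (one_lt_div h0).2 h
  refine ha.of_le h0.le (K := K * (θ / θ' - 1)⁻¹) fun n => ?_
  -- Lowering the rate from `θ` to `θ'` gains `(θ / θ') ^ |n|`, which dominates the linear factor.
  have h1 := nat_le_pow hρ (norm1 n)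
  have h2 : θ' ^ norm1 n * (norm1 n : ℝ) ≤ (θ / θ' - 1)⁻¹ * θ ^ norm1 n := by
    refine (mul_le_mul_of_nonneg_left h1 (pow_nonneg h0.le _)).trans (le_of_eq ?_)
    rw [div_pow]
    have := (pow_pos h0 (norm1 n)).ne'
    have h3 : θ / θ' - 1 ≠ 0 := by linarith
    field_simp
  rw [norm_mul]
  calc θ' ^ norm1 n * (‖c n‖ * ‖a n‖) ≤ θ' ^ norm1 n * (K * norm1 n * ‖a n‖) := by
        gcongr; exact hc n
    _ = K * (θ' ^ norm1 n * (norm1 n : ℝ)) * ‖a n‖ := by ring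
    _ ≤ K * ((θ / θ' - 1)⁻¹ * θ ^ norm1 n) * ‖a n‖ := by gcongr
    _ = _ := by ring

theorem dx (ha : ExpDecay θ a) (h0 : 0 < θ') (h : θ' < θ) (m : Fin 3) :
    ExpDecay θ' (Dx m a) :=
  ha.mul_linear h0 h zero_le_one fun n => by
    rw [Complex.norm_intCast, one_mul]; exact sp_le_norm1 n m

theorem norm_summable (ha : ExpDecay θ a) (hθ : 1 ≤ θ) : Summable fun n => ‖a n‖ := by
  have := ha.mono zero_le_one hθ
  simpa [ExpDecay] using this

theorem summable_mul (ha : ExpDecay θ a) (hb : ExpDecay θ b) (hθ : 1 ≤ θ) (n : Z4) :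
    Summable fun k => ‖a k‖ * ‖b (n - k)‖ :=
  summable_antidiagonal hθ (a := fun k => ‖a k‖) (b := fun k => ‖b k‖) (fun _ => norm_nonneg _)
    (fun _ => norm_nonneg _) ha hb n

theorem summable_conv (ha : ExpDecay θ a) (hb : ExpDecay θ b) (hθ : 1 ≤ θ) (n : Z4) :
    Summable fun k => a k * b (n - k) :=
  Summable.of_norm ((ha.summable_mul hb hθ n).congr fun _ => (norm_mul _ _).symm)

theorem conv (ha : ExpDecay θ a) (hb : ExpDecay θ b) (hθ : 1 ≤ θ) : ExpDecay θ (conv a b) := by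
  have hs := (conv_summable hθ (fun k => norm_nonneg (a k)) (fun k => norm_nonneg (b k)) ha hb
    ).prod
  have h0 : 0 ≤ θ := by linarith
  refine Summable.of_nonneg_of_le (fun n => mul_nonneg (pow_nonneg h0 _) (norm_nonneg _))
    (fun n => ?_) hs
  dsimp only
  rw [tsum_mul_left]
  refine mul_le_mul_of_nonneg_left ?_ (pow_nonneg h0 _)
  exact tsum_of_norm_bounded (ha.summable_mul hb hθ n).hasSum fun _ => (norm_mul _ _).le

end ExpDecay

theorem InL1.expDecay {η : ℝ} {ω : FSeq} (h : InL1 η ω) (l : Fin 3) :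
    ExpDecay η fun n => ω n l := h l

section starD

variable {η : ℝ} {a a' b b' : FSeq}

theorem InL1.summable_starD (hη : 1 < η) (ha : InL1 η a) (hb : InL1 η b) (n : Z4) (l m : Fin 3) :
    Summable fun k => a k m * Dx m (fun k => b k l) (n - k) :=
  ((ha.expDecay m).mono zero_le_one hη.le).summable_conv
    ((hb.expDecay l).dx zero_lt_one hη m) le_rfl n

theorem starD_add_left (hη : 1 < η) (ha : InL1 η a) (ha' : InL1 η a') (hb : InL1 η b) :
    starD (a + a') b = starD a b + starD a' b := by
  funext n l
  simp only [starD, conv, Pi.add_apply, ← Finset.sum_add_distrib]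
  refine Finset.sum_congr rfl fun m _ => ?_
  rw [← (ha.summable_starD hη hb n l m).tsum_add (ha'.summable_starD hη hb n l m)]
  exact tsum_congr fun k => add_mul _ _ _

theorem starD_add_right (hη : 1 < η) (ha : InL1 η a) (hb : InL1 η b) (hb' : InL1 η b') :
    starD a (b + b') = starD a b + starD a b' := by
  funext n l
  simp only [starD, conv, Pi.add_apply, ← Finset.sum_add_distrib]
  refine Finset.sum_congr rfl fun m _ => ?_
  rw [← (ha.summable_starD hη hb n l m).tsum_add (ha.summable_starD hη hb' n l m)]
  refine tsum_congr fun k => ?_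
  simp only [Dx]; ring

/-- Transport by a divergence free field in conservative form. -/
theorem starD_eq_of_div (hη : 1 < η) (ha : InL1 η a) (hb : InL1 η b)
    (hdiv : ∀ k, ∑ m, (sp k m : ℂ) * a k m = 0) (n : Z4) (l : Fin 3) :
    starD a b n l = ∑ m, (sp n m : ℂ) * conv (fun k => a k m) (fun k => b k l) n := by
  have h2 : ∀ m, Summable fun k => a k m * b (n - k) l := fun m =>
    (ha.expDecay m).summable_conv (hb.expDecay l) hη.le n
  rw [starD]
  simp only [conv, ← tsum_mul_left]
  rw [← Summable.tsum_finsetSum fun m _ => ha.summable_starD hη hb n l m,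
    ← Summable.tsum_finsetSum fun m _ => (h2 m).mul_left _]
  refine tsum_congr fun k => ?_
  have h1 : ∑ m, a k m * Dx m (fun k => b k l) (n - k)
      = ∑ m, (sp n m : ℂ) * (a k m * b (n - k) l)
        - (∑ m, (sp k m : ℂ) * a k m) * b (n - k) l := by
    rw [Finset.sum_mul, ← Finset.sum_sub_distrib]
    refine Finset.sum_congr rfl fun m _ => ?_
    have : (sp (n - k) m : ℂ) = sp n m - sp k m := by simp [sp]
    rw [Dx, this]; ring
  rw [h1, hdiv, zero_mul, sub_zero]

end starD

/-- `∑_i |ω_n^{(i)}|`. -/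
def absSum (ω : FSeq) (n : Z4) : ℝ := ∑ i, ‖ω n i‖

theorem absSum_nonneg (ω : FSeq) (n : Z4) : 0 ≤ absSum ω n :=
  Finset.sum_nonneg fun _ _ => norm_nonneg _

theorem InL1.summable_absSum {η : ℝ} {ω : FSeq} (h : InL1 η ω) :
    Summable fun n => η ^ norm1 n * absSum ω n := h.sum

theorem InL1.summable_absSum_mul {η : ℝ} (hη : 1 < η) {ω ω' : FSeq} (h : InL1 η ω)
    (h' : InL1 η ω') (n : Z4) : Summable fun k => absSum ω k * absSum ω' (n - k) :=
  summable_antidiagonal hη.le (absSum_nonneg ω) (absSum_nonneg ω') h.summable_absSum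
    h'.summable_absSum n

theorem le_absSum (ω : FSeq) (n : Z4) (l : Fin 3) : ‖ω n l‖ ≤ absSum ω n :=
  Finset.single_le_sum (f := fun i => ‖ω n i‖) (fun _ _ => norm_nonneg _) (Finset.mem_univ l)

/-! ### Estimates for the bilinear form, with a gain in the time frequency. -/

/-- The bilinear form of the vorticity equation. -/
def bilF (ω ω' : FSeq) : FSeq := fun n l =>
  Complex.I * starD (M ω) ω' n l - Complex.I * starD ω (M ω') n l

/-- The decay in `n₄` of the smoothing gain. -/
def gain (m : ℤ) : ℝ := 1 / Real.sqrt (max 1 |(m : ℝ)|)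

theorem gain_pos (m : ℤ) : 0 < gain m :=
  one_div_pos.2 (Real.sqrt_pos.2 (lt_max_of_lt_left one_pos))

theorem gain_le_one (m : ℤ) : gain m ≤ 1 :=
  (div_le_one (Real.sqrt_pos.2 (lt_max_of_lt_left one_pos))).2
    (Real.one_le_sqrt.2 (le_max_left _ _))

/-- With `b = max(1, |n₄|)`, the inequality `2 |ñ| √b ≤ |ñ|² + b` gives `(|ñ| + 1) √b ≤ 2 order21
n`. So one space derivative, measured against the order of the equation, leaves a factor `1/√b`. -/
theorem le_order21_mul_gain {n : Z4} (hn : n ≠ 0) :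
    3 * (spSup n : ℝ) + 3 ≤ order21 n * (6 * gain (n 3)) := by
  set b := max 1 |(n 3 : ℝ)| with hb
  have hb1 : 1 ≤ b := le_max_left _ _
  have hs1 : 1 ≤ Real.sqrt b := Real.one_le_sqrt.2 hb1
  have hss : Real.sqrt b * Real.sqrt b = b := Real.mul_self_sqrt (by linarith)
  have hbo : b ≤ order21 n := max_le (one_le_order21 hn) (le_max_right _ _)
  have hao : (spSup n : ℝ) ^ 2 ≤ order21 n := le_max_left _ _
  have key : (spSup n + 1) * Real.sqrt b ≤ 2 * order21 n := by
    nlinarith [sq_nonneg ((spSup n : ℝ) - Real.sqrt b)]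
  have : order21 n * (6 * gain (n 3)) = 6 * order21 n / Real.sqrt b := by
    rw [gain]; ring
  rw [this, le_div_iff₀ (by linarith)]
  linarith

/-- In the first term the derivative falls on the output frequency, as `M ω` is divergence free; in
the second it is absorbed by the smoothing of `M`. Each sums over three components. -/
theorem norm_bilF_le {η : ℝ} (hη : 1 < η) {ω ω' : FSeq} (h : InL1 η ω) (h' : InL1 η ω') (n : Z4)
    (l : Fin 3) : ‖bilF ω ω' n l‖ ≤
      (3 * spSup n + 3) * ∑' k, absSum ω k * absSum ω' (n - k) := by
  have hM := h.M hη
  have hM' := h'.M hη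
  have hs := h.summable_absSum_mul hη h' n
  have b1 : ‖starD (M ω) ω' n l‖ ≤
      3 * spSup n * ∑' k, absSum ω k * absSum ω' (n - k) := by
    rw [starD_eq_of_div hη hM h' (dot_M ω)]
    refine (norm_sum_le _ _).trans ?_
    have : ∀ m ∈ (Finset.univ : Finset (Fin 3)), ‖(sp n m : ℂ) * conv (fun k => M ω k m)
        (fun k => ω' k l) n‖ ≤ spSup n * ∑' k, absSum ω k * absSum ω' (n - k) := fun m _ => by
      rw [norm_mul, Complex.norm_intCast]
      refine mul_le_mul (sp_le_spSup n m) ?_ (norm_nonneg _) (Nat.cast_nonneg _)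
      refine tsum_of_norm_bounded hs.hasSum fun k => ?_
      rw [norm_mul]
      exact mul_le_mul (M_le ω k m) (le_absSum _ _ _) (norm_nonneg _) (absSum_nonneg _ _)
    refine (Finset.sum_le_card_nsmul _ _ _ this).trans (le_of_eq ?_)
    simp; ring
  have b2 : ‖starD ω (M ω') n l‖ ≤ 3 * ∑' k, absSum ω k * absSum ω' (n - k) := by
    rw [starD]
    refine (norm_sum_le _ _).trans ?_
    have : ∀ m ∈ (Finset.univ : Finset (Fin 3)), ‖conv (fun k => ω k m) (Dx m fun k => M ω' k l) n‖
        ≤ ∑' k, absSum ω k * absSum ω' (n - k) := fun m _ => by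
      refine tsum_of_norm_bounded hs.hasSum fun k => ?_
      rw [norm_mul, Dx, norm_mul, Complex.norm_intCast]
      refine mul_le_mul (le_absSum _ _ _) ?_ (by positivity) (absSum_nonneg _ _)
      exact (mul_le_mul_of_nonneg_right (sp_le_spSup _ m) (norm_nonneg _)).trans
        (spSup_mul_M_le ω' (n - k) l)
    refine (Finset.sum_le_card_nsmul _ _ _ this).trans (le_of_eq ?_)
    simp
  rw [bilF]
  refine (norm_sub_le _ _).trans ?_
  rw [norm_mul, norm_mul, Complex.norm_I]
  linarith

/-- The double sum controlling the bilinear form. -/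
def pairTerm (η : ℝ) (ω ω' : FSeq) (q : Z4 × Z4) : ℝ :=
  (η ^ norm1 q.1 * absSum ω q.1) * (η ^ norm1 q.2 * absSum ω' q.2) * gain (q.1 3 + q.2 3)

theorem pairTerm_nonneg {η : ℝ} (hη : 1 < η) (ω ω' : FSeq) (q : Z4 × Z4) :
    0 ≤ pairTerm η ω ω' q := by
  have := absSum_nonneg ω q.1
  have := absSum_nonneg ω' q.2
  have := (gain_pos (q.1 3 + q.2 3)).le
  unfold pairTerm
  positivity

theorem pairTerm_le {η : ℝ} (hη : 1 < η) (ω ω' : FSeq) (q : Z4 × Z4) : pairTerm η ω ω' q ≤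
    (η ^ norm1 q.1 * absSum ω q.1) * (η ^ norm1 q.2 * absSum ω' q.2) := by
  have := absSum_nonneg ω q.1
  have := absSum_nonneg ω' q.2
  exact mul_le_of_le_one_right (by positivity) (gain_le_one _)

theorem summable_weighted_mul {η : ℝ} (hη : 1 < η) {ω ω' : FSeq} (h : InL1 η ω)
    (h' : InL1 η ω') : Summable fun q : Z4 × Z4 =>
      (η ^ norm1 q.1 * absSum ω q.1) * (η ^ norm1 q.2 * absSum ω' q.2) := by
  have h0 : ∀ (ω : FSeq) n, 0 ≤ η ^ norm1 n * absSum ω n := fun ω n =>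
    mul_nonneg (pow_nonneg (by linarith) _) (absSum_nonneg _ _)
  have h2 := Summable.mul_of_nonneg h.summable_absSum h'.summable_absSum (h0 ω) (h0 ω')
  exact h2

theorem summable_pairTerm {η : ℝ} (hη : 1 < η) {ω ω' : FSeq} (h : InL1 η ω) (h' : InL1 η ω') :
    Summable (pairTerm η ω ω') :=
  Summable.of_nonneg_of_le (pairTerm_nonneg hη ω ω') (pairTerm_le hη ω ω')
    (summable_weighted_mul hη h h')

theorem tsum_pairTerm_le {η : ℝ} (hη : 1 < η) {ω ω' : FSeq} (h : InL1 η ω) (h' : InL1 η ω') :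
    ∑' q, pairTerm η ω ω' q ≤
      (∑' n, η ^ norm1 n * absSum ω n) * ∑' n, η ^ norm1 n * absSum ω' n := by
  rw [Summable.tsum_mul_tsum h.summable_absSum h'.summable_absSum (summable_weighted_mul hη h h')]
  exact (summable_pairTerm hη h h').tsum_le_tsum (pairTerm_le hη ω ω')
    (summable_weighted_mul hη h h')

/-- The bilinear form maps into the space with weights reduced by `order21`. -/
theorem bilF_sum_le {η : ℝ} (hη : 1 < η) {ω ω' : FSeq} (h : InL1 η ω) (h' : InL1 η ω') :
    ∃ s ≤ 18 * ∑' q, pairTerm η ω ω' q,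
      HasSum (fun i : J => xi η i / order21 i.1.1 * ‖bilF ω ω' i.1.1 i.2‖) s := by
  let e : Z4 × Z4 ≃ Z4 × Z4 :=
    { toFun := fun q => (q.2, q.1 - q.2)
      invFun := fun q => (q.1 + q.2, q.1)
      left_inv := fun q => by ext <;> simp
      right_inv := fun q => by ext <;> simp }
  have hs := summable_pairTerm hη h h'
  have hs2 : Summable fun q : Z4 × Z4 => pairTerm η ω ω' (q.2, q.1 - q.2) := e.summable_iff.2 hs
  have ht : ∑' n, ∑' k, pairTerm η ω ω' (k, n - k) = ∑' q, pairTerm η ω ω' q := by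
    rw [← e.tsum_eq (pairTerm η ω ω')]
    exact hs2.tsum_prod.symm
  set D : Z4 → ℝ := fun n => ∑' k, pairTerm η ω ω' (k, n - k) with hD
  have hDs : Summable D := hs2.prod
  have hD0 : ∀ n, 0 ≤ D n := fun n => tsum_nonneg fun k => pairTerm_nonneg hη _ _ _
  have hle : ∀ i : J, xi η i / order21 i.1.1 * ‖bilF ω ω' i.1.1 i.2‖ ≤ 6 * D i.1.1 := by
    rintro ⟨⟨n, hn⟩, l⟩
    have ho := order21_pos hn
    have hx : 0 < xi η (⟨n, hn⟩, l) := xi_pos hη _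
    have hcs := h.summable_absSum_mul hη h' n
    have hc0 : 0 ≤ ∑' k, absSum ω k * absSum ω' (n - k) :=
      tsum_nonneg fun k => mul_nonneg (absSum_nonneg _ _) (absSum_nonneg _ _)
    have h1 : ‖bilF ω ω' n l‖ ≤
        order21 n * (6 * gain (n 3)) * ∑' k, absSum ω k * absSum ω' (n - k) :=
      (norm_bilF_le hη h h' n l).trans (mul_le_mul_of_nonneg_right (le_order21_mul_gain hn) hc0)
    have h2 : η ^ norm1 n * gain (n 3) * ∑' k, absSum ω k * absSum ω' (n - k) ≤ D n := by
      rw [← tsum_mul_left]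
      refine (hcs.mul_left _).tsum_le_tsum (fun k => ?_) (hs2.prod_factor n)
      have h3 : η ^ norm1 n ≤ η ^ norm1 k * η ^ norm1 (n - k) := by
        rw [← pow_add]; exact pow_le_pow_right₀ hη.le (norm1_add_le _ _)
      have h4 : gain (k 3 + (n - k) 3) = gain (n 3) := by simp
      have h5 := absSum_nonneg ω k
      have h6 := absSum_nonneg ω' (n - k)
      have h7 := (gain_pos (n 3)).le
      simp only [pairTerm, h4]
      calc η ^ norm1 n * gain (n 3) * (absSum ω k * absSum ω' (n - k))
          ≤ (η ^ norm1 k * η ^ norm1 (n - k)) * gain (n 3) *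
            (absSum ω k * absSum ω' (n - k)) := by gcongr
        _ = _ := by ring
    calc xi η (⟨n, hn⟩, l) / order21 n * ‖bilF ω ω' n l‖
        ≤ xi η (⟨n, hn⟩, l) / order21 n *
          (order21 n * (6 * gain (n 3)) * ∑' k, absSum ω k * absSum ω' (n - k)) := by gcongr
      _ = 6 * (η ^ norm1 n * gain (n 3) * ∑' k, absSum ω k * absSum ω' (n - k)) := by
          rw [xi]; field_simp
      _ ≤ 6 * D n := by linarith
  have inj : Function.Injective (Subtype.val : {n : Z4 // n ≠ 0} → Z4) := Subtype.val_injective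
  -- `18 = 3 * 6`: every `n` occurs with three vector components.
  have hDJ : HasSum (fun i : J => 6 * D i.1.1) (18 * ∑' n : {n : Z4 // n ≠ 0}, D n.1) := by
    have hs3 : Summable fun i : J => 6 * D i.1.1 := by
      refine (summable_prod_of_nonneg fun i => ?_).2 ⟨fun n => Summable.of_finite, ?_⟩
      · exact mul_nonneg (by norm_num) (hD0 _)
      · simp only [tsum_fintype, Finset.sum_const, Finset.card_univ, Fintype.card_fin]
        exact ((hDs.comp_injective inj).mul_left 6).const_smul 3
    convert hs3.hasSum using 1
    rw [hs3.tsum_prod]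
    simp only [tsum_fintype, Finset.sum_const, Finset.card_univ, Fintype.card_fin, nsmul_eq_mul]
    rw [tsum_mul_left, tsum_mul_left]
    push_cast; ring
  have hsum : Summable fun i : J => xi η i / order21 i.1.1 * ‖bilF ω ω' i.1.1 i.2‖ :=
    Summable.of_nonneg_of_le (fun i => mul_nonneg (div_nonneg (xi_pos hη i).le
      (order21_pos i.1.2).le) (norm_nonneg _)) hle hDJ.summable
  refine ⟨_, ?_, hsum.hasSum⟩
  refine (hasSum_le hle hsum.hasSum hDJ).trans ?_
  rw [← ht]
  have := Summable.tsum_subtype_le D {n : Z4 | n ≠ 0} hD0 hDs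
  exact mul_le_mul_of_nonneg_left this (by norm_num)

theorem bilF_add_left {η : ℝ} (hη : 1 < η) {a a' b : FSeq} (ha : InL1 η a) (ha' : InL1 η a')
    (hb : InL1 η b) : bilF (a + a') b = bilF a b + bilF a' b := by
  funext n l
  rw [bilF, M_add, starD_add_left hη (ha.M hη) (ha'.M hη) hb, starD_add_left hη ha ha' (hb.M hη)]
  simp only [Pi.add_apply, bilF]; ring

theorem bilF_add_right {η : ℝ} (hη : 1 < η) {a b b' : FSeq} (ha : InL1 η a) (hb : InL1 η b)
    (hb' : InL1 η b') : bilF a (b + b') = bilF a b + bilF a b' := by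
  funext n l
  rw [bilF, M_add, starD_add_right hη (ha.M hη) hb hb',
    starD_add_right hη ha (hb.M hη) (hb'.M hη)]
  simp only [Pi.add_apply, bilF]; ring

theorem bilF_smul_left (c : ℂ) (a b : FSeq) : bilF (c • a) b = c • bilF a b := by
  funext n l
  rw [bilF, M_smul, starD_smul_left, starD_smul_left]
  simp only [Pi.smul_apply, smul_eq_mul, bilF]; ring

theorem bilF_smul_right (c : ℂ) (a b : FSeq) : bilF a (c • b) = c • bilF a b := by
  funext n l
  rw [bilF, M_smul, starD_smul_right, starD_smul_right]
  simp only [Pi.smul_apply, smul_eq_mul, bilF]; ring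

theorem ext_add (a b : J → ℂ) : ext (a + b) = ext a + ext b := by
  funext n m
  by_cases h : n = 0 <;> simp [ext, h]

theorem ext_smul (c : ℂ) (a : J → ℂ) : ext (c • a) = c • ext a := by
  funext n m
  by_cases h : n = 0 <;> simp [ext, h]

theorem ext_apply (a : J → ℂ) (i : J) : ext a i.1.1 i.2 = a i := by
  simp [ext, i.1.2]

theorem vortF_eq (ν : ℝ) (fω : FSeq) (Ω : ℂ) (ω : FSeq) (n : Z4) (l : Fin 3) :
    vortF ν fω Ω ω n l = Complex.I * Ω * (n 3 : ℂ) * ω n l + bilF ω ω n l +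
      (ν : ℂ) * (sqNorm n : ℂ) * ω n l - fω n l := by
  rw [vortF, bilF]; ring

theorem tsum_absSum_ext {η : ℝ} {ω : J → ℂ} (h : Summable fun i => xi η i * ‖ω i‖) :
    ∑' n, η ^ norm1 n * absSum (ext ω) n = ∑' i : J, xi η i * ‖ω i‖ := by
  have h1 : Function.support (fun n => η ^ norm1 n * absSum (ext ω) n) ⊆ {n : Z4 | n ≠ 0} := by
    intro n hn h0
    obtain rfl : n = 0 := h0
    simp [absSum, ext] at hn
  rw [← tsum_subtype_eq_of_support_subset h1, h.tsum_prod]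
  refine tsum_congr fun n => ?_
  rw [tsum_fintype, absSum, Finset.mul_sum]
  refine Finset.sum_congr rfl fun l _ => ?_
  rw [ext_apply _ (n, l)]; rfl

/-! ### `𝓕^red` as a continuous quadratic map, and its derivative. -/

namespace SymAction

variable {G : Type*} [Group G] (S : SymAction G) [Fintype G] {dom : Set J} {η : ℝ}

theorem Sig_add (hdom : S.IsFundamentalDomain dom) (φ ψ : S.Jred dom → ℂ) :
    S.Sig (φ + ψ) = S.Sig φ + S.Sig ψ := by
  funext i
  by_cases hi : i ∈ S.Jsym
  · obtain ⟨j, g, rfl⟩ := S.exists_red hdom hi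
    simp only [Pi.add_apply, S.Sig_beta hdom]; ring
  · simp only [Pi.add_apply, S.Sig_of_notMem _ hi, add_zero]

theorem Sig_smul (hdom : S.IsFundamentalDomain dom) (c : ℂ) (φ : S.Jred dom → ℂ) :
    S.Sig (c • φ) = c • S.Sig φ := by
  funext i
  by_cases hi : i ∈ S.Jsym
  · obtain ⟨j, g, rfl⟩ := S.exists_red hdom hi
    simp only [Pi.smul_apply, S.Sig_beta hdom, smul_eq_mul]; ring
  · simp only [Pi.smul_apply, S.Sig_of_notMem _ hi, smul_zero]

/-- The vorticity coefficients of `(Ω, φ)`. -/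
def vort (φ : Option (S.Jred dom) → ℂ) : FSeq := ext (S.Sig (S.seqPart φ))

theorem summable_seqPart {hη : 1 < η} (φ : S.XRed dom hη) :
    Summable fun j : S.Jred dom => (S.orbCard j * xi η j) * ‖S.seqPart φ j‖ :=
  φ.summable.comp_injective (Option.some_injective _)

theorem summable_Sig {hη : 1 < η} (φ : S.XRed dom hη) :
    Summable fun i : J => xi η i * ‖S.Sig (S.seqPart φ) i‖ :=
  S.Sig_summable hη _ (S.summable_seqPart φ)

theorem vort_inL1 {hη : 1 < η} (φ : S.XRed dom hη) : InL1 η (S.vort φ) :=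
  ext_inL1 (S.summable_Sig φ)

theorem vort_apply (hdom : S.IsFundamentalDomain dom) (φ : Option (S.Jred dom) → ℂ)
    (j : S.Jred dom) : S.vort φ j.1.1.1 j.1.2 = φ (some j) := by
  rw [vort, ext_apply]
  exact congrFun (S.Pr_Sig hdom (S.seqPart φ)) j

theorem vort_add (hdom : S.IsFundamentalDomain dom) {hη : 1 < η} (φ ψ : S.XRed dom hη) :
    S.vort (φ + ψ : S.XRed dom hη) = S.vort φ + S.vort ψ := by
  rw [vort, vort, vort, ← ext_add, ← S.Sig_add hdom]; rfl

theorem vort_smul (hdom : S.IsFundamentalDomain dom) {hη : 1 < η} (c : ℂ) (φ : S.XRed dom hη) :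
    S.vort (c • φ : S.XRed dom hη) = c • S.vort φ := by
  rw [vort, vort, ← ext_smul, ← S.Sig_smul hdom]; rfl

theorem hasSum_option {w : Option (S.Jred dom) → ℝ} {s : ℝ}
    (h : HasSum (fun j => w (some j)) s) : HasSum w (w none + s) := by
  have hs : Summable w := S.summable_option.2 h.summable
  have h1 := hs.hasSum
  rw [hs.tsum_eq_add_tsum_ite none] at h1
  convert h1 using 2
  rw [← h.tsum_eq]
  symm
  have h2 : Function.support (fun i => if i = none then 0 else w i) ⊆
      Set.range (some : S.Jred dom → _) := by
    intro i hi
    rcases i with _ | j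
    · simp at hi
    · exact ⟨j, rfl⟩
  rw [← (Option.some_injective _).tsum_eq h2]
  simp

/-- This transfers estimates on the full index set to the reduced space without loss. -/
theorem norm_eq {hη : 1 < η} (hdom : S.IsFundamentalDomain dom) (φ : S.XRed dom hη) :
    ‖φ‖ = ‖φ none‖ + ∑' i : J, xi η i * ‖S.Sig (S.seqPart φ) i‖ := by
  have h := S.hasSum_norm_red hdom hη (S.gam_Sig hdom (S.seqPart φ)) (S.summable_Sig φ).hasSum
  rw [S.Pr_Sig hdom] at h
  have h2 := S.hasSum_option (w := fun i => (S.wX dom hη i : ℝ) * ‖φ i‖) h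
  rw [WL1.norm_def, h2.tsum_eq]
  congr 1
  exact one_mul _

theorem tsum_vort_le {hη : 1 < η} (hdom : S.IsFundamentalDomain dom) (φ : S.XRed dom hη) :
    ∑' n, η ^ norm1 n * absSum (S.vort φ) n ≤ ‖φ‖ := by
  rw [vort, tsum_absSum_ext (S.summable_Sig φ), S.norm_eq hdom]
  linarith [norm_nonneg (φ none)]

/-- No invariance of `v` is needed: bounding orbit lengths by `|G|` costs only a constant. -/
theorem summable_red_of_J (hη : 1 < η) {v : J → ℂ} {s : ℝ}
    (h : HasSum (fun i : J => xi η i / order21 i.1.1 * ‖v i‖) s) :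
    ∃ s' ≤ (Fintype.card G : ℝ) * s,
      HasSum (fun j : S.Jred dom => (S.wY dom hη (some j) : ℝ) * ‖v j‖) s' := by
  have hnn : ∀ i : J, 0 ≤ xi η i / order21 i.1.1 * ‖v i‖ := fun i =>
    mul_nonneg (div_nonneg (xi_pos hη _).le (order21_pos i.1.2).le) (norm_nonneg _)
  have hle : ∀ j : S.Jred dom, (S.wY dom hη (some j) : ℝ) * ‖v j‖ ≤
      (Fintype.card G : ℝ) * (xi η j / order21 j.1.1.1 * ‖v j‖) := fun j => by
    have hc : (S.orbCard j : ℝ) ≤ Fintype.card G := by exact_mod_cast S.orbCard_le j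
    refine le_trans (le_of_eq ?_) (mul_le_mul_of_nonneg_right hc (hnn j))
    change S.orbCard j * xi η j / order21 j.1.1.1 * ‖v j‖ = _
    ring
  have h1 := (h.summable.comp_injective (Subtype.val_injective (p := (· ∈ S.Jred dom)))).mul_left
    (Fintype.card G : ℝ)
  have h2 := Summable.of_nonneg_of_le
    (fun j => mul_nonneg (S.wY dom hη (some j)).2.le (norm_nonneg _)) hle h1
  refine ⟨_, ?_, h2.hasSum⟩
  refine (h2.tsum_le_tsum hle h1).trans ?_
  rw [tsum_mul_left]
  refine mul_le_mul_of_nonneg_left ?_ (Nat.cast_nonneg _)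
  rw [← h.tsum_eq]
  exact Summable.tsum_subtype_le _ (S.Jred dom) hnn h.summable

/-- A sequence on the reduced indices with frequency component `z`. -/
def optSeq (z : ℂ) (v : S.Jred dom → ℂ) : Option (S.Jred dom) → ℂ
  | none => z
  | some j => v j

theorem bil_summable (hη : 1 < η) (φ ψ : S.XRed dom hη) :
    ∃ s ≤ (Fintype.card G : ℝ) * (18 * ∑' q, pairTerm η (S.vort φ) (S.vort ψ) q),
      HasSum (fun j : S.Jred dom => (S.wY dom hη (some j) : ℝ) *
        ‖bilF (S.vort φ) (S.vort ψ) j.1.1.1 j.1.2‖) s := by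
  obtain ⟨s, hs, hsum⟩ := bilF_sum_le hη (S.vort_inL1 φ) (S.vort_inL1 ψ)
  obtain ⟨s', hs', hsum'⟩ := S.summable_red_of_J (dom := dom) hη
    (v := fun i => bilF (S.vort φ) (S.vort ψ) i.1.1 i.2) hsum
  exact ⟨s', hs'.trans (mul_le_mul_of_nonneg_left hs (Nat.cast_nonneg _)), hsum'⟩

/-- The quadratic transport part of `𝓕^red`. -/
def transB (hη : 1 < η) (φ ψ : S.XRed dom hη) : S.YRed dom hη :=
  WL1.mk (S.optSeq 0 fun j => bilF (S.vort φ) (S.vort ψ) j.1.1.1 j.1.2) (by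
    obtain ⟨s, -, h⟩ := S.bil_summable hη φ ψ
    exact S.summable_option.2 h.summable)

theorem norm_transB_le (hη : 1 < η) (φ ψ : S.XRed dom hη) : ‖S.transB hη φ ψ‖ ≤
    (Fintype.card G : ℝ) * (18 * ∑' q, pairTerm η (S.vort φ) (S.vort ψ) q) := by
  obtain ⟨s, hs, h⟩ := S.bil_summable hη φ ψ
  have h2 := S.hasSum_option (w := fun i => (S.wY dom hη i : ℝ) * ‖S.transB hη φ ψ i‖) h
  rw [WL1.norm_def, h2.tsum_eq]
  have : (S.wY dom hη none : ℝ) * ‖S.transB hη φ ψ none‖ = 0 := by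
    have : S.transB hη φ ψ none = 0 := rfl
    rw [this, norm_zero, mul_zero]
  rw [this, zero_add]
  exact hs

theorem wY_le (hη : 1 < η) (j : S.Jred dom) :
    (S.wY dom hη (some j) : ℝ) * order21 j.1.1.1 = S.wX dom hη (some j) := by
  change (S.wRed dom hη j : ℝ) / order21 j.1.1.1 * _ = (S.wRed dom hη j : ℝ)
  exact div_mul_cancel₀ _ (order21_pos j.1.1.2).ne'

/-- Multiplication by a symbol of order `order21`. -/
def symbolOp (hη : 1 < η) (d : Z4 → ℂ) (K : ℝ) (hd : ∀ n, ‖d n‖ ≤ K * order21 n) :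
    S.XRed dom hη →L[ℂ] S.YRed dom hη :=
  WL1.diag _ _ (S.optSeq 0 fun j => d j.1.1.1) (by
    refine ⟨max K 0, fun i => ?_⟩
    rcases i with _ | j
    · have : (S.optSeq 0 fun j : S.Jred dom => d j.1.1.1) none = 0 := rfl
      rw [this, norm_zero, mul_zero]
      exact mul_nonneg (le_max_right _ _) (S.wX dom hη none).2.le
    · rw [← wY_le, mul_left_comm]
      refine mul_le_mul_of_nonneg_left ((hd _).trans ?_) (S.wY dom hη (some j)).2.le
      exact mul_le_mul_of_nonneg_right (le_max_left _ _) (order21_pos j.1.1.2).le)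

theorem symbolOp_none (hη : 1 < η) (d : Z4 → ℂ) (K : ℝ) (hd : ∀ n, ‖d n‖ ≤ K * order21 n)
    (φ : S.XRed dom hη) : S.symbolOp hη d K hd φ none = 0 := zero_mul _

theorem symbolOp_some (hη : 1 < η) (d : Z4 → ℂ) (K : ℝ) (hd : ∀ n, ‖d n‖ ≤ K * order21 n)
    (φ : S.XRed dom hη) (j : S.Jred dom) :
    S.symbolOp hη d K hd φ (some j) = d j.1.1.1 * φ (some j) := rfl

theorem norm_last_le (n : Z4) : ‖(n 3 : ℂ)‖ ≤ 1 * order21 n := by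
  rw [one_mul, Complex.norm_intCast]; exact le_max_right _ _

/-- Multiplication by `n₄`. -/
def lastOp (hη : 1 < η) : S.XRed dom hη →L[ℂ] S.YRed dom hη :=
  S.symbolOp hη (fun n => (n 3 : ℂ)) 1 norm_last_le

theorem lastOp_none (hη : 1 < η) (φ : S.XRed dom hη) : S.lastOp hη φ none = 0 := zero_mul _

theorem lastOp_some (hη : 1 < η) (φ : S.XRed dom hη) (j : S.Jred dom) :
    S.lastOp hη φ (some j) = (j.1.1.1 3 : ℂ) * φ (some j) := rfl

theorem transB_none (hη : 1 < η) (φ ψ : S.XRed dom hη) : S.transB hη φ ψ none = 0 := rfl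

theorem transB_some (hη : 1 < η) (φ ψ : S.XRed dom hη) (j : S.Jred dom) :
    S.transB hη φ ψ (some j) = bilF (S.vort φ) (S.vort ψ) j.1.1.1 j.1.2 := rfl

theorem transB_add_left (hdom : S.IsFundamentalDomain dom) (hη : 1 < η) (φ φ' ψ : S.XRed dom hη) :
    S.transB hη (φ + φ') ψ = S.transB hη φ ψ + S.transB hη φ' ψ := by
  ext i
  rcases i with _ | j
  · rw [WL1.add_apply]; simp only [transB_none, add_zero]
  · rw [WL1.add_apply]
    simp only [transB_some]
    rw [S.vort_add hdom, bilF_add_left hη (S.vort_inL1 _) (S.vort_inL1 _) (S.vort_inL1 _)]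
    rfl

theorem transB_add_right (hdom : S.IsFundamentalDomain dom) (hη : 1 < η)
    (φ ψ ψ' : S.XRed dom hη) :
    S.transB hη φ (ψ + ψ') = S.transB hη φ ψ + S.transB hη φ ψ' := by
  ext i
  rcases i with _ | j
  · rw [WL1.add_apply]; simp only [transB_none, add_zero]
  · rw [WL1.add_apply]
    simp only [transB_some]
    rw [S.vort_add hdom, bilF_add_right hη (S.vort_inL1 _) (S.vort_inL1 _) (S.vort_inL1 _)]
    rfl

theorem transB_smul_left (hdom : S.IsFundamentalDomain dom) (hη : 1 < η) (c : ℂ)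
    (φ ψ : S.XRed dom hη) : S.transB hη (c • φ) ψ = c • S.transB hη φ ψ := by
  ext i
  rcases i with _ | j
  · rw [WL1.smul_apply]; simp only [transB_none, mul_zero]
  · rw [WL1.smul_apply]
    simp only [transB_some]
    rw [S.vort_smul hdom, bilF_smul_left]
    rfl

theorem transB_smul_right (hdom : S.IsFundamentalDomain dom) (hη : 1 < η) (c : ℂ)
    (φ ψ : S.XRed dom hη) : S.transB hη φ (c • ψ) = c • S.transB hη φ ψ := by
  ext i
  rcases i with _ | j
  · rw [WL1.smul_apply]; simp only [transB_none, mul_zero]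
  · rw [WL1.smul_apply]
    simp only [transB_some]
    rw [S.vort_smul hdom, bilF_smul_right]
    rfl

theorem norm_transB_le_mul (hdom : S.IsFundamentalDomain dom) (hη : 1 < η)
    (φ ψ : S.XRed dom hη) : ‖S.transB hη φ ψ‖ ≤ (Fintype.card G * 18) * ‖φ‖ * ‖ψ‖ := by
  refine (S.norm_transB_le hη φ ψ).trans ?_
  rw [mul_assoc, mul_assoc]
  refine mul_le_mul_of_nonneg_left (mul_le_mul_of_nonneg_left ?_ (by norm_num))
    (Nat.cast_nonneg _)
  refine (tsum_pairTerm_le hη (S.vort_inL1 φ) (S.vort_inL1 ψ)).trans ?_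
  refine mul_le_mul (S.tsum_vort_le hdom φ) (S.tsum_vort_le hdom ψ) ?_ (norm_nonneg _)
  exact tsum_nonneg fun n => mul_nonneg (pow_nonneg (by linarith) _) (absSum_nonneg _ _)

/-- The transport part as a continuous bilinear map. -/
def transL (hdom : S.IsFundamentalDomain dom) (hη : 1 < η) :
    S.XRed dom hη →L[ℂ] S.XRed dom hη →L[ℂ] S.YRed dom hη :=
  LinearMap.mkContinuous₂ (LinearMap.mk₂ ℂ (S.transB (dom := dom) hη)
      (S.transB_add_left hdom hη) (S.transB_smul_left hdom hη)
      (S.transB_add_right hdom hη) (S.transB_smul_right hdom hη))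
    (Fintype.card G * 18) (S.norm_transB_le_mul hdom hη)

/-- Multiplication by the frequency. -/
def freqL (hη : 1 < η) : S.XRed dom hη →L[ℂ] S.XRed dom hη →L[ℂ] S.YRed dom hη :=
  (WL1.evalCLM (w := S.wX dom hη) none).smulRight (Complex.I • S.lastOp (dom := dom) hη)

/-- The bilinear part of `𝓕^red` as a continuous bilinear map. -/
def quadB (hdom : S.IsFundamentalDomain dom) (hη : 1 < η) :
    S.XRed dom hη →L[ℂ] S.XRed dom hη →L[ℂ] S.YRed dom hη :=
  S.freqL hη + S.transL hdom hη

theorem quadB_apply (hdom : S.IsFundamentalDomain dom) (hη : 1 < η) (φ ψ : S.XRed dom hη) :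
    S.quadB hdom hη φ ψ = (Complex.I * φ none) • S.lastOp hη ψ + S.transB hη φ ψ := by
  change φ none • Complex.I • S.lastOp hη ψ + S.transB hη φ ψ = _
  rw [smul_smul, mul_comm]

theorem norm_viscous_le (ν : ℝ) (n : Z4) :
    ‖(ν : ℂ) * (sqNorm n : ℂ)‖ ≤ (3 * |ν|) * order21 n := by
  have h := norm_symb_le ν 0 n
  simpa [symb] using h

/-- The exponential weight of `φhat` absorbs `n₄`, because `k ≤ η ^ k / (η - 1)`. -/
theorem phase_term_le (hη : 1 < η) (φhat : S.RedSeq dom hη) (j : S.Jred dom) :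
    |(j.1.1.1 3 : ℝ)| * ‖φhat j‖ ≤ ‖φhat‖ / (η - 1) ∧
    xi η j.1 * ‖φhat j‖ ≤ ‖φhat‖ := by
  have h1 : (S.orbCard j * xi η j) * ‖φhat j‖ ≤ ‖φhat‖ := φhat.le_norm j
  have hc : (1 : ℝ) ≤ S.orbCard j := by exact_mod_cast S.orbCard_pos (j : J)
  have hx := xi_pos hη j.1
  have h2 : xi η j.1 * ‖φhat j‖ ≤ ‖φhat‖ := by
    refine le_trans ?_ h1
    rw [mul_assoc]
    exact le_mul_of_one_le_left (by positivity) hc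
  refine ⟨?_, h2⟩
  have h3 : |(j.1.1.1 3 : ℝ)| ≤ xi η j.1 / (η - 1) :=
    (last_le_norm1 _).trans (nat_le_pow hη _)
  have h4 : 0 < η - 1 := by linarith
  calc |(j.1.1.1 3 : ℝ)| * ‖φhat j‖ ≤ xi η j.1 / (η - 1) * ‖φhat j‖ := by gcongr
    _ = (xi η j.1 * ‖φhat j‖) / (η - 1) := by ring
    _ ≤ _ := by gcongr

/-- The terms of the phase condition. -/
def phaseTerm {hη : 1 < η} (φhat : S.RedSeq dom hη) (φ : Option (S.Jred dom) → ℂ)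
    (j : S.Jred dom) : ℂ :=
  (S.orbCard j : ℂ) * (j.1.1.1 3 : ℂ) * φ (some j) * conj (φhat j)

theorem norm_phaseTerm_le {hη : 1 < η} (φhat : S.RedSeq dom hη) (φ : S.XRed dom hη)
    (j : S.Jred dom) : ‖S.phaseTerm φhat φ j‖ ≤
      ‖φhat‖ / (η - 1) * ((S.wX dom hη (some j) : ℝ) * ‖φ (some j)‖) := by
  have h1 := (S.phase_term_le hη φhat j).1
  have hx : 1 ≤ xi η j.1 := one_le_pow₀ hη.le
  have h2 : (0 : ℝ) ≤ S.orbCard j.1 := Nat.cast_nonneg _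
  have h3 : 0 ≤ ‖φhat‖ / (η - 1) := div_nonneg (norm_nonneg _) (by linarith)
  rw [phaseTerm, norm_mul, norm_mul, norm_mul, Complex.norm_natCast, Complex.norm_intCast,
    RCLike.norm_conj]
  change _ ≤ ‖φhat‖ / (η - 1) * (S.orbCard j.1 * xi η j.1 * ‖φ (some j)‖)
  calc (S.orbCard j.1 : ℝ) * |(j.1.1.1 3 : ℝ)| * ‖φ (some j)‖ * ‖φhat j‖
      = (|(j.1.1.1 3 : ℝ)| * ‖φhat j‖) * (S.orbCard j.1 * 1 * ‖φ (some j)‖) := by ring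
    _ ≤ _ := by gcongr

theorem summable_wX {hη : 1 < η} (φ : S.XRed dom hη) :
    Summable fun j : S.Jred dom => (S.wX dom hη (some j) : ℝ) * ‖φ (some j)‖ :=
  S.summable_option.1 φ.summable

theorem summable_phaseTerm {hη : 1 < η} (φhat : S.RedSeq dom hη) (φ : S.XRed dom hη) :
    Summable (S.phaseTerm φhat φ) :=
  Summable.of_norm_bounded ((S.summable_wX φ).mul_left _) (S.norm_phaseTerm_le φhat φ)

/-- The phase condition as a functional. -/
def phaseCLM {hη : 1 < η} (φhat : S.RedSeq dom hη) : S.XRed dom hη →L[ℂ] ℂ :=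
  LinearMap.mkContinuous
    { toFun := fun φ => Complex.I * ∑' j, S.phaseTerm φhat φ j
      map_add' := fun φ ψ => by
        rw [← mul_add, ← (S.summable_phaseTerm φhat φ).tsum_add (S.summable_phaseTerm φhat ψ)]
        congr 1
        refine tsum_congr fun j => ?_
        simp only [phaseTerm, WL1.add_apply]; ring
      map_smul' := fun c φ => by
        have h : ∀ j, S.phaseTerm φhat (c • φ : S.XRed dom hη) j = c * S.phaseTerm φhat φ j :=
          fun j => by simp only [phaseTerm, WL1.smul_apply]; ring
        rw [tsum_congr h, tsum_mul_left, RingHom.id_apply, smul_eq_mul]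
        ring }
    (‖φhat‖ / (η - 1)) fun φ => by
      have h3 : 0 ≤ ‖φhat‖ / (η - 1) := div_nonneg (norm_nonneg _) (by linarith)
      change ‖Complex.I * ∑' j, S.phaseTerm φhat φ j‖ ≤ _
      rw [norm_mul, Complex.norm_I, one_mul]
      refine (tsum_of_norm_bounded (HasSum.mul_left (‖φhat‖ / (η - 1)) (S.summable_wX φ).hasSum)
        (S.norm_phaseTerm_le φhat φ)).trans ?_
      refine mul_le_mul_of_nonneg_left ?_ h3
      have h2 := S.hasSum_option (w := fun i => (S.wX dom hη i : ℝ) * ‖φ i‖)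
        (S.summable_wX φ).hasSum
      rw [WL1.norm_def, h2.tsum_eq]
      exact le_add_of_nonneg_left (φ.term_nonneg none)

/-- The linear part of `𝓕^red`. -/
def linL {hη : 1 < η} (ν : ℝ) (φhat : S.RedSeq dom hη) : S.XRed dom hη →L[ℂ] S.YRed dom hη :=
  (S.phaseCLM φhat).smulRight (WL1.single (S.wY dom hη) none) +
    S.symbolOp hη (fun n => (ν : ℂ) * (sqNorm n : ℂ)) (3 * |ν|) (norm_viscous_le ν)

theorem linL_none {hη : 1 < η} (ν : ℝ) (φhat : S.RedSeq dom hη) (φ : S.XRed dom hη) :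
    S.linL ν φhat φ none = S.phaseCLM φhat φ := by
  change S.phaseCLM φhat φ * WL1.single (S.wY dom hη) none none + S.symbolOp hη _ _ _ φ none = _
  rw [symbolOp_none, WL1.single_apply]; simp

theorem linL_some {hη : 1 < η} (ν : ℝ) (φhat : S.RedSeq dom hη) (φ : S.XRed dom hη)
    (j : S.Jred dom) :
    S.linL ν φhat φ (some j) = (ν : ℂ) * (sqNorm j.1.1.1 : ℂ) * φ (some j) := by
  change S.phaseCLM φhat φ * WL1.single (S.wY dom hη) none (some j) +
    S.symbolOp hη _ _ _ φ (some j) = _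
  rw [symbolOp_some, WL1.single_apply]; simp

theorem Fred_none {hη : 1 < η} (ν : ℝ) (f : Forcing η) (φhat : S.RedSeq dom hη)
    (φ : S.XRed dom hη) : S.Fred hη ν f φhat φ none = S.phaseCLM φhat φ := rfl

theorem Fred_some {hη : 1 < η} (ν : ℝ) (f : Forcing η) (φhat : S.RedSeq dom hη)
    (φ : S.XRed dom hη) (j : S.Jred dom) : S.Fred hη ν f φhat φ (some j) =
      vortF ν (curlCoeff f.coeff) (φ none) (S.vort φ) j.1.1.1 j.1.2 := rfl

/-- The bilinear part contains the product of the unknown frequency with `n₄ φ` as well as the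
transport; the constant part comes from the forcing. -/
theorem Fred_eq (hdom : S.IsFundamentalDomain dom) {hη : 1 < η} (ν : ℝ) (f : Forcing η)
    (φhat : S.RedSeq dom hη) (φ : S.XRed dom hη) : S.Fred hη ν f φhat φ =
      S.quadB hdom hη φ φ + S.linL ν φhat φ + S.Fred hη ν f φhat 0 := by
  have hv : S.vort (0 : S.XRed dom hη) = 0 := by
    have := S.vort_smul hdom (hη := hη) 0 0
    simpa using this
  ext i
  rcases i with _ | j
  · rw [quadB_apply, WL1.add_apply, WL1.add_apply, WL1.add_apply, WL1.smul_apply, linL_none,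
      Fred_none, Fred_none, map_zero, lastOp_none, transB_none]
    ring
  · rw [quadB_apply, WL1.add_apply, WL1.add_apply, WL1.add_apply, WL1.smul_apply, linL_some,
      Fred_some, Fred_some, lastOp_some, vortF_eq, vortF_eq, S.vort_apply hdom, hv]
    have h1 : S.transB hη φ φ (some j) = bilF (S.vort φ) (S.vort φ) j.1.1.1 j.1.2 := rfl
    have h2 : bilF (0 : FSeq) 0 = 0 := by
      have := bilF_smul_left 0 0 (0 : FSeq)
      simpa using this
    rw [h1, h2]
    simp
    ring

/-- The derivative of `𝓕^red`. -/
def dFred (hdom : S.IsFundamentalDomain dom) {hη : 1 < η} (ν : ℝ)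
    (φhat : S.RedSeq dom hη) (φ : S.XRed dom hη) : S.XRed dom hη →L[ℂ] S.YRed dom hη :=
  S.quadB hdom hη φ + (S.quadB hdom hη).flip φ + S.linL ν φhat

theorem dFred_apply (hdom : S.IsFundamentalDomain dom) {hη : 1 < η} (ν : ℝ)
    (φhat : S.RedSeq dom hη) (φ ψ : S.XRed dom hη) : S.dFred hdom ν φhat φ ψ =
      S.quadB hdom hη φ ψ + S.quadB hdom hη ψ φ + S.linL ν φhat ψ := rfl

theorem fderiv_Fred (hdom : S.IsFundamentalDomain dom) {hη : 1 < η} (ν : ℝ) (f : Forcing η)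
    (φhat : S.RedSeq dom hη) (φ : S.XRed dom hη) :
    fderiv ℂ (S.Fred hη ν f φhat) φ = S.dFred hdom ν φhat φ := by
  refine HasFDerivAt.fderiv ?_
  have h := (((S.quadB hdom hη).hasFDerivAt_of_bilinear (hasFDerivAt_id φ)
    (hasFDerivAt_id φ)).add (S.linL ν φhat).hasFDerivAt).add_const (S.Fred hη ν f φhat 0)
  refine (h.congr_of_eventuallyEq (Filter.Eventually.of_forall fun ψ =>
    S.Fred_eq hdom ν f φhat ψ)).congr_fderiv ?_
  ext1 ψ
  rfl

/-- For bilinear `B`, symmetric or not, `2 (B(x,x) - B(y,y)) = B(x+y, x-y) + B(x-y, x+y)`. -/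
theorem Fred_sub (hdom : S.IsFundamentalDomain dom) {hη : 1 < η} (ν : ℝ) (f : Forcing η)
    (φhat : S.RedSeq dom hη) (φ ψ : S.XRed dom hη) :
    S.Fred hη ν f φhat φ - S.Fred hη ν f φhat ψ =
      fderiv ℂ (S.Fred hη ν f φhat) ((2 : ℂ)⁻¹ • (φ + ψ)) (φ - ψ) := by
  rw [S.fderiv_Fred hdom, dFred_apply, S.Fred_eq hdom ν f φhat φ, S.Fred_eq hdom ν f φhat ψ]
  simp only [map_add, map_sub, map_smul, add_apply, smul_apply, sub_apply]
  module

end SymAction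

open Filter Topology

theorem tendsto_gain (c : ℤ) : Tendsto (fun m : ℤ => gain (c + m)) atTop (𝓝 0) := by
  have h1 : Tendsto (fun m : ℤ => ((c + m : ℤ) : ℝ)) atTop atTop :=
    tendsto_intCast_atTop_atTop.comp (tendsto_atTop_add_const_left _ c tendsto_id)
  have h2 : Tendsto (fun m : ℤ => max 1 |((c + m : ℤ) : ℝ)|) atTop atTop :=
    tendsto_atTop_mono (fun m => (le_abs_self _).trans (le_max_right _ _)) h1
  have h3 := (Real.tendsto_sqrt_atTop.comp h2).inv_tendsto_atTop
  refine h3.congr fun m => ?_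
  simp [gain]

/-! ### Symmetries of zeros: full equation, unbounded time frequencies, conjugation. -/

namespace SymAction

variable {G : Type*} [Group G] (S : SymAction G)

theorem gam_restrict (g : G) (F : FSeq) (i : J) :
    S.gam g (fun i => F i.1.1 i.2) i = (S.detC g • S.vact g F) i.1.1 i.2 := by
  simp only [gam, Pi.smul_apply, vact, smul_eq_mul, alpha_eq, detC, beta]
  ring

/-- Purely temporal frequencies are fixed by `moveIndex`, so the cocycle law becomes
multiplicativity in `g`. Consequently `twist g v` is a root of unity of order dividing `|G|`, which
`twist_card_nsmul` exploits. -/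
theorem twist_pow_group (g : G) {v : Z4} (hv : sp v = 0) (k : ℕ) :
    S.twist (g ^ k) v = S.twist g v ^ k := by
  have hm : ∀ h, S.moveIndex h v = v := fun h =>
    ext_Z4 (by rw [hv, sp_moveIndex_eq_zero]; exact hv) (S.moveIndex_last h v)
  induction k with
  | zero =>
    have h := S.twist_mul 1 1 v
    rw [hm, mul_one] at h
    have hne : S.twist 1 v ≠ 0 := Complex.exp_ne_zero _
    rw [pow_zero, pow_zero]
    exact (mul_left_cancel₀ hne ((mul_one _).trans h)).symm
  | succ k ih => rw [pow_succ, twist_mul, hm, ih, pow_succ, mul_comm]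

theorem twist_nsmul (g : G) (v : Z4) (k : ℕ) : S.twist g (k • v) = S.twist g v ^ k := by
  induction k with
  | zero =>
    have h := S.twist_add g 0 0
    rw [add_zero] at h
    have hne : S.twist g 0 ≠ 0 := Complex.exp_ne_zero _
    rw [zero_smul, pow_zero]
    exact (mul_left_cancel₀ hne ((mul_one _).trans h)).symm
  | succ k ih => rw [succ_nsmul, twist_add, ih, pow_succ]

variable [Fintype G] {dom : Set J} {η : ℝ}

theorem twist_card_nsmul (g : G) {v : Z4} (hv : sp v = 0) :
    S.twist g (Fintype.card G • v) = 1 := by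
  rw [twist_nsmul, ← S.twist_pow_group g hv, pow_card_eq_one]
  exact (S.twist_pow_group g hv 0).trans (pow_zero _) |> fun h => by rwa [pow_zero] at h

/-- Reduced indices are unbounded in the time frequency. -/
theorem exists_red_last_ge (hdom : S.IsFundamentalDomain dom) (j₀ : S.Jred dom) (R : ℤ) :
    ∃ j : S.Jred dom, R ≤ j.1.1.1 3 ∧ sqNorm j.1.1.1 = sqNorm j₀.1.1.1 := by
  set n := j₀.1.1.1 with hn
  -- Large enough for `n₄ + |G| K ≥ max R 1`; the lower bound one keeps the shifted index nonzero.
  let K : ℕ := (max R 1 - n 3).toNat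
  let e : Z4 := Pi.single 3 (K : ℤ)
  have he : sp e = 0 := by
    funext l
    have : l.castSucc ≠ (3 : Fin 4) := by fin_cases l <;> decide
    simp [e, sp, this]
  have hKe : sp (Fintype.card G • e) = 0 := by
    have : sp (Fintype.card G • e) = Fintype.card G • sp e := rfl
    rw [this, he, smul_zero]
  let n' : Z4 := n + Fintype.card G • e
  have hsp : sp n' = sp n := by
    change sp n + sp (Fintype.card G • e) = sp n
    rw [hKe, add_zero]
  have h3 : max R 1 ≤ n' 3 := by
    have h4 : n' 3 = n 3 + Fintype.card G * K := by simp [n', e]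
    have h5 : max R 1 - n 3 ≤ K := Int.self_le_toNat _
    have h6 : (1 : ℤ) ≤ Fintype.card G := by exact_mod_cast Fintype.card_pos
    rw [h4]
    nlinarith
  have hn0 : n' ≠ 0 := fun h => by
    rw [h] at h3
    have : (1 : ℤ) ≤ 0 := (le_max_right _ _).trans h3
    omega
  let i : J := (⟨n', hn0⟩, j₀.1.2)
  -- An element fixing the shifted index also fixes `j₀`, as `ñ` and the component agree; its
  -- multiplier is unchanged because the time shift is a multiple of `|G|`.
  have hi : i ∈ S.Jsym := by
    rw [mem_Jsym_iff]
    intro g hg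
    have h7 : S.moveIndex g n' = n' := congrArg (fun q : J => q.1.1) hg
    have h8 : S.beta g j₀ = j₀ := by
      refine Prod.ext (Subtype.ext (ext_Z4 ?_ (S.moveIndex_last g n)))
        (show S.τ g j₀.1.2 = j₀.1.2 from congrArg (fun q : J => q.2) hg)
      have := congrArg sp h7
      rw [sp_moveIndex, hsp] at this
      exact (S.sp_moveIndex g n).trans this
    have h9 := (S.mem_Jsym_iff.1 j₀.2.2) g h8
    rw [alpha_eq] at h9 ⊢
    change _ * _ * S.twist g n' = 1
    rw [S.twist_add, S.twist_card_nsmul g he, mul_one]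
    exact h9
  obtain ⟨j, g, hj⟩ := S.exists_red hdom hi
  have h10 : S.moveIndex g j.1.1.1 = n' := congrArg (fun q : J => q.1.1) hj
  refine ⟨j, ?_, ?_⟩
  · rw [← S.moveIndex_last g j.1.1.1, h10]; exact (le_max_left _ _).trans h3
  · rw [← S.sqNorm_moveIndex g j.1.1.1, h10]
    simp [sqNorm, hsp]

theorem vort_gam (hdom : S.IsFundamentalDomain dom) (φ : Option (S.Jred dom) → ℂ) (g : G) :
    S.detC g • S.vact g (S.vort φ) = S.vort φ := by
  rw [vort, ← ext_gam, S.gam_Sig hdom]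

/-- The restricted equations imply the full vorticity equation. -/
theorem vortF_eq_zero (hdom : S.IsFundamentalDomain dom) {hη : 1 < η} {ν : ℝ} {f : Forcing η}
    (hf : ∀ g, S.detC g • S.vact g (curlCoeff f.coeff) = curlCoeff f.coeff)
    {φhat : S.RedSeq dom hη} {φ : S.XRed dom hη} (h : S.Fred hη ν f φhat φ = 0) (i : J) :
    vortF ν (curlCoeff f.coeff) (φ none) (S.vort φ) i.1.1 i.2 = 0 := by
  let w : J → ℂ := fun i => vortF ν (curlCoeff f.coeff) (φ none) (S.vort φ) i.1.1 i.2
  -- The residual is invariant, so `Σ` rebuilds it from its reduced coordinates, all of which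
  -- vanish.
  have hw : ∀ g, S.gam g w = w := fun g => funext fun i => by
    rw [S.gam_restrict g, ← S.vortF_vact ν (hf g), S.vort_gam hdom]
  have hP : S.Pr dom w = 0 := funext fun j => by
    have h1 : S.Fred hη ν f φhat φ (some j) = 0 := by rw [h]; rfl
    exact h1
  have h2 := S.Sig_Pr hdom hw
  rw [hP] at h2
  have h3 : S.Sig (0 : S.Jred dom → ℂ) = 0 := by
    have := S.Sig_smul hdom 0 0
    simpa using this
  rw [h3] at h2
  exact (congrFun h2 i).symm

/-- Reflection of indices. -/
def negJEquiv : J ≃ J := ⟨negJ, negJ, negJ_negJ, negJ_negJ⟩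

theorem xi_negJ (i : J) : xi η (negJ i) = xi η i := by
  simp [xi, negJ, norm1]

theorem summable_conjSym {ω : J → ℂ} (h : Summable fun i => xi η i * ‖ω i‖) :
    HasSum (fun i => xi η i * ‖conjSym ω i‖) (∑' i, xi η i * ‖ω i‖) := by
  have h1 := (Equiv.hasSum_iff negJEquiv).2 h.hasSum
  refine h1.congr_fun fun i => ?_
  change xi η i * ‖conj (ω (negJ i))‖ = xi η (negJ i) * ‖ω (negJ i)‖
  rw [RCLike.norm_conj, xi_negJ]

theorem redConj_summable (hdom : S.IsFundamentalDomain dom) {hη : 1 < η} (φ : S.XRed dom hη) :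
    Summable fun i => (S.wX dom hη i : ℝ) * ‖S.redConj φ i‖ := by
  rw [S.summable_option]
  exact (S.hasSum_norm_red hdom hη (S.gam_conjSym (S.gam_Sig hdom (S.seqPart φ)))
    (summable_conjSym (S.summable_Sig φ))).summable

/-- `γ̃_*` on `𝒳^red`. -/
def conjX (hdom : S.IsFundamentalDomain dom) {hη : 1 < η} (φ : S.XRed dom hη) : S.XRed dom hη :=
  WL1.mk (S.redConj φ) (S.redConj_summable hdom φ)

theorem Sig_conjX (hdom : S.IsFundamentalDomain dom) {hη : 1 < η} (φ : S.XRed dom hη) :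
    S.Sig (S.seqPart (S.conjX hdom φ)) = conjSym (S.Sig (S.seqPart φ)) :=
  S.Sig_Pr hdom (S.gam_conjSym (S.gam_Sig hdom (S.seqPart φ)))

theorem vort_conjX (hdom : S.IsFundamentalDomain dom) {hη : 1 < η} (φ : S.XRed dom hη) :
    S.vort (S.conjX hdom φ) = cjSeq (S.vort φ) := by
  rw [vort, S.Sig_conjX, ext_conjSym, vort]

theorem norm_conjX (hdom : S.IsFundamentalDomain dom) {hη : 1 < η} (φ : S.XRed dom hη) :
    ‖S.conjX hdom φ‖ = ‖φ‖ := by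
  rw [S.norm_eq hdom, S.norm_eq hdom, S.Sig_conjX, (summable_conjSym (S.summable_Sig φ)).tsum_eq]
  congr 1
  exact RCLike.norm_conj _

theorem conjX_sub (hdom : S.IsFundamentalDomain dom) {hη : 1 < η} (φ ψ : S.XRed dom hη) :
    S.conjX hdom (φ - ψ) = S.conjX hdom φ - S.conjX hdom ψ := by
  have h : S.seqPart (φ - ψ : S.XRed dom hη) = S.seqPart φ + (-1 : ℂ) • S.seqPart ψ := by
    funext j
    change φ (some j) - ψ (some j) = φ (some j) + -1 * ψ (some j)
    ring
  ext i
  rcases i with _ | j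
  · exact map_sub (starRingEnd ℂ) (φ none) (ψ none)
  · change conj (S.Sig (S.seqPart (φ - ψ : S.XRed dom hη)) _) =
      conj (S.Sig (S.seqPart φ) _) - conj (S.Sig (S.seqPart ψ) _)
    rw [h, S.Sig_add hdom, S.Sig_smul hdom, ← map_sub]
    simp [sub_eq_add_neg]

/-- The phase functional as a sum over all indices. -/
theorem hasSum_phase (hdom : S.IsFundamentalDomain dom) {hη : 1 < η} (φhat : S.RedSeq dom hη)
    (φ : S.XRed dom hη) :
    Summable (fun i : J => (i.1.1 3 : ℂ) * S.Sig (S.seqPart φ) i * conj (S.Sig φhat i)) ∧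
    S.phaseCLM φhat φ =
      Complex.I * ∑' i : J, (i.1.1 3 : ℂ) * S.Sig (S.seqPart φ) i * conj (S.Sig φhat i) := by
  set ω := S.Sig (S.seqPart φ)
  set ωh := S.Sig φhat
  have hωh : Summable fun i : J => xi η i * ‖ωh i‖ := S.Sig_summable hη _ φhat.summable
  have hs : Summable fun i : J => (i.1.1 3 : ℂ) * ω i * conj (ωh i) := by
    refine Summable.of_norm_bounded
      ((S.summable_Sig φ).mul_left ((∑' i, xi η i * ‖ωh i‖) / (η - 1))) fun i => ?_
    have h1 : xi η i * ‖ωh i‖ ≤ ∑' i, xi η i * ‖ωh i‖ := hωh.le_tsum i fun k _ =>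
      mul_nonneg (xi_pos hη k).le (norm_nonneg _)
    have h2 : |(i.1.1 3 : ℝ)| ≤ xi η i / (η - 1) := (last_le_norm1 _).trans (nat_le_pow hη _)
    have h3 : 0 < η - 1 := by linarith
    have h4 : 1 ≤ xi η i := one_le_pow₀ hη.le
    have h5 : 0 ≤ (∑' i, xi η i * ‖ωh i‖) / (η - 1) :=
      div_nonneg ((mul_nonneg (xi_pos hη i).le (norm_nonneg _)).trans h1) h3.le
    rw [norm_mul, norm_mul, RCLike.norm_conj, Complex.norm_intCast]
    calc |(i.1.1 3 : ℝ)| * ‖ω i‖ * ‖ωh i‖ ≤ xi η i / (η - 1) * ‖ω i‖ * ‖ωh i‖ := by gcongr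
      _ = (xi η i * ‖ωh i‖) / (η - 1) * (1 * ‖ω i‖) := by ring
      _ ≤ _ := by gcongr
  refine ⟨hs, ?_⟩
  have h := S.hasSum_red hdom (h := fun i : J => (i.1.1 3 : ℂ) * ω i * conj (ωh i))
    (fun i hi => by
      have : ω i = 0 := S.Sig_of_notMem _ hi
      rw [this]; ring)
    (fun g i => by
      have h1 : S.alpha g i * ω (S.beta g i) = ω i := congrFun (S.gam_Sig hdom _ g) i
      have h2 : S.alpha g i * ωh (S.beta g i) = ωh i := congrFun (S.gam_Sig hdom _ g) i
      -- The summand is invariant since the unit multipliers of the two factors cancel and `n₄` is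
      -- not moved.
      have h3 : S.alpha g i * conj (S.alpha g i) = 1 := by
        rw [Complex.mul_conj, Complex.normSq_eq_norm_sq, norm_alpha]; simp
      have h4 : (S.beta g i).1.1 3 = i.1.1 3 := S.moveIndex_last g i.1.1
      have h5 : conj (ωh i) = conj (S.alpha g i) * conj (ωh (S.beta g i)) := by
        rw [← h2, map_mul]
      rw [h4, h5]
      linear_combination (-(i.1.1 3 : ℂ) * ω (S.beta g i) * conj (ωh (S.beta g i))) * h3 +
        (i.1.1 3 : ℂ) * conj (S.alpha g i) * conj (ωh (S.beta g i)) * h1)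
    hs.hasSum
  have h5 : S.phaseCLM φhat φ = Complex.I * ∑' j, S.phaseTerm φhat φ j := rfl
  rw [h5, ← h.tsum_eq]
  congr 1
  refine tsum_congr fun j => ?_
  have h6 : ω j = φ (some j) := congrFun (S.Pr_Sig hdom (S.seqPart φ)) j
  have h7 : ωh j = φhat j := congrFun (S.Pr_Sig hdom (φhat : S.Jred dom → ℂ)) j
  rw [phaseTerm, h6, h7, nsmul_eq_mul]
  ring

/-- The equation commutes with conjugation because the forcing is real. In the phase condition,
reflecting indices replaces the sum by minus its conjugate, since `φhat` is fixed by conjugation. -/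
theorem Fred_conjX_eq_zero (hdom : S.IsFundamentalDomain dom) {hη : 1 < η} {ν : ℝ}
    {f : Forcing η} (hf : ∀ g, S.detC g • S.vact g (curlCoeff f.coeff) = curlCoeff f.coeff)
    {φhat : S.RedSeq dom hη} (hφhat : S.Pr dom (conjSym (S.Sig φhat)) = φhat)
    {φ : S.XRed dom hη} (h : S.Fred hη ν f φhat φ = 0) :
    S.Fred hη ν f φhat (S.conjX hdom φ) = 0 := by
  ext i
  rcases i with _ | j
  · have h0 : S.phaseCLM φhat φ = 0 := by rw [← S.Fred_none ν f, h]; rfl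
    rw [Fred_none, (S.hasSum_phase hdom φhat _).2]
    rw [(S.hasSum_phase hdom φhat φ).2] at h0
    have h1 := (mul_eq_zero.1 h0).resolve_left Complex.I_ne_zero
    have hh : conjSym (S.Sig φhat) = S.Sig φhat := by
      rw [← S.Sig_Pr hdom (S.gam_conjSym (S.gam_Sig hdom (φhat : S.Jred dom → ℂ))), hφhat]
    rw [S.Sig_conjX, ← negJEquiv.tsum_eq]
    have h2 : ∀ i : J, (((negJEquiv i).1.1 3 : ℤ) : ℂ) * conjSym (S.Sig (S.seqPart φ)) (negJEquiv i)
        * conj (S.Sig φhat (negJEquiv i)) =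
        -conj ((i.1.1 3 : ℂ) * S.Sig (S.seqPart φ) i * conj (S.Sig φhat i)) := fun i => by
      have h3 : S.Sig φhat (negJEquiv i) = conj (S.Sig φhat i) := by
        rw [← hh]
        change conj (S.Sig φhat (negJ (negJ i))) = conj (conjSym (S.Sig φhat) i)
        rw [negJ_negJ, hh]
      have h4 : conjSym (S.Sig (S.seqPart φ)) (negJEquiv i) = conj (S.Sig (S.seqPart φ) i) := by
        change conj (S.Sig (S.seqPart φ) (negJ (negJ i))) = _
        rw [negJ_negJ]
      have h5 : (((negJEquiv i).1.1 3 : ℤ) : ℂ) = -(i.1.1 3 : ℂ) := by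
        change ((-(i.1.1 3) : ℤ) : ℂ) = _
        push_cast; rfl
      rw [h3, h4, h5, map_mul, map_mul, map_intCast]
      ring
    rw [tsum_congr h2, tsum_neg, ← Complex.conj_tsum, h1]
    simp
  · rw [Fred_some, S.vort_conjX hdom]
    have h1 : S.conjX hdom φ none = conj (φ none) := rfl
    rw [h1, vortF_cjSeq ν (curlCoeff_cjSeq f.coeff_neg)]
    have h2 := S.vortF_eq_zero hdom hf h (negJ j)
    change conj (vortF ν (curlCoeff f.coeff) (φ none) (S.vort φ) (negJ (j : J)).1.1 (negJ (j : J)).2) = 0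
    rw [h2, map_zero]

/-! ### The frequency of the zero does not vanish. -/

section Frequency

variable {hη : 1 < η}

/-- Vorticity coefficients of a coordinate vector have a single time frequency. -/
theorem absSum_vort_single (j : S.Jred dom) {p : Z4} (hp : p 3 ≠ j.1.1.1 3) :
    absSum (S.vort (WL1.single (S.wX dom hη) (some j))) p = 0 := by
  refine Finset.sum_eq_zero fun l _ => ?_
  rw [norm_eq_zero]
  by_cases h0 : p = 0
  · simp [vort, ext, h0]
  have h1 : S.vort (WL1.single (S.wX dom hη) (some j)) p l =
    S.Sig (S.seqPart (WL1.single (S.wX dom hη) (some j))) (⟨p, h0⟩, l) := by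
    rw [vort]; exact ext_apply _ (⟨p, h0⟩, l)
  rw [h1, Sig]
  convert tsum_zero with k
  by_cases hk : k = j
  · subst hk
    rw [S.alphaT_eq_zero, mul_zero]
    rintro ⟨g, hg⟩
    apply hp
    rw [← S.moveIndex_last g k.1.1.1]
    exact congrArg (fun q : J => q.1.1 3) hg.symm
  · have : S.seqPart (WL1.single (S.wX dom hη) (some j)) k = 0 := by
      simp [seqPart, WL1.single_apply, hk]
    rw [this, zero_mul]

/-- A coordinate vector has one time frequency, since `G` does not move `n₄`. The gain then depends
only on the other argument and the double sum factorizes. -/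
theorem tsum_pairTerm_single_le (hdom : S.IsFundamentalDomain dom) (φ : S.XRed dom hη)
    (j : S.Jred dom) :
    ∑' q, pairTerm η (S.vort φ) (S.vort (WL1.single (S.wX dom hη) (some j))) q ≤
      (∑' k, η ^ norm1 k * absSum (S.vort φ) k * gain (k 3 + j.1.1.1 3)) *
        (S.wX dom hη (some j) : ℝ) := by
  set e := WL1.single (S.wX dom hη) (some j) with he
  set m := j.1.1.1 3
  have h0 : ∀ (ω : FSeq) n, 0 ≤ η ^ norm1 n * absSum ω n := fun ω n =>
    mul_nonneg (pow_nonneg (by linarith) _) (absSum_nonneg _ _)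
  have hA : Summable fun k => η ^ norm1 k * absSum (S.vort φ) k * gain (k 3 + m) :=
    Summable.of_nonneg_of_le (fun k => mul_nonneg (h0 _ k) (gain_pos _).le)
      (fun k => mul_le_of_le_one_right (h0 _ k) (gain_le_one _))
      (S.vort_inL1 φ).summable_absSum
  have hE := (S.vort_inL1 e).summable_absSum
  have hnorm : ‖e‖ = (S.wX dom hη (some j) : ℝ) := WL1.norm_single _
  have hT : ∀ q : Z4 × Z4, pairTerm η (S.vort φ) (S.vort e) q =
      (η ^ norm1 q.1 * absSum (S.vort φ) q.1 * gain (q.1 3 + m)) *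
        (η ^ norm1 q.2 * absSum (S.vort e) q.2) := fun q => by
    rw [pairTerm]
    by_cases hq : q.2 3 = m
    · rw [hq]; ring
    · rw [S.absSum_vort_single j hq]; ring
  have hs := summable_pairTerm hη (S.vort_inL1 φ) (S.vort_inL1 e)
  rw [tsum_congr hT]
  rw [← Summable.tsum_mul_tsum hA hE (hs.congr hT)]
  refine mul_le_mul_of_nonneg_left ?_ (tsum_nonneg fun k => mul_nonneg (h0 _ k) (gain_pos _).le)
  rw [← hnorm]
  exact S.tsum_vort_le hdom e

theorem pairTerm_comm (ω ω' : FSeq) :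
    ∑' q, pairTerm η ω ω' q = ∑' q, pairTerm η ω' ω q := by
  rw [← (Equiv.prodComm Z4 Z4).tsum_eq]
  refine tsum_congr fun q => ?_
  simp only [pairTerm, Equiv.prodComm_apply, Prod.fst_swap, Prod.snd_swap, add_comm (q.2 3)]
  ring

theorem WL1_single_some_none (j : S.Jred dom) : WL1.single (S.wX dom hη) (some j) none = 0 := by
  simp [WL1.single_apply]

/-- `|n₄| |φhat_j|` is bounded, while the norm of the coordinate vector is at least `|G.j| (η - 1)
n₄`. -/
theorem norm_phaseCLM_single_le (φhat : S.RedSeq dom hη) (j : S.Jred dom)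
    (hj : 0 < j.1.1.1 3) : ‖S.phaseCLM φhat (WL1.single (S.wX dom hη) (some j))‖ ≤
      ‖φhat‖ / (η - 1) / ((η - 1) * (j.1.1.1 3 : ℝ)) * (S.wX dom hη (some j) : ℝ) := by
  have h1 : S.phaseCLM φhat (WL1.single (S.wX dom hη) (some j)) =
      Complex.I * S.phaseTerm φhat (WL1.single (S.wX dom hη) (some j)) j := by
    change Complex.I * ∑' k, S.phaseTerm φhat (WL1.single (S.wX dom hη) (some j)) k = _
    rw [tsum_eq_single j fun k hk => by simp [phaseTerm, WL1.single_apply, hk]]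
  have h2 := (S.phase_term_le hη φhat j).1
  have h3 : 0 < η - 1 := by linarith
  have hj' : (0 : ℝ) < (j.1.1.1 3 : ℝ) := by exact_mod_cast hj
  have hx := xi_pos hη j.1
  have h4 : (η - 1) * (j.1.1.1 3 : ℝ) ≤ xi η j.1 := by
    have := (last_le_norm1 j.1.1.1).trans (nat_le_pow hη _)
    rw [le_div_iff₀ h3, abs_of_pos hj'] at this
    rw [mul_comm]; exact this
  rw [h1, norm_mul, Complex.norm_I, one_mul, phaseTerm, norm_mul, norm_mul, norm_mul,
    Complex.norm_natCast, Complex.norm_intCast, RCLike.norm_conj, WL1.single_apply, if_pos rfl,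
    norm_one]
  change _ ≤ _ * (S.orbCard j.1 * xi η j.1)
  have h5 : 0 ≤ ‖φhat‖ / (η - 1) := div_nonneg (norm_nonneg _) h3.le
  have hc : (0 : ℝ) ≤ S.orbCard j.1 := Nat.cast_nonneg _
  calc (S.orbCard j.1 : ℝ) * |(j.1.1.1 3 : ℝ)| * 1 * ‖φhat j‖
      = S.orbCard j.1 * (|(j.1.1.1 3 : ℝ)| * ‖φhat j‖) := by ring
    _ ≤ S.orbCard j.1 * (‖φhat‖ / (η - 1)) := by gcongr
    _ = ‖φhat‖ / (η - 1) / ((η - 1) * (j.1.1.1 3 : ℝ)) *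
        (S.orbCard j.1 * ((η - 1) * (j.1.1.1 3 : ℝ))) := by
        field_simp
    _ ≤ _ := by gcongr

/-- The target weight is smaller than the source weight by the factor `order21 ≥ n₄`. -/
theorem norm_viscous_single_le (ν : ℝ) (j : S.Jred dom) (hj : 0 < j.1.1.1 3) :
    ‖S.symbolOp hη (fun n => (ν : ℂ) * (sqNorm n : ℂ)) (3 * |ν|) (norm_viscous_le ν)
      (WL1.single (S.wX dom hη) (some j))‖ ≤
      |ν| * (sqNorm j.1.1.1 : ℝ) / (j.1.1.1 3 : ℝ) * (S.wX dom hη (some j) : ℝ) := by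
  have hj' : (0 : ℝ) < (j.1.1.1 3 : ℝ) := by exact_mod_cast hj
  have hq : (0 : ℝ) ≤ (sqNorm j.1.1.1 : ℝ) := (sq_nonneg _).trans (spSup_sq_le_sqNorm _)
  have ho : (j.1.1.1 3 : ℝ) ≤ order21 j.1.1.1 := (le_abs_self _).trans (le_max_right _ _)
  rw [WL1.norm_def, tsum_eq_single (some j)]
  · rw [symbolOp_some, WL1.single_apply, if_pos rfl, mul_one, norm_mul, Complex.norm_real,
      Complex.norm_intCast, Real.norm_eq_abs, abs_of_nonneg hq, ← S.wY_le]
    have hw := (S.wY dom hη (some j)).2.le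
    have h1 : 0 ≤ |ν| * (sqNorm j.1.1.1 : ℝ) := by positivity
    calc (S.wY dom hη (some j) : ℝ) * (|ν| * (sqNorm j.1.1.1 : ℝ))
        = |ν| * (sqNorm j.1.1.1 : ℝ) / (j.1.1.1 3 : ℝ) *
          ((S.wY dom hη (some j) : ℝ) * (j.1.1.1 3 : ℝ)) := by field_simp
      _ ≤ _ := by gcongr
  · intro i hi
    rcases i with _ | k
    · rw [symbolOp_none, norm_zero, mul_zero]
    · rw [symbolOp_some, WL1.single_apply, if_neg hi, mul_zero, norm_zero, mul_zero]

/-- Without the term `i Ω n₄` every contribution is small relative to the norm of the coordinate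
vector when `n₄` is large and `ñ²` stays bounded. -/
theorem norm_dFred_single_le (hdom : S.IsFundamentalDomain dom) (ν : ℝ) (φhat : S.RedSeq dom hη)
    {φ : S.XRed dom hη} (hφ : φ none = 0) (j : S.Jred dom) (hj : 0 < j.1.1.1 3) :
    ‖S.dFred hdom ν φhat φ (WL1.single (S.wX dom hη) (some j))‖ ≤
      (2 * (Fintype.card G * 18 *
        ∑' k, η ^ norm1 k * absSum (S.vort φ) k * gain (k 3 + j.1.1.1 3)) +
      ‖φhat‖ / (η - 1) / ((η - 1) * (j.1.1.1 3 : ℝ)) +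
      |ν| * (sqNorm j.1.1.1 : ℝ) / (j.1.1.1 3 : ℝ)) * (S.wX dom hη (some j) : ℝ) := by
  set e := WL1.single (S.wX dom hη) (some j) with he
  have h1 : S.dFred hdom ν φhat φ e = S.transB hη φ e + S.transB hη e φ + S.linL ν φhat e := by
    rw [dFred_apply, quadB_apply, quadB_apply, hφ, S.WL1_single_some_none]
    simp
  have h2 := S.tsum_pairTerm_single_le hdom φ j
  have h3 := S.norm_transB_le hη φ e
  have h4 := S.norm_transB_le hη e φ
  rw [pairTerm_comm] at h4
  have hc : (0 : ℝ) ≤ Fintype.card G * 18 := by positivity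
  have h5 := mul_le_mul_of_nonneg_left h2 hc
  have h6 : ‖S.linL ν φhat e‖ ≤
      ‖φhat‖ / (η - 1) / ((η - 1) * (j.1.1.1 3 : ℝ)) * (S.wX dom hη (some j) : ℝ) +
      |ν| * (sqNorm j.1.1.1 : ℝ) / (j.1.1.1 3 : ℝ) * (S.wX dom hη (some j) : ℝ) := by
    refine (norm_add_le _ _).trans (add_le_add ?_ (S.norm_viscous_single_le ν j hj))
    refine le_trans (le_of_eq ?_) (S.norm_phaseCLM_single_le φhat j hj)
    change ‖S.phaseCLM φhat e • WL1.single (S.wY dom hη) none‖ = _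
    rw [norm_smul, WL1.norm_single]
    exact mul_one _
  rw [h1]
  refine (norm_add_le _ _).trans ((add_le_add (norm_add_le _ _) h6).trans ?_)
  linarith

/-- At vanishing frequency the linearization has no bounded approximate left inverse. -/
theorem freq_ne_zero (hdom : S.IsFundamentalDomain dom) (ν : ℝ) (φhat : S.RedSeq dom hη)
    {φ : S.XRed dom hη} {A : S.YRed dom hη →L[ℂ] S.XRed dom hη}
    (h : ‖ContinuousLinearMap.id ℂ (S.XRed dom hη) - A ∘L S.dFred hdom ν φhat φ‖ < 1) :
    φ none ≠ 0 := by
  intro hφ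
  set q := ‖ContinuousLinearMap.id ℂ (S.XRed dom hη) - A ∘L S.dFred hdom ν φhat φ‖ with hq
  -- Nearness of `A ∘ D𝓕` to the identity bounds `D𝓕` from below.
  have key : ∀ e : S.XRed dom hη, (1 - q) * ‖e‖ ≤ ‖A‖ * ‖S.dFred hdom ν φhat φ e‖ := fun e => by
    have h1 := (ContinuousLinearMap.id ℂ (S.XRed dom hη) -
      A ∘L S.dFred hdom ν φhat φ).le_opNorm e
    have h2 : e = (ContinuousLinearMap.id ℂ (S.XRed dom hη) - A ∘L S.dFred hdom ν φhat φ) e +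
        A (S.dFred hdom ν φhat φ e) := by
      change e = (e - A (S.dFred hdom ν φhat φ e)) + A (S.dFred hdom ν φhat φ e)
      abel
    have h3 := A.le_opNorm (S.dFred hdom ν φhat φ e)
    have h4 : ‖e‖ ≤ _ + _ := (congrArg norm h2).le.trans (norm_add_le _ _)
    rw [← hq] at h1
    linarith
  -- Without reduced indices the frequency is the only coordinate, and the derivative vanishes in
  -- its direction.
  rcases isEmpty_or_nonempty (S.Jred dom) with hemp | ⟨⟨j₀⟩⟩
  · have h1 := key (WL1.single (S.wX dom hη) none)
    have h2 : S.dFred hdom ν φhat φ (WL1.single (S.wX dom hη) none) = 0 := by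
      ext i
      rcases i with _ | j
      · rw [dFred_apply, quadB_apply, quadB_apply, WL1.add_apply, WL1.add_apply, WL1.add_apply,
          WL1.add_apply, WL1.smul_apply, WL1.smul_apply, lastOp_none, lastOp_none, transB_none,
          transB_none, linL_none]
        have : S.phaseCLM φhat (WL1.single (S.wX dom hη) none) = Complex.I * ∑' j,
          S.phaseTerm φhat (WL1.single (S.wX dom hη) none) j := rfl
        rw [this, tsum_empty]
        simp
      · exact hemp.elim j
    rw [h2, norm_zero, mul_zero, WL1.norm_single] at h1
    have h3 : (S.wX dom hη none : ℝ) = 1 := rfl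
    rw [h3] at h1
    linarith
  · choose j hj hsq using fun k : ℕ => S.exists_red_last_ge hdom j₀ ((k : ℤ) + 1)
    have hpos : ∀ k, 0 < (j k).1.1.1 3 := fun k => by have := hj k; omega
    have hlim : Tendsto (fun k => (j k).1.1.1 3) atTop atTop :=
      tendsto_atTop_mono (fun k => (by omega : (k : ℤ) ≤ (k : ℤ) + 1).trans (hj k))
        tendsto_natCast_atTop_atTop
    have hlimR : Tendsto (fun k => ((j k).1.1.1 3 : ℝ)) atTop atTop :=
      tendsto_intCast_atTop_atTop.comp hlim
    have t1 : Tendsto (fun k => ∑' p : Z4, η ^ norm1 p * absSum (S.vort φ) p *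
        gain (p 3 + (j k).1.1.1 3)) atTop (𝓝 0) := by
      have h0 : ∀ n, 0 ≤ η ^ norm1 n * absSum (S.vort φ) n := fun n =>
        mul_nonneg (pow_nonneg (by linarith) _) (absSum_nonneg _ _)
      -- For each fixed `p` the gain tends to zero, and it is at most one.
      have := tendsto_tsum_of_dominated_convergence (𝓕 := atTop)
        (f := fun k (p : Z4) => η ^ norm1 p * absSum (S.vort φ) p * gain (p 3 + (j k).1.1.1 3))
        (g := fun _ => 0) (S.vort_inL1 φ).summable_absSum
        (fun p => by
          have := ((tendsto_gain (p 3)).comp hlim).const_mul (η ^ norm1 p * absSum (S.vort φ) p)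
          rwa [mul_zero] at this)
        (Filter.Eventually.of_forall fun k p => by
          rw [Real.norm_of_nonneg (mul_nonneg (h0 p) (gain_pos _).le)]
          exact mul_le_of_le_one_right (h0 p) (gain_le_one _))
      simpa using this
    have t2 : Tendsto (fun k => ‖φhat‖ / (η - 1) / ((η - 1) * ((j k).1.1.1 3 : ℝ))) atTop (𝓝 0) :=
      (hlimR.const_mul_atTop (by linarith : 0 < η - 1)).const_div_atTop _
    have t3 : Tendsto (fun k => |ν| * (sqNorm (j k).1.1.1 : ℝ) / ((j k).1.1.1 3 : ℝ))
        atTop (𝓝 0) := by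
      simp only [hsq]
      exact hlimR.const_div_atTop _
    have t4 := (((t1.const_mul (Fintype.card G * 18 : ℝ)).const_mul 2).add t2).add t3
    have t5 := t4.const_mul ‖A‖
    have h5 : ∀ k, 1 - q ≤ ‖A‖ * _ := fun k => by
      have h1 := (key (WL1.single (S.wX dom hη) (some (j k)))).trans (mul_le_mul_of_nonneg_left
        (S.norm_dFred_single_le hdom ν φhat hφ (j k) (hpos k)) (norm_nonneg A))
      rw [WL1.norm_single, ← mul_assoc] at h1
      exact le_of_mul_le_mul_right h1 (S.wX dom hη (some (j k))).2
    have h6 := ge_of_tendsto' t5 h5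
    simp only [mul_zero, add_zero] at h6
    linarith

end Frequency

end SymAction

theorem hasSum_sub_left {E : Type*} [AddCommMonoid E] [TopologicalSpace E] {F : Z4 → E} {s : E}
    (n : Z4) (h : HasSum F s) : HasSum (fun k => F (n - k)) s :=
  (Equiv.hasSum_iff (Equiv.subLeft n)).2 h

/-! ### Vector calculus identities for Fourier coefficients. -/

section Coefficients

variable {η : ℝ} {a b : FSeq}

theorem hasSum_starD (hη : 1 < η) (ha : InL1 η a) (hb : InL1 η b) (n : Z4) :
    HasSum (fun k => (spC (n - k) ⬝ᵥ a k) • b (n - k)) (starD a b n) := by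
  refine Pi.hasSum.2 fun l => ?_
  have h := hasSum_sum fun m (_ : m ∈ Finset.univ) => (ha.summable_starD hη hb n l m).hasSum
  refine h.congr_fun fun k => ?_
  simp only [Pi.smul_apply, smul_eq_mul, dotProduct, Finset.sum_mul, Dx, spC]
  exact Finset.sum_congr rfl fun m _ => by ring

theorem hasSum_dot {F : Z4 → Fin 3 → ℂ} {s : Fin 3 → ℂ} (h : HasSum F s) (v : Fin 3 → ℂ) :
    HasSum (fun k => v ⬝ᵥ F k) (v ⬝ᵥ s) :=
  hasSum_sum fun l _ => (Pi.hasSum.1 h l).mul_left (v l)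

theorem hasSum_cross {F : Z4 → Fin 3 → ℂ} {s : Fin 3 → ℂ} (h : HasSum F s) (v : Fin 3 → ℂ) :
    HasSum (fun k => crossProduct v (F k)) (crossProduct v s) :=
  h.mapL (LinearMap.toContinuousLinearMap (crossProduct v))

theorem dot_M' (ω : FSeq) (n : Z4) : spC n ⬝ᵥ M ω n = 0 := dot_M ω n

/-- The divergence of the transport terms. -/
theorem hasSum_div_transport (hη : 1 < η) (ha : InL1 η a) (hb : InL1 η b)
    (hdiv : ∀ n, spC n ⬝ᵥ a n = 0) (n : Z4) :
    HasSum (fun k => (spC (n - k) ⬝ᵥ a k) * (spC (n - k) ⬝ᵥ b (n - k)))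
      (spC n ⬝ᵥ starD a b n - spC n ⬝ᵥ starD b a n) := by
  have h1 := hasSum_dot (hasSum_starD hη ha hb n) (spC n)
  have h2 := hasSum_sub_left n (hasSum_dot (hasSum_starD hη hb ha n) (spC n))
  refine (h1.sub h2).congr_fun fun k => ?_
  -- With `p = n - k` one has `n · a_k = p · a_k`, and the mixed terms `(p · a_k) (k · b_p)` cancel.
  have e : spC n = spC k + spC (n - k) := by rw [spC_sub]; abel
  simp only [sub_sub_cancel, dotProduct_smul, smul_eq_mul]
  rw [e, add_dotProduct, add_dotProduct, hdiv k]
  ring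

/-- This is the joint contribution of two divergence free modes to the defect in `cross_starD_self`;
only the sum over both orders vanishes. -/
theorem cross_pair_identity (k p a b : Fin 3 → ℂ) (ha : k ⬝ᵥ a = 0) (hb : p ⬝ᵥ b = 0) :
    (p ⬝ᵥ a) • crossProduct k b + (p ⬝ᵥ crossProduct k a) • b
      + ((k ⬝ᵥ b) • crossProduct p a + (k ⬝ᵥ crossProduct p b) • a) = 0 := by
  simp only [dotProduct, Fin.sum_univ_three] at ha hb
  funext l
  fin_cases l <;>
    simp [crossProduct, dotProduct, Fin.sum_univ_three, Matrix.vecHead, Matrix.vecTail]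
  · linear_combination (p 1 * b 2 - p 2 * b 1) * ha + (k 1 * a 2 - k 2 * a 1) * hb
  · linear_combination (p 2 * b 0 - p 0 * b 2) * ha + (k 2 * a 0 - k 0 * a 2) * hb
  · linear_combination (p 0 * b 1 - p 1 * b 0) * ha + (k 0 * a 1 - k 1 * a 0) * hb

/-- The curl of the transport term of a divergence free field. -/
theorem cross_starD_self (hη : 1 < η) (ha : InL1 η a) (hb : InL1 η b)
    (hdiv : ∀ n, spC n ⬝ᵥ a n = 0) (hcurl : ∀ n, b n = Complex.I • crossProduct (spC n) (a n))
    (n : Z4) : Complex.I • crossProduct (spC n) (starD a a n) = starD a b n - starD b a n := by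
  -- The summand of the defect after inserting `n = k + (n - k)`. It cancels against its reflection
  -- `k ↦ n - k`, so twice the defect is zero.
  let g : Z4 → Fin 3 → ℂ := fun k => Complex.I • ((spC (n - k) ⬝ᵥ a k) • crossProduct (spC k) (a (n - k))
    + (spC (n - k) ⬝ᵥ crossProduct (spC k) (a k)) • a (n - k))
  have h1 := ((hasSum_cross (hasSum_starD hη ha ha n) (spC n)).const_smul Complex.I).sub
    ((hasSum_starD hη ha hb n).sub (hasSum_starD hη hb ha n))
  have h2 : HasSum g (Complex.I • crossProduct (spC n) (starD a a n) -
      (starD a b n - starD b a n)) := by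
    refine h1.congr_fun fun k => ?_
    have e : spC n = spC k + spC (n - k) := by rw [spC_sub]; abel
    simp only [g, hcurl]
    rw [e]
    simp only [map_add, map_smul, LinearMap.add_apply, dotProduct_smul, smul_eq_mul]
    module
  have h3 := h2.add (hasSum_sub_left n h2)
  have h4 : ∀ k, g k + g (n - k) = 0 := fun k => by
    have h5 := cross_pair_identity (spC k) (spC (n - k)) (a k) (a (n - k)) (hdiv k) (hdiv (n - k))
    have h6 : n - (n - k) = k := sub_sub_cancel _ _
    simp only [g, h6]
    rw [← smul_add, h5, smul_zero]
  have h7 := h3.unique (hasSum_zero.congr_fun h4)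
  have h8 : (2 : ℂ) • (Complex.I • crossProduct (spC n) (starD a a n) -
      (starD a b n - starD b a n)) = 0 := by rw [two_smul]; exact h7
  exact sub_eq_zero.1 ((smul_eq_zero.1 h8).resolve_left two_ne_zero)

/-- In conservative form every term carries a component of `ñ`. -/
theorem starD_eq_zero_of_div (hη : 1 < η) (ha : InL1 η a) (hb : InL1 η b)
    (hdiv : ∀ n, spC n ⬝ᵥ a n = 0) {n : Z4} (hn : sp n = 0) : starD a b n = 0 := by
  funext l
  rw [starD_eq_of_div hη ha hb hdiv]
  simp [hn]

theorem spC_dot_self (n : Z4) : spC n ⬝ᵥ spC n = (sqNorm n : ℂ) := by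
  simp only [dotProduct, spC, sqNorm]
  push_cast
  exact Finset.sum_congr rfl fun l _ => (sq _).symm

theorem sqNorm_ne_zero {n : Z4} (hn : sp n ≠ 0) : (sqNorm n : ℂ) ≠ 0 := by
  have h : 0 < (spSup n : ℝ) := by exact_mod_cast spSup_pos hn
  have h2 : (0 : ℝ) < sqNorm n := lt_of_lt_of_le (by positivity) (spSup_sq_le_sqNorm n)
  exact_mod_cast h2.ne'

theorem cross_cross_self (v w : Fin 3 → ℂ) :
    crossProduct v (crossProduct v w) = (v ⬝ᵥ w) • v - (v ⬝ᵥ v) • w := by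
  funext l
  fin_cases l <;> simp [crossProduct, dotProduct, Fin.sum_univ_three] <;> ring

/-- The forcing coefficients on `ℤ⁴`. -/
def forceSeq (c : (Fin 3 → ℤ) → Fin 3 → ℂ) : FSeq := fun n l => if n 3 = 0 then c (sp n) l else 0

theorem cross_spC_eq (c : (Fin 3 → ℤ) → Fin 3 → ℂ) (n : Z4) : curlCoeff c n =
    Complex.I • crossProduct (spC n) (forceSeq c n) := by
  by_cases h : n 3 = 0
  · have h2 : forceSeq c n = c (sp n) := by funext l; simp [forceSeq, h]
    simp only [curlCoeff, h2, h, if_true]; rfl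
  · have h2 : forceSeq c n = 0 := by funext l; simp [forceSeq, h]
    simp [curlCoeff, h, h2]

theorem dot_curlCoeff (c : (Fin 3 → ℤ) → Fin 3 → ℂ) (n : Z4) : spC n ⬝ᵥ curlCoeff c n = 0 := by
  rw [cross_spC_eq, dotProduct_smul, dot_self_cross, smul_zero]

end Coefficients

/-! ### Divergence, spatial averages and pressure of a real solution. -/

section Vorticity

variable {η ν Ω : ℝ} {ω : FSeq} {c : (Fin 3 → ℤ) → Fin 3 → ℂ}

/-- The vorticity equation in vector form. -/
theorem vortF_vec (h : ∀ n ≠ 0, ∀ l, vortF ν (curlCoeff c) Ω ω n l = 0) {n : Z4} (hn : n ≠ 0) :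
    (Complex.I * Ω * (n 3 : ℂ) + (ν : ℂ) * (sqNorm n : ℂ)) • ω n +
      Complex.I • (starD (M ω) ω n - starD ω (M ω) n) = curlCoeff c n := by
  funext l
  have := h n hn l
  rw [vortF] at this
  simp only [Pi.add_apply, Pi.smul_apply, Pi.sub_apply, smul_eq_mul]
  linear_combination this

theorem expDecay_div (h : InL1 η ω) {θ : ℝ} (h0 : 0 < θ) (hθ : θ < η) :
    ExpDecay θ fun n => spC n ⬝ᵥ ω n :=
  ExpDecay.finset_sum _ (fun m _ => (h.expDecay m).dx h0 hθ m) h0.le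

/-- A real solution of the vorticity equation is divergence free. -/
theorem div_eq_zero (hη : 1 < η) (hν : 0 < ν) (hω : InL1 η ω) (h0 : ω 0 = 0)
    (hreal : cjSeq ω = ω) (h : ∀ n ≠ 0, ∀ l, vortF ν (curlCoeff c) Ω ω n l = 0) (n : Z4) :
    spC n ⬝ᵥ ω n = 0 := by
  set u := M ω with hu
  set d : Z4 → ℂ := fun n => spC n ⬝ᵥ ω n with hd
  have hM : InL1 η u := hω.M hη
  have hudiv := dot_M' ω
  have hureal : cjSeq u = u := by rw [hu, ← M_cjSeq, hreal]
  obtain ⟨θ, hθ1, hθ⟩ := exists_between hη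
  have hdd := expDecay_div hω (by linarith) hθ
  -- The divergence of the nonlinear terms is the transport of `d` by `u`.
  have hT : ∀ n, HasSum (fun k => (spC k ⬝ᵥ u (n - k)) * d k)
      (spC n ⬝ᵥ starD u ω n - spC n ⬝ᵥ starD ω u n) := fun n => by
    have := hasSum_sub_left n (hasSum_div_transport hη hM hω hudiv n)
    simpa only [sub_sub_cancel] using this
  let t : Z4 × Z4 → ℂ := fun q => (spC q.2 ⬝ᵥ u (q.1 - q.2)) * d q.2 * conj (d q.1)
  -- Decay of the second factor `d` absorbs the derivative, so that the energy pairing `t` is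
  -- absolutely summable.
  obtain ⟨C, hC⟩ : ∃ C : ℝ, ∀ n, (norm1 n : ℝ) * ‖d n‖ ≤ C := by
    have h1 : ExpDecay 1 fun n => (norm1 n : ℂ) * d n :=
      ExpDecay.mul_linear hdd one_pos hθ1 zero_le_one fun n => by simp
    refine ⟨∑' k, ‖(norm1 k : ℂ) * d k‖, fun n => ?_⟩
    have := (h1.norm_summable le_rfl).le_tsum n fun k _ => norm_nonneg _
    rwa [norm_mul, Complex.norm_natCast] at this
  have ht : Summable t := by
    have h1 : Summable fun q : Z4 × Z4 => absSum u q.1 * ‖d q.2‖ :=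
      Summable.mul_of_nonneg (f := fun n => absSum u n) (g := fun n => ‖d n‖)
        (summable_sum fun l _ => (hM.expDecay l).norm_summable hη.le)
        (hdd.norm_summable hθ1.le) (fun n => absSum_nonneg u n) (fun n => norm_nonneg _)
    let e : Z4 × Z4 ≃ Z4 × Z4 :=
      { toFun := fun q => (q.1 - q.2, q.2)
        invFun := fun q => (q.1 + q.2, q.2)
        left_inv := fun q => by ext <;> simp
        right_inv := fun q => by ext <;> simp }
    have h2 : Summable fun q : Z4 × Z4 => absSum u (q.1 - q.2) * ‖d q.2‖ := e.summable_iff.2 h1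
    refine Summable.of_norm_bounded (h2.mul_left C) fun q => ?_
    have e1 : spC q.2 ⬝ᵥ u (q.1 - q.2) = spC q.1 ⬝ᵥ u (q.1 - q.2) := by
      have h3 := hudiv (q.1 - q.2)
      rw [spC_sub, sub_dotProduct] at h3
      exact (sub_eq_zero.1 h3).symm
    have e2 : ‖spC q.1 ⬝ᵥ u (q.1 - q.2)‖ ≤ norm1 q.1 * absSum u (q.1 - q.2) := by
      refine (norm_sum_le _ _).trans ?_
      rw [absSum, Finset.mul_sum]
      refine Finset.sum_le_sum fun l _ => ?_
      rw [norm_mul]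
      refine mul_le_mul_of_nonneg_right ?_ (norm_nonneg _)
      rw [spC, Complex.norm_intCast]
      exact sp_le_norm1 _ _
    have h4 := absSum_nonneg u (q.1 - q.2)
    simp only [t]
    rw [e1, norm_mul, norm_mul, RCLike.norm_conj]
    calc ‖spC q.1 ⬝ᵥ u (q.1 - q.2)‖ * ‖d q.2‖ * ‖d q.1‖
        ≤ (norm1 q.1 * absSum u (q.1 - q.2)) * ‖d q.2‖ * ‖d q.1‖ := by gcongr
      _ = (norm1 q.1 * ‖d q.1‖) * (absSum u (q.1 - q.2) * ‖d q.2‖) := by ring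
      _ ≤ _ := mul_le_mul_of_nonneg_right (hC _) (by positivity)
  -- Transport by a real divergence free field is skew; in these coefficients its pairing with `d`
  -- is a real number.
  have hconj : ∀ q, conj (t q) = t q.swap := fun q => by
    have e1 : spC q.2 ⬝ᵥ u (q.1 - q.2) = spC q.1 ⬝ᵥ u (q.1 - q.2) := by
      have h3 := hudiv (q.1 - q.2)
      rw [spC_sub, sub_dotProduct] at h3
      exact (sub_eq_zero.1 h3).symm
    have e2 : conj (spC q.1 ⬝ᵥ u (q.1 - q.2)) = spC q.1 ⬝ᵥ u (q.2 - q.1) := by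
      rw [dotProduct, dotProduct, map_sum]
      refine Finset.sum_congr rfl fun l _ => ?_
      rw [map_mul]
      have h5 : u (q.2 - q.1) l = conj (u (q.1 - q.2) l) := by
        rw [← hureal]
        have : cjSeq u (q.2 - q.1) l = conj (u (-(q.2 - q.1)) l) := rfl
        rw [this, neg_sub, hureal]
      rw [h5, spC, map_intCast]
    simp only [t, Prod.fst_swap, Prod.snd_swap]
    rw [e1, map_mul, map_mul, e2, Complex.conj_conj]
    ring
  have hS : conj (∑' q, t q) = ∑' q, t q := by
    rw [Complex.conj_tsum, tsum_congr hconj]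
    exact (Equiv.prodComm Z4 Z4).tsum_eq t
  -- The time derivative contributes only to the real part and the curl of the forcing has no
  -- divergence, so the imaginary part isolates dissipation.
  have hn : ∀ n, ν * (sqNorm n : ℝ) * ‖d n‖ ^ 2 =
      ((spC n ⬝ᵥ starD u ω n - spC n ⬝ᵥ starD ω u n) * conj (d n)).im := fun n => by
    by_cases hn0 : n = 0
    · have : d n = 0 := by simp [hd, hn0, h0]
      simp [this]
    have h1 := congrArg (fun v => spC n ⬝ᵥ v) (vortF_vec h hn0)
    simp only [dotProduct_add, dotProduct_smul, dotProduct_sub, dot_curlCoeff, smul_eq_mul] at h1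
    have h2 : d n * conj (d n) = ((‖d n‖ ^ 2 : ℝ) : ℂ) := by
      rw [Complex.mul_conj, Complex.normSq_eq_norm_sq]
    have h3 : (spC n ⬝ᵥ starD u ω n - spC n ⬝ᵥ starD ω u n) * conj (d n) =
        (((-(Ω * n 3) * ‖d n‖ ^ 2 : ℝ)) : ℂ) +
          ((ν * (sqNorm n : ℝ) * ‖d n‖ ^ 2 : ℝ) : ℂ) * Complex.I := by
      push_cast at h2 ⊢
      have hI : Complex.I * Complex.I = -1 := Complex.I_mul_I
      have h1' : (Complex.I * Ω * (n 3 : ℂ) + (ν : ℂ) * (sqNorm n : ℂ)) * d n +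
        Complex.I * (spC n ⬝ᵥ starD u ω n - spC n ⬝ᵥ starD ω u n) = 0 := h1
      linear_combination (-Complex.I * conj (d n)) * h1' + (-(Ω : ℂ) * (n 3 : ℂ)
        + Complex.I * (ν : ℂ) * (sqNorm n : ℂ)) * h2 + ((Ω : ℂ) * (n 3 : ℂ) * d n * conj (d n)
        + (spC n ⬝ᵥ starD u ω n - spC n ⬝ᵥ starD ω u n) * conj (d n)) * hI
    rw [h3, Complex.add_im, Complex.ofReal_im, Complex.mul_I_im, Complex.ofReal_re, zero_add]
  have hsum : HasSum (fun n => ν * (sqNorm n : ℝ) * ‖d n‖ ^ 2) 0 := by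
    have h1 : HasSum (fun n => (spC n ⬝ᵥ starD u ω n - spC n ⬝ᵥ starD ω u n) * conj (d n))
        (∑' q, t q) := by
      have hf : ∀ n, HasSum (fun k => t (n, k))
          ((spC n ⬝ᵥ starD u ω n - spC n ⬝ᵥ starD ω u n) * conj (d n)) := fun n =>
        (hT n).mul_right (conj (d n))
      exact ht.hasSum.prod_fiberwise hf
    have h2 := Complex.hasSum_im h1
    rw [Complex.conj_eq_iff_im.1 hS] at h2
    exact h2.congr_fun hn
  have hnn : ∀ n, 0 ≤ ν * (sqNorm n : ℝ) * ‖d n‖ ^ 2 := fun n => by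
    have : (0 : ℝ) ≤ sqNorm n := (sq_nonneg _).trans (spSup_sq_le_sqNorm n)
    positivity
  have h5 := congrFun ((hasSum_zero_iff_of_nonneg hnn).1 hsum) n
  by_cases hsp : sp n = 0
  · simp [dotProduct, spC, hsp]
  · have h6 : (sqNorm n : ℝ) ≠ 0 := by exact_mod_cast sqNorm_ne_zero hsp
    have h7 : ν * (sqNorm n : ℝ) * ‖d n‖ ^ 2 = 0 := h5
    have h8 := (mul_eq_zero.1 h7).resolve_left (mul_ne_zero hν.ne' h6)
    exact norm_eq_zero.1 (pow_eq_zero_iff two_ne_zero |>.1 h8)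

/-- A divergence free solution with nonzero frequency has zero spatial averages. -/
theorem eq_zero_of_sp_eq_zero (hη : 1 < η) (hΩ : Ω ≠ 0) (hω : InL1 η ω) (h0 : ω 0 = 0)
    (hdiv : ∀ n, spC n ⬝ᵥ ω n = 0) (h : ∀ n ≠ 0, ∀ l, vortF ν (curlCoeff c) Ω ω n l = 0)
    {n : Z4} (hn : sp n = 0) : ω n = 0 := by
  by_cases hn0 : n = 0
  · rw [hn0, h0]
  have h3 : n 3 ≠ 0 := fun h3 => hn0 (SymAction.ext_Z4 hn h3)
  have h1 := vortF_vec h hn0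
  have hs : sqNorm n = 0 := by simp [sqNorm, hn]
  -- Only `i Ω n₄ ω_n` remains: transport and viscosity vanish at `ñ = 0`, and the forcing does not
  -- depend on time.
  rw [starD_eq_zero_of_div hη (hω.M hη) hω (dot_M' ω) hn,
    starD_eq_zero_of_div hη hω (hω.M hη) hdiv hn, sub_zero, smul_zero, add_zero, hs] at h1
  have h2 : curlCoeff c n = 0 := by funext l; simp [curlCoeff, h3]
  rw [h2, smul_eq_zero] at h1
  refine h1.resolve_left ?_
  have : (Ω : ℂ) ≠ 0 := by exact_mod_cast hΩ
  simp [this, h3]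

/-- The vorticity is the curl of the velocity. -/
theorem curl_M (hdiv : ∀ n, spC n ⬝ᵥ ω n = 0) (hz : ∀ n, sp n = 0 → ω n = 0) (n : Z4) :
    ω n = Complex.I • crossProduct (spC n) (M ω n) := by
  by_cases hn : sp n = 0
  · rw [hz n hn, M_eq_zero _ _ hn, map_zero, smul_zero]
  · have h1 := sqNorm_ne_zero hn
    rw [M_eq _ _ hn, map_smul, smul_smul, cross_cross_self, hdiv, spC_dot_self, zero_smul, zero_sub,
      smul_neg, smul_smul, ← neg_smul]
    have : -(Complex.I * (Complex.I / (sqNorm n : ℂ)) * (sqNorm n : ℂ)) = 1 := by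
      field_simp
      rw [Complex.I_sq]; ring
    rw [this, one_smul]

/-- Fourier coefficients of the pressure. -/
def presSeq (c : (Fin 3 → ℤ) → Fin 3 → ℂ) (u : FSeq) : Z4 → ℂ := fun n =>
  (Complex.I / (sqNorm n : ℂ)) *
    (spC n ⬝ᵥ (Complex.I • starD u u n - forceSeq c n))

/-- The momentum equation in Fourier coefficients. -/
theorem momentum (hη : 1 < η) (hω : InL1 η ω) (hc : c 0 = 0)
    (hdiv : ∀ n, spC n ⬝ᵥ ω n = 0) (hz : ∀ n, sp n = 0 → ω n = 0)
    (h : ∀ n ≠ 0, ∀ l, vortF ν (curlCoeff c) Ω ω n l = 0) (n : Z4) :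
    (Complex.I * Ω * (n 3 : ℂ) + (ν : ℂ) * (sqNorm n : ℂ)) • M ω n +
      Complex.I • starD (M ω) (M ω) n + (Complex.I * presSeq c (M ω) n) • spC n
      - forceSeq c n = 0 := by
  set u := M ω with hu
  by_cases hn : sp n = 0
  -- At `ñ = 0` no pressure is available; each term vanishes separately, the forcing because it has
  -- zero average.
  · have h1 : u n = 0 := M_eq_zero _ _ hn
    have h2 : spC n = 0 := by funext l; simp [spC, hn]
    have h3 : forceSeq c n = 0 := by
      funext l
      simp [forceSeq, hn, hc]
    rw [h1, h2, h3, starD_eq_zero_of_div hη (hω.M hη) (hω.M hη) (dot_M' ω) hn]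
    simp
  · have hn0 : n ≠ 0 := fun h0 => hn (by rw [h0]; rfl)
    have hq := sqNorm_ne_zero hn
    set R := (Complex.I * Ω * (n 3 : ℂ) + (ν : ℂ) * (sqNorm n : ℂ)) • u n +
      Complex.I • starD u u n - forceSeq c n with hR
    -- The curl of the residual `R` is the vorticity equation. Hence `R` is parallel to `ñ`, and the
    -- pressure coefficient is read off from the component along `ñ`.
    have h1 : crossProduct (spC n) R = 0 := by
      have h2 := vortF_vec h hn0
      have h3 := curl_M hdiv hz n
      have h4 := cross_starD_self hη (hω.M hη) hω (dot_M' ω) (curl_M hdiv hz) n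
      rw [← h4, cross_spC_eq, h3] at h2
      have h5 : Complex.I • crossProduct (spC n) R = 0 := by
        rw [hR]
        simp only [map_add, map_sub, map_smul]
        rw [smul_sub, ← h2]
        module
      exact (smul_eq_zero.1 h5).resolve_left Complex.I_ne_zero
    have h6 := cross_cross_self (spC n) R
    rw [h1, map_zero, spC_dot_self] at h6
    have h7 : spC n ⬝ᵥ R = spC n ⬝ᵥ (Complex.I • starD u u n - forceSeq c n) := by
      rw [hR, add_sub_assoc, dotProduct_add, dotProduct_smul, hu, dot_M', smul_zero, zero_add]
    have h8 : R + (Complex.I * presSeq c u n) • spC n = 0 := by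
      have h9 : R = (spC n ⬝ᵥ R / (sqNorm n : ℂ)) • spC n := by
        have h10 : (sqNorm n : ℂ) • R = (spC n ⬝ᵥ R) • spC n := (sub_eq_zero.1 h6.symm).symm
        rw [div_eq_inv_mul, mul_smul, ← h10, smul_smul, inv_mul_cancel₀ hq, one_smul]
      have h11 : Complex.I * (Complex.I / (sqNorm n : ℂ) * (spC n ⬝ᵥ R)) =
          -(spC n ⬝ᵥ R / (sqNorm n : ℂ)) := by
        linear_combination (spC n ⬝ᵥ R / (sqNorm n : ℂ)) * Complex.I_mul_I
      rw [presSeq, ← h7, h11, neg_smul, ← h9, add_neg_cancel]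
    rw [← h8, hR]
    abel

end Vorticity

/-! ### Real analytic functions defined by Fourier series. -/

/-- Sequences which decay exponentially with some rate. -/
def AnSeq (a : Z4 → ℂ) : Prop := ∃ θ : ℝ, 1 < θ ∧ ExpDecay θ a

/-- The phase `ñ · x + n₄ Ω t`. -/
def freqPair (Ω : ℝ) (n : Z4) (z : (Fin 3 → ℝ) × ℝ) : ℝ :=
  ∑ l, (sp n l : ℝ) * z.1 l + (n 3 : ℝ) * Ω * z.2

/-- The function with Fourier coefficients `a`. -/
def synth (Ω : ℝ) (a : Z4 → ℂ) (z : (Fin 3 → ℝ) × ℝ) : ℂ := ∑' n, a n * mode Ω n z.1 z.2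

theorem mode_eq (Ω : ℝ) (n : Z4) (z : (Fin 3 → ℝ) × ℝ) :
    mode Ω n z.1 z.2 = Complex.exp (Complex.I * (freqPair Ω n z : ℂ)) := rfl

theorem norm_mode (Ω : ℝ) (n : Z4) (x : Fin 3 → ℝ) (t : ℝ) : ‖mode Ω n x t‖ = 1 := by
  rw [mode, mul_comm, Complex.norm_exp_ofReal_mul_I]

theorem freqPair_add (Ω : ℝ) (n : Z4) (z w : (Fin 3 → ℝ) × ℝ) :
    freqPair Ω n (z + w) = freqPair Ω n z + freqPair Ω n w := by
  simp only [freqPair, Prod.fst_add, Prod.snd_add, Pi.add_apply, Fin.sum_univ_three]; ring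

theorem freqPair_smul (Ω : ℝ) (n : Z4) (c : ℝ) (z : (Fin 3 → ℝ) × ℝ) :
    freqPair Ω n (c • z) = c * freqPair Ω n z := by
  simp only [freqPair, Prod.smul_fst, Prod.smul_snd, Pi.smul_apply, Fin.sum_univ_three,
    smul_eq_mul]; ring

theorem freqPair_add_left (Ω : ℝ) (n k : Z4) (z : (Fin 3 → ℝ) × ℝ) :
    freqPair Ω (n + k) z = freqPair Ω n z + freqPair Ω k z := by
  simp only [freqPair, sp, Pi.add_apply, Fin.sum_univ_three]; push_cast; ring

theorem freqPair_neg_left (Ω : ℝ) (n : Z4) (z : (Fin 3 → ℝ) × ℝ) :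
    freqPair Ω (-n) z = -freqPair Ω n z := by
  simp only [freqPair, sp, Pi.neg_apply, Fin.sum_univ_three]; push_cast; ring

theorem norm1_eq (n : Z4) : (norm1 n : ℝ) = ∑ l, |(sp n l : ℝ)| + |(n 3 : ℝ)| := by
  rw [norm1, Fin.sum_univ_castSucc]
  push_cast [Nat.cast_natAbs]
  rfl

theorem abs_freqPair_le (Ω : ℝ) (n : Z4) (z : (Fin 3 → ℝ) × ℝ) :
    |freqPair Ω n z| ≤ (1 + |Ω|) * norm1 n * ‖z‖ := by
  have h1 : ∀ l, |(sp n l : ℝ) * z.1 l| ≤ |(sp n l : ℝ)| * ‖z‖ := fun l => by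
    rw [abs_mul]
    exact mul_le_mul_of_nonneg_left ((norm_le_pi_norm z.1 l).trans (norm_fst_le z)) (abs_nonneg _)
  have h2 : |(n 3 : ℝ) * Ω * z.2| ≤ |(n 3 : ℝ)| * |Ω| * ‖z‖ := by
    rw [abs_mul, abs_mul]
    exact mul_le_mul_of_nonneg_left (norm_snd_le z) (by positivity)
  have h3 : |∑ l, (sp n l : ℝ) * z.1 l| ≤ (∑ l, |(sp n l : ℝ)|) * ‖z‖ := by
    rw [Finset.sum_mul]
    exact (Finset.abs_sum_le_sum_abs _ _).trans (Finset.sum_le_sum fun l _ => h1 l)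
  have h4 : 0 ≤ ∑ l, |(sp n l : ℝ)| := Finset.sum_nonneg fun l _ => abs_nonneg _
  rw [norm1_eq]
  have h5 : 0 ≤ |Ω| * (∑ l, |(sp n l : ℝ)|) * ‖z‖ := by positivity
  have h6 : 0 ≤ |(n 3 : ℝ)| * ‖z‖ := by positivity
  calc |freqPair Ω n z| ≤ (∑ l, |(sp n l : ℝ)|) * ‖z‖ + |(n 3 : ℝ)| * |Ω| * ‖z‖ :=
        (abs_add_le _ _).trans (add_le_add h3 h2)
    _ ≤ _ := by nlinarith

/-- The derivative of the phase, as a complex valued functional. -/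
def freqCLM (Ω : ℝ) (n : Z4) : (Fin 3 → ℝ) × ℝ →L[ℝ] ℂ :=
  LinearMap.mkContinuous
    { toFun := fun z => Complex.I * (freqPair Ω n z : ℂ)
      map_add' := fun z w => by rw [freqPair_add]; push_cast; ring
      map_smul' := fun c z => by
        rw [freqPair_smul]; simp only [RingHom.id_apply, Complex.real_smul]; push_cast; ring }
    ((1 + |Ω|) * norm1 n) (fun z => by
      simp only [LinearMap.coe_mk, AddHom.coe_mk, norm_mul, Complex.norm_I, one_mul,
        Complex.norm_real, Real.norm_eq_abs]
      exact abs_freqPair_le Ω n z)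

theorem freqCLM_apply (Ω : ℝ) (n : Z4) (z : (Fin 3 → ℝ) × ℝ) :
    freqCLM Ω n z = Complex.I * (freqPair Ω n z : ℂ) := rfl

theorem norm_freqCLM_le (Ω : ℝ) (n : Z4) : ‖freqCLM Ω n‖ ≤ (1 + |Ω|) * norm1 n :=
  LinearMap.mkContinuous_norm_le _ (by positivity) _

/-- The terms of the power series of a mode. -/
def modeTerm (Ω : ℝ) (a : Z4 → ℂ) (z : (Fin 3 → ℝ) × ℝ) (k : ℕ) (n : Z4) :
    ContinuousMultilinearMap ℝ (fun _ : Fin k => (Fin 3 → ℝ) × ℝ) ℂ :=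
  (a n * mode Ω n z.1 z.2 / (k.factorial : ℂ)) •
    (ContinuousMultilinearMap.mkPiAlgebraFin ℝ k ℂ).compContinuousLinearMap fun _ => freqCLM Ω n

theorem modeTerm_apply (Ω : ℝ) (a : Z4 → ℂ) (z : (Fin 3 → ℝ) × ℝ) (k : ℕ) (n : Z4)
    (y : (Fin 3 → ℝ) × ℝ) : modeTerm Ω a z k n (fun _ => y) =
      a n * mode Ω n z.1 z.2 * (freqCLM Ω n y ^ k / (k.factorial : ℂ)) := by
  simp [modeTerm, List.ofFn_const]
  ring

theorem norm_modeTerm_le (Ω : ℝ) (a : Z4 → ℂ) (z : (Fin 3 → ℝ) × ℝ) (k : ℕ) (n : Z4) :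
    ‖modeTerm Ω a z k n‖ ≤ ‖a n‖ * (((1 + |Ω|) * norm1 n) ^ k / (k.factorial : ℝ)) := by
  have h1 : ‖(ContinuousMultilinearMap.mkPiAlgebraFin ℝ k ℂ).compContinuousLinearMap
      fun _ => freqCLM Ω n‖ ≤ ((1 + |Ω|) * norm1 n) ^ k := by
    refine (ContinuousMultilinearMap.norm_compContinuousLinearMap_le _ _).trans ?_
    rw [ContinuousMultilinearMap.norm_mkPiAlgebraFin, one_mul, Finset.prod_const,
      Finset.card_univ, Fintype.card_fin]
    exact pow_le_pow_left₀ (norm_nonneg _) (norm_freqCLM_le Ω n) k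
  rw [modeTerm, norm_smul, norm_div, norm_mul, norm_mode, mul_one, Complex.norm_natCast,
    div_mul_eq_mul_div, mul_div_assoc]
  gcongr

section PowerSeries

variable {θ Ω : ℝ} {a : Z4 → ℂ}

/-- The radius `log θ / (1 + |Ω|)` is chosen so that the exponential bound on a mode is exactly the
decay weight. -/
theorem exp_radius (hθ : 1 < θ) (m : ℕ) :
    Real.exp ((1 + |Ω|) * m * (Real.log θ / (1 + |Ω|))) = θ ^ m := by
  have h : (1 + |Ω|) ≠ 0 := by positivity
  have e : (1 + |Ω|) * m * (Real.log θ / (1 + |Ω|)) = m * Real.log θ := by field_simp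
  rw [e, Real.exp_nat_mul, Real.exp_log (by linarith)]

theorem norm_modeTerm_mul_le (hθ : 1 < θ) (z : (Fin 3 → ℝ) × ℝ) (k : ℕ) (n : Z4) :
    ‖modeTerm Ω a z k n‖ * (Real.log θ / (1 + |Ω|)) ^ k ≤ θ ^ norm1 n * ‖a n‖ := by
  have hr : 0 < Real.log θ / (1 + |Ω|) := div_pos (Real.log_pos hθ) (by positivity)
  rw [← exp_radius (Ω := Ω) hθ]
  have h2 := Real.pow_div_factorial_le_exp
    ((1 + |Ω|) * norm1 n * (Real.log θ / (1 + |Ω|))) (by positivity) k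
  calc _ ≤ ‖a n‖ * (((1 + |Ω|) * norm1 n) ^ k / (k.factorial : ℝ)) *
        (Real.log θ / (1 + |Ω|)) ^ k :=
        mul_le_mul_of_nonneg_right (norm_modeTerm_le Ω a z k n) (by positivity)
    _ = ‖a n‖ * (((1 + |Ω|) * norm1 n * (Real.log θ / (1 + |Ω|))) ^ k / (k.factorial : ℝ)) := by
        rw [mul_pow _ (Real.log θ / (1 + |Ω|))]; ring
    _ ≤ ‖a n‖ * Real.exp ((1 + |Ω|) * norm1 n * (Real.log θ / (1 + |Ω|))) := by gcongr
    _ = _ := mul_comm _ _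

theorem summable_modeTerm (hθ : 1 < θ) (ha : ExpDecay θ a) (z : (Fin 3 → ℝ) × ℝ) (k : ℕ) :
    Summable fun n => ‖modeTerm Ω a z k n‖ := by
  have hr : 0 < (Real.log θ / (1 + |Ω|)) ^ k :=
    pow_pos (div_pos (Real.log_pos hθ) (by positivity)) k
  refine Summable.of_nonneg_of_le (fun _ => norm_nonneg _) (fun n => ?_)
    (Summable.mul_right ((Real.log θ / (1 + |Ω|)) ^ k)⁻¹ ha)
  rw [← div_eq_mul_inv, le_div_iff₀ hr]
  exact norm_modeTerm_mul_le hθ z k n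

variable (Ω a) in
/-- The power series of a Fourier series. -/
def synthSeries (z : (Fin 3 → ℝ) × ℝ) : FormalMultilinearSeries ℝ ((Fin 3 → ℝ) × ℝ) ℂ :=
  fun k => ∑' n, modeTerm Ω a z k n

theorem hasSum_synthSeries (hθ : 1 < θ) (ha : ExpDecay θ a) (z y : (Fin 3 → ℝ) × ℝ) (k : ℕ) :
    HasSum (fun n => a n * mode Ω n z.1 z.2 * (freqCLM Ω n y ^ k / (k.factorial : ℂ)))
      (synthSeries Ω a z k fun _ => y) := by
  have h := (summable_modeTerm (Ω := Ω) hθ ha z k).of_norm.hasSum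
  have h2 := ContinuousMultilinearMap.hasSum_eval h fun _ => y
  exact h2.congr_fun fun n => (modeTerm_apply Ω a z k n y).symm

theorem mode_add (Ω : ℝ) (n : Z4) (z y : (Fin 3 → ℝ) × ℝ) :
    mode Ω n (z + y).1 (z + y).2 = mode Ω n z.1 z.2 * Complex.exp (freqCLM Ω n y) := by
  rw [mode_eq, mode_eq, freqPair_add, freqCLM_apply, ← Complex.exp_add]
  push_cast; ring_nf

/-- Each mode is expanded by the exponential series around `z`; absolute summability over mode and
degree allows regrouping by degree. -/
theorem hasFPowerSeriesOnBall_synth (hθ : 1 < θ) (ha : ExpDecay θ a) (z : (Fin 3 → ℝ) × ℝ) :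
    HasFPowerSeriesOnBall (synth Ω a) (synthSeries Ω a z) z
      (ENNReal.ofReal (Real.log θ / (1 + |Ω|))) where
  r_le := by
    refine FormalMultilinearSeries.le_radius_of_bound _ (∑' n, θ ^ norm1 n * ‖a n‖) fun k => ?_
    have hr : 0 ≤ Real.log θ / (1 + |Ω|) := (div_pos (Real.log_pos hθ) (by positivity)).le
    have hs := summable_modeTerm (Ω := Ω) hθ ha z k
    rw [Real.coe_toNNReal _ hr]
    calc _ ≤ (∑' n, ‖modeTerm Ω a z k n‖) * (Real.log θ / (1 + |Ω|)) ^ k :=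
          mul_le_mul_of_nonneg_right (norm_tsum_le_tsum_norm hs) (by positivity)
      _ = ∑' n, ‖modeTerm Ω a z k n‖ * (Real.log θ / (1 + |Ω|)) ^ k := tsum_mul_right.symm
      _ ≤ _ := (hs.mul_right _).tsum_le_tsum (fun n => norm_modeTerm_mul_le hθ z k n) ha
  r_pos := ENNReal.ofReal_pos.2 (div_pos (Real.log_pos hθ) (by positivity))
  hasSum := by
    intro y hy
    have hr : 0 < Real.log θ / (1 + |Ω|) := div_pos (Real.log_pos hθ) (by positivity)
    have hy2 : ‖y‖ < Real.log θ / (1 + |Ω|) := by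
      rw [Metric.mem_eball, edist_zero_right, ← ofReal_norm] at hy
      exact (ENNReal.ofReal_lt_ofReal_iff hr).1 hy
    let F : Z4 × ℕ → ℂ := fun q =>
      a q.1 * mode Ω q.1 z.1 z.2 * (freqCLM Ω q.1 y ^ q.2 / (q.2.factorial : ℂ))
    have hrow : ∀ n, HasSum (fun k => ‖F (n, k)‖) (‖a n‖ * Real.exp ‖freqCLM Ω n y‖) := fun n => by
      have h := (NormedSpace.expSeries_div_hasSum_exp (𝔸 := ℝ) ‖freqCLM Ω n y‖).mul_left ‖a n‖
      rw [← Real.exp_eq_exp_ℝ] at h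
      refine h.congr_fun fun k => ?_
      simp [F, norm_mode]
    have hF : Summable F := by
      refine Summable.of_norm ?_
      refine (summable_prod_of_nonneg fun _ => norm_nonneg _).2 ⟨fun n => (hrow n).summable, ?_⟩
      simp only [(hrow _).tsum_eq]
      refine Summable.of_nonneg_of_le (fun n => by positivity) (fun n => ?_) ha
      rw [mul_comm, ← exp_radius (Ω := Ω) hθ]
      gcongr
      rw [freqCLM_apply, norm_mul, Complex.norm_I, one_mul, Complex.norm_real]
      exact (abs_freqPair_le Ω n y).trans (by gcongr)
    have h1 : HasSum F (synth Ω a (z + y)) := by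
      have h2 : ∀ n, HasSum (fun k => F (n, k)) (a n * mode Ω n (z + y).1 (z + y).2) := fun n => by
        have h := (NormedSpace.expSeries_div_hasSum_exp (𝔸 := ℂ) (freqCLM Ω n y)).mul_left
          (a n * mode Ω n z.1 z.2)
        rw [← Complex.exp_eq_exp_ℂ] at h
        rw [mode_add, ← mul_assoc]
        exact h
      have h3 := hF.hasSum
      rw [synth, ← (h3.prod_fiberwise h2).tsum_eq] at *
      exact h3
    exact ((Equiv.prodComm ℕ Z4).hasSum_iff.2 h1).prod_fiberwise
      fun k => hasSum_synthSeries hθ ha z y k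

end PowerSeries

theorem AnSeq.analyticAt_synth {a : Z4 → ℂ} (ha : AnSeq a) (Ω : ℝ) (z : (Fin 3 → ℝ) × ℝ) :
    AnalyticAt ℝ (synth Ω a) z := by
  obtain ⟨θ, hθ, ha⟩ := ha
  exact (hasFPowerSeriesOnBall_synth hθ ha z).analyticAt

/-- Termwise differentiation is read off from the degree one coefficient of the power series. -/
theorem AnSeq.fderiv_synth {a : Z4 → ℂ} (ha : AnSeq a) (Ω : ℝ) (z v : (Fin 3 → ℝ) × ℝ) :
    fderiv ℝ (synth Ω a) z v = synth Ω (fun n => freqCLM Ω n v * a n) z := by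
  obtain ⟨θ, hθ, ha⟩ := ha
  have h := (hasFPowerSeriesOnBall_synth (Ω := Ω) hθ ha z).hasFPowerSeriesAt.hasFDerivAt.fderiv
  rw [h, continuousMultilinearCurryFin1_apply, synth]
  have e : (Fin.snoc 0 v : Fin 1 → (Fin 3 → ℝ) × ℝ) = fun _ => v := by
    funext i; fin_cases i; rfl
  rw [e, ← (hasSum_synthSeries (Ω := Ω) hθ ha z v 1).tsum_eq]
  refine tsum_congr fun n => ?_
  simp; ring

namespace AnSeq

variable {a b : Z4 → ℂ}

theorem add (ha : AnSeq a) (hb : AnSeq b) : AnSeq fun n => a n + b n := by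
  obtain ⟨θ, hθ, ha⟩ := ha
  obtain ⟨θ', hθ', hb⟩ := hb
  have h : 1 < min θ θ' := lt_min hθ hθ'
  exact ⟨_, h, (ha.mono (by linarith) (min_le_left _ _)).add
    (hb.mono (by linarith) (min_le_right _ _)) (by linarith)⟩

theorem const_mul (ha : AnSeq a) (c : ℂ) : AnSeq fun n => c * a n := by
  obtain ⟨θ, hθ, ha⟩ := ha
  exact ⟨θ, hθ, ha.const_mul c (by linarith)⟩

theorem zero : AnSeq fun _ => 0 := ⟨2, one_lt_two, ExpDecay.zero⟩

theorem sum {ι : Type*} (s : Finset ι) {f : ι → Z4 → ℂ} (hf : ∀ i, AnSeq (f i)) :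
    AnSeq fun n => ∑ i ∈ s, f i n := by
  classical
  induction s using Finset.induction_on with
  | empty => simpa using zero
  | insert i s hi ih =>
    simp only [Finset.sum_insert hi]
    exact (hf i).add ih

theorem mul_linear (ha : AnSeq a) {c : Z4 → ℂ} {K : ℝ} (hK : 0 ≤ K)
    (hc : ∀ n, ‖c n‖ ≤ K * norm1 n) : AnSeq fun n => c n * a n := by
  obtain ⟨θ, hθ, ha⟩ := ha
  obtain ⟨θ', h1, h2⟩ := exists_between hθ
  exact ⟨θ', h1, ha.mul_linear (by linarith) h2 hK hc⟩

theorem dx (ha : AnSeq a) (m : Fin 3) : AnSeq (Dx m a) :=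
  ha.mul_linear zero_le_one fun n => by
    rw [Complex.norm_intCast, one_mul]; exact sp_le_norm1 n m

theorem dt (ha : AnSeq a) : AnSeq fun n => (n 3 : ℂ) * a n :=
  ha.mul_linear zero_le_one fun n => by
    rw [Complex.norm_intCast, one_mul, norm1_eq]
    exact le_add_of_nonneg_left (Finset.sum_nonneg fun _ _ => abs_nonneg _)

theorem conv (ha : AnSeq a) (hb : AnSeq b) : AnSeq (conv a b) := by
  obtain ⟨θ, hθ, ha⟩ := ha
  obtain ⟨θ', hθ', hb⟩ := hb
  have h : 1 < min θ θ' := lt_min hθ hθ'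
  exact ⟨_, h, (ha.mono (by linarith) (min_le_left _ _)).conv
    (hb.mono (by linarith) (min_le_right _ _)) h.le⟩

theorem norm_summable (ha : AnSeq a) : Summable fun n => ‖a n‖ := by
  obtain ⟨θ, hθ, ha⟩ := ha
  exact ha.norm_summable hθ.le

theorem summable_mode (ha : AnSeq a) (Ω : ℝ) (z : (Fin 3 → ℝ) × ℝ) :
    Summable fun n => ‖a n * mode Ω n z.1 z.2‖ := by
  simpa [norm_mode] using ha.norm_summable

theorem hasSum_synth (ha : AnSeq a) (Ω : ℝ) (z : (Fin 3 → ℝ) × ℝ) :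
    HasSum (fun n => a n * mode Ω n z.1 z.2) (synth Ω a z) :=
  (ha.summable_mode Ω z).of_norm.hasSum

theorem starD {a b : FSeq} (ha : ∀ l, AnSeq fun n => a n l) (hb : ∀ l, AnSeq fun n => b n l)
    (l : Fin 3) : AnSeq fun n => starD a b n l :=
  sum _ fun m => (ha m).conv ((hb l).dx m)

end AnSeq

theorem mode_add_left (Ω : ℝ) (n k : Z4) (x : Fin 3 → ℝ) (t : ℝ) :
    mode Ω (n + k) x t = mode Ω n x t * mode Ω k x t := by
  rw [mode_eq Ω _ (x, t), mode_eq Ω _ (x, t), mode_eq Ω _ (x, t), freqPair_add_left,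
    ← Complex.exp_add]
  push_cast; ring_nf

theorem mode_neg_left (Ω : ℝ) (n : Z4) (x : Fin 3 → ℝ) (t : ℝ) :
    mode Ω (-n) x t = conj (mode Ω n x t) := by
  rw [mode_eq Ω _ (x, t), mode_eq Ω _ (x, t), freqPair_neg_left, ← Complex.exp_conj, map_mul,
    Complex.conj_I, Complex.conj_ofReal]
  push_cast; ring_nf

section Algebra

variable {a b : Z4 → ℂ} (Ω : ℝ) (z : (Fin 3 → ℝ) × ℝ)

theorem synth_const_mul (ha : AnSeq a) (c : ℂ) :
    synth Ω (fun n => c * a n) z = c * synth Ω a z :=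
  ((ha.const_mul c).hasSum_synth Ω z).unique
    (((ha.hasSum_synth Ω z).mul_left c).congr_fun fun n => by ring)

theorem synth_sum {ι : Type*} (s : Finset ι) {f : ι → Z4 → ℂ} (hf : ∀ i, AnSeq (f i)) :
    synth Ω (fun n => ∑ i ∈ s, f i n) z = ∑ i ∈ s, synth Ω (f i) z :=
  ((AnSeq.sum s hf).hasSum_synth Ω z).unique
    ((hasSum_sum fun i _ => (hf i).hasSum_synth Ω z).congr_fun fun n => by rw [Finset.sum_mul])

/-- Reindexing of a convolution. -/
def convEquiv : Z4 × Z4 ≃ Z4 × Z4 where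
  toFun q := (q.2, q.1 - q.2)
  invFun q := (q.1 + q.2, q.1)
  left_inv q := by simp
  right_inv q := by simp

theorem synth_mul (ha : AnSeq a) (hb : AnSeq b) :
    synth Ω a z * synth Ω b z = synth Ω (conv a b) z := by
  have h1 := (summable_mul_of_summable_norm (ha.summable_mode Ω z) (hb.summable_mode Ω z))
  have h2 := convEquiv.hasSum_iff.2 ((ha.hasSum_synth Ω z).mul (hb.hasSum_synth Ω z) h1)
  obtain ⟨θ, hθ, hA⟩ := ha
  obtain ⟨θ', hθ', hB⟩ := hb
  refine (h2.prod_fiberwise fun n => ?_).unique ((AnSeq.conv ⟨θ, hθ, hA⟩ ⟨θ', hθ', hB⟩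
    ).hasSum_synth Ω z)
  have h3 := ((hA.mono zero_le_one hθ.le).summable_conv (hB.mono zero_le_one hθ'.le) le_rfl n
    ).hasSum.mul_right (mode Ω n z.1 z.2)
  refine h3.congr_fun fun k => ?_
  have h4 := mode_add_left Ω k (n - k) z.1 z.2
  rw [add_sub_cancel] at h4
  simp only [Function.comp, convEquiv, Equiv.coe_fn_mk, h4]
  ring

theorem conj_synth : conj (synth Ω a z) = synth Ω (fun n => conj (a (-n))) z := by
  rw [synth, synth, Complex.conj_tsum, ← (Equiv.neg Z4).tsum_eq]
  refine tsum_congr fun n => ?_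
  rw [Equiv.neg_apply, map_mul, mode_neg_left, Complex.conj_conj]

end Algebra

/-- The real part of the function with Fourier coefficients `a`. -/
def rsynth (Ω : ℝ) (a : Z4 → ℂ) (z : (Fin 3 → ℝ) × ℝ) : ℝ := (synth Ω a z).re

theorem coe_rsynth {a : Z4 → ℂ} (h : ∀ n, conj (a (-n)) = a n) (Ω : ℝ)
    (z : (Fin 3 → ℝ) × ℝ) : (rsynth Ω a z : ℂ) = synth Ω a z := by
  rw [rsynth, ← Complex.conj_eq_iff_re, conj_synth]
  exact congrArg (fun b => synth Ω b z) (funext h)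

namespace AnSeq

variable {a : Z4 → ℂ}

theorem analyticAt_rsynth (ha : AnSeq a) (Ω : ℝ) (z : (Fin 3 → ℝ) × ℝ) :
    AnalyticAt ℝ (rsynth Ω a) z :=
  (Complex.reCLM.analyticAt _).comp (ha.analyticAt_synth Ω z)

theorem fderiv_rsynth (ha : AnSeq a) (Ω : ℝ) (z v : (Fin 3 → ℝ) × ℝ) :
    fderiv ℝ (rsynth Ω a) z v = rsynth Ω (fun n => freqCLM Ω n v * a n) z := by
  have h := (Complex.reCLM.hasFDerivAt (x := synth Ω a z)).comp z
    (ha.analyticAt_synth Ω z).differentiableAt.hasFDerivAt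
  have h2 : fderiv ℝ (rsynth Ω a) z = Complex.reCLM ∘L fderiv ℝ (synth Ω a) z := h.fderiv
  rw [h2, ContinuousLinearMap.comp_apply, ha.fderiv_synth]
  rfl

theorem pd_rsynth (ha : AnSeq a) (Ω : ℝ) (x : Fin 3 → ℝ) (t : ℝ) (j : Fin 3) :
    pd j (fun y => rsynth Ω a (y, t)) x = rsynth Ω (fun n => Complex.I * Dx j a n) (x, t) := by
  have h := HasFDerivAt.comp (g := rsynth Ω a) (f := fun y : Fin 3 → ℝ => (y, t)) x
    (ha.analyticAt_rsynth Ω (x, t)).differentiableAt.hasFDerivAt (hasFDerivAt_prodMk_left x t)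
  have h2 : fderiv ℝ (fun y => rsynth Ω a (y, t)) x = _ := h.fderiv
  rw [pd, h2, ContinuousLinearMap.comp_apply, ContinuousLinearMap.inl_apply, ha.fderiv_rsynth]
  congr 1
  funext n
  have : freqPair Ω n (Pi.single j 1, 0) = sp n j := by simp [freqPair, Pi.single_apply]
  rw [freqCLM_apply, this, Dx]
  push_cast; ring

theorem deriv_rsynth (ha : AnSeq a) (Ω : ℝ) (x : Fin 3 → ℝ) (t : ℝ) :
    deriv (fun s => rsynth Ω a (x, s)) t =
      rsynth Ω (fun n => Complex.I * Ω * ((n 3 : ℂ) * a n)) (x, t) := by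
  have h := (ha.analyticAt_rsynth Ω (x, t)).differentiableAt.hasFDerivAt.comp t
    (hasFDerivAt_prodMk_right x t)
  have h2 : deriv (fun s => rsynth Ω a (x, s)) t = _ := h.hasDerivAt.deriv
  rw [h2, ContinuousLinearMap.comp_apply, ContinuousLinearMap.inr_apply, ha.fderiv_rsynth]
  congr 1
  funext n
  have : freqPair Ω n (0, 1) = n 3 * Ω := by simp [freqPair]
  rw [freqCLM_apply, this]
  push_cast; ring

end AnSeq

/-! ### Fourier series of the forcing and the pressure; the Navier-Stokes equations. -/

section Force

variable (c : (Fin 3 → ℤ) → Fin 3 → ℂ)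

/-- The inclusion of the spatial frequencies. -/
def snocZero (k : Fin 3 → ℤ) : Z4 := Fin.snoc (α := fun _ => ℤ) k 0

theorem sp_snocZero (k : Fin 3 → ℤ) : sp (snocZero k) = k := by
  funext l; simp [sp, snocZero]

theorem snocZero_last (k : Fin 3 → ℤ) : snocZero k 3 = 0 := Fin.snoc_last (α := fun _ => ℤ) _ _

theorem snocZero_injective : Function.Injective snocZero := fun k k' h => by
  rw [← sp_snocZero k, h, sp_snocZero]

theorem forceSeq_snocZero (k : Fin 3 → ℤ) : forceSeq c (snocZero k) = c k := by
  funext l; rw [forceSeq, snocZero_last, if_pos rfl, sp_snocZero]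

theorem forceSeq_eq_zero {n : Z4} (hn : n ∉ Set.range snocZero) : forceSeq c n = 0 := by
  funext l
  rw [forceSeq, if_neg]
  · rfl
  intro h
  refine hn ⟨sp n, funext fun i => Fin.lastCases ?_ (fun l => ?_) i⟩
  · exact (snocZero_last _).trans h.symm
  · exact congrFun (sp_snocZero (sp n)) l

theorem Forcing.anSeq {η : ℝ} (f : Forcing η) (l : Fin 3) : AnSeq fun n => forceSeq f.coeff n l := by
  obtain ⟨θ, hθ, h⟩ := f.analytic
  refine ⟨θ, hθ, (snocZero_injective.summable_iff fun n hn => ?_).1 ((h l).congr fun k => ?_)⟩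
  · simp [forceSeq_eq_zero _ hn]
  · have : norm1 (snocZero k) = ∑ i, (k i).natAbs := by
      rw [norm1, Fin.sum_univ_castSucc]
      have h3 : snocZero k (Fin.last 3) = 0 := snocZero_last k
      rw [h3]
      exact (add_zero _).trans (Finset.sum_congr rfl fun i _ =>
        congrArg Int.natAbs (congrFun (sp_snocZero k) i))
    simp only [Function.comp]
    rw [forceSeq_snocZero, this]

/-- `Ω` and `t` are arbitrary because only modes with `n₄ = 0` contribute. -/
theorem Forcing.fn_eq {η : ℝ} (f : Forcing η) (Ω : ℝ) (x : Fin 3 → ℝ) (t : ℝ) (l : Fin 3) :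
    f.fn x l = rsynth Ω (fun n => forceSeq f.coeff n l) (x, t) := by
  rw [Forcing.fn, rsynth, synth]
  congr 1
  rw [← snocZero_injective.tsum_eq (f := fun n => forceSeq f.coeff n l * mode Ω n x t)]
  · refine tsum_congr fun k => ?_
    rw [forceSeq_snocZero, mode, sp_snocZero, snocZero_last]
    simp
  · intro n hn
    by_contra h
    exact hn (by simp [forceSeq_eq_zero _ h])

theorem Forcing.cjSeq_forceSeq {η : ℝ} (f : Forcing η) :
    cjSeq (forceSeq f.coeff) = forceSeq f.coeff := by
  funext n l
  have : sp (-n) = -sp n := rfl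
  by_cases h : n 3 = 0
  · simp [cjSeq, forceSeq, h, this, f.coeff_neg]
  · simp [cjSeq, forceSeq, h]

end Force

/-- The multiplier `ñ / ñ²` grows at most linearly; at `ñ = 0` division by zero gives the value
zero. -/
theorem AnSeq.presSeq {c : (Fin 3 → ℤ) → Fin 3 → ℂ} {u : FSeq}
    (hc : ∀ l, AnSeq fun n => forceSeq c n l) (hu : ∀ l, AnSeq fun n => u n l) :
    AnSeq (presSeq c u) := by
  have h1 : ∀ l, AnSeq fun n => Complex.I / (sqNorm n : ℂ) * (sp n l : ℂ) *
      (Complex.I * NSOrbit.starD u u n l + (-1) * forceSeq c n l) := fun l => by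
    refine AnSeq.mul_linear (K := 1) (((AnSeq.starD hu hu l).const_mul _).add ((hc l).const_mul _))
      zero_le_one fun n => ?_
    rw [norm_mul, norm_div, Complex.norm_I, Complex.norm_intCast, Complex.norm_intCast]
    have h2 : (1 : ℝ) / |(sqNorm n : ℝ)| ≤ 1 := by
      by_cases h : sqNorm n = 0
      · simp [h]
      · have : (1 : ℝ) ≤ |(sqNorm n : ℝ)| := by exact_mod_cast Int.one_le_abs h
        exact (div_le_one (by linarith)).2 this
    exact mul_le_mul h2 (sp_le_norm1 n l) (abs_nonneg _) zero_le_one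
  have h3 := AnSeq.sum Finset.univ h1
  have e : NSOrbit.presSeq c u = fun n => ∑ l, Complex.I / (sqNorm n : ℂ) * (sp n l : ℂ) *
      (Complex.I * NSOrbit.starD u u n l + (-1) * forceSeq c n l) := by
    funext n
    simp only [NSOrbit.presSeq, dotProduct, Finset.mul_sum, spC, Pi.sub_apply, Pi.smul_apply,
      smul_eq_mul]
    exact Finset.sum_congr rfl fun l _ => by ring
  rwa [e]

/-- A real solution of the vorticity equation yields a solution of the Navier-Stokes equations. -/
theorem solvesNS {η ν Ω : ℝ} {ω : FSeq} {f : Forcing η} (hη : 1 < η) (hω : InL1 η ω)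
    (hreal : cjSeq ω = ω)
    (hdiv : ∀ n, spC n ⬝ᵥ ω n = 0) (hz : ∀ n, sp n = 0 → ω n = 0)
    (h : ∀ n ≠ 0, ∀ l, vortF ν (curlCoeff f.coeff) Ω ω n l = 0) :
    SolvesNS ν f.fn (fun x t l => rsynth Ω (fun n => M ω n l) (x, t))
      (fun x t => rsynth Ω (presSeq f.coeff (M ω)) (x, t)) := by
  have hu : ∀ l, AnSeq fun n => M ω n l := fun l => ⟨η, hη, (hω.M hη).expDecay l⟩
  have hr : ∀ l n, conj (M ω (-n) l) = M ω n l := fun l n => by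
    have h1 := M_cjSeq ω
    rw [hreal] at h1
    exact (congrFun₂ h1 n l).symm
  have hP : AnSeq (presSeq f.coeff (M ω)) := AnSeq.presSeq f.anSeq hu
  intro x t
  refine ⟨fun l => ?_, ?_⟩
  · rw [(hu l).deriv_rsynth, hP.pd_rsynth, f.fn_eq Ω x t l]
    have h2 : ∀ m, pd m (fun y => pd m (fun z => rsynth Ω (fun n => M ω n l) (z, t)) y) x =
        rsynth Ω (fun n => Complex.I * Dx m (fun n => Complex.I * Dx m (fun n => M ω n l) n) n)
          (x, t) := fun m => by
      have e : (fun y => pd m (fun z => rsynth Ω (fun n => M ω n l) (z, t)) y) = fun y =>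
          rsynth Ω (fun n => Complex.I * Dx m (fun n => M ω n l) n) (y, t) :=
        funext fun y => (hu l).pd_rsynth Ω y t m
      rw [e, AnSeq.pd_rsynth (((hu l).dx m).const_mul _)]
    -- The velocity is real valued, so real parts pass through the product and the convolution
    -- theorem applies.
    have h3 : ∀ m, rsynth Ω (fun n => M ω n m) (x, t) *
        pd m (fun y => rsynth Ω (fun n => M ω n l) (y, t)) x =
        (Complex.I * synth Ω (conv (fun n => M ω n m) (Dx m fun n => M ω n l)) (x, t)).re :=
      fun m => by
        rw [(hu l).pd_rsynth, ← synth_mul _ _ (hu m) ((hu l).dx m), ← coe_rsynth (hr m),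
          mul_left_comm, Complex.re_ofReal_mul, ← synth_const_mul _ _ ((hu l).dx m)]
        rfl
    simp only [h2, h3]
    have hA : ∀ m, AnSeq (Dx m (fun n => Complex.I * Dx m (fun n => M ω n l) n)) := fun m =>
      (((hu l).dx m).const_mul _).dx m
    have hC : ∀ m, AnSeq (conv (fun n => M ω n m) (Dx m fun n => M ω n l)) := fun m =>
      (hu m).conv ((hu l).dx m)
    have key := (((((hu l).dt.const_mul (Complex.I * Ω)).hasSum_synth Ω (x, t)).add
      (hasSum_sum fun m (_ : m ∈ Finset.univ) =>
        ((hC m).hasSum_synth Ω (x, t)).mul_left Complex.I)).sub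
      ((hasSum_sum fun m (_ : m ∈ Finset.univ) =>
        ((hA m).const_mul Complex.I).hasSum_synth Ω (x, t)).mul_left (ν : ℂ))).add
      (((hP.dx l).const_mul Complex.I).hasSum_synth Ω (x, t))
    have key2 := key.unique (((f.anSeq l).hasSum_synth Ω (x, t)).congr_fun fun n => by
      have h4 := congrFun (momentum hη hω f.coeff_zero hdiv hz h n) l
      simp only [Pi.add_apply, Pi.sub_apply, Pi.smul_apply, smul_eq_mul, Pi.zero_apply,
        NSOrbit.starD, spC] at h4
      rw [← sub_eq_zero]
      have h5 : ((sqNorm n : ℤ) : ℂ) = ∑ m, (sp n m : ℂ) ^ 2 := by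
        rw [sqNorm]; push_cast; rfl
      rw [h5] at h4
      simp only [Fin.sum_univ_three] at h4 ⊢
      simp only [Dx] at h4 ⊢
      have hI := Complex.I_mul_I
      linear_combination (mode Ω n x t) * h4
        - mode Ω n x t * ν * M ω n l * ((sp n 0 : ℂ) ^ 2 + (sp n 1 : ℂ) ^ 2 + (sp n 2 : ℂ) ^ 2) * hI)
    have key3 := congrArg Complex.re key2
    simp only [Complex.add_re, Complex.sub_re, Complex.re_sum, Complex.re_ofReal_mul] at key3
    exact key3
  · simp only [(hu _).pd_rsynth]
    simp only [rsynth]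
    rw [← Complex.re_sum, ← synth_sum Ω (x, t) Finset.univ fun m => ((hu m).dx m).const_mul Complex.I]
    have e : (fun n => ∑ m, Complex.I * Dx m (fun n => M ω n m) n) = fun _ => 0 := funext fun n => by
      rw [← Finset.mul_sum]
      have := dot_M' ω n
      simp only [dotProduct, spC] at this
      simp only [Dx]
      rw [this, mul_zero]
    rw [e]
    simp [synth]

/-! ### Uniqueness of Fourier coefficients, and periodicity. -/

theorem mFourier_coe (n : Z4) (x : Fin 4 → ℝ) :
    UnitAddTorus.mFourier n (fun i => (x i : UnitAddCircle)) =
      mode 1 n (fun l => 2 * Real.pi * x l.castSucc) (2 * Real.pi * x 3) := by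
  simp only [UnitAddTorus.mFourier, ContinuousMap.coe_mk, fourier_coe_apply]
  rw [← Complex.exp_sum, mode, Fin.sum_univ_castSucc]
  congr 1
  have h3 : Fin.last 3 = 3 := rfl
  rw [h3]
  push_cast
  simp only [sp, Fin.sum_univ_three]
  ring

/-- Fourier coefficients are determined by the function. -/
theorem eq_zero_of_synth_eq_zero {a : Z4 → ℂ} (ha : Summable fun n => ‖a n‖)
    (h : ∀ z, synth 1 a z = 0) (m : Z4) : a m = 0 := by
  -- With the normalized Haar measure the characters are orthonormal in `L²`; the inner product with
  -- the `m`-th one isolates `a m`.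
  let : MeasureTheory.MeasureSpace UnitAddCircle := ⟨AddCircle.haarAddCircle⟩
  have : MeasureTheory.IsProbabilityMeasure
      (MeasureTheory.volume : MeasureTheory.Measure UnitAddCircle) :=
    inferInstanceAs (MeasureTheory.IsProbabilityMeasure AddCircle.haarAddCircle)
  have hs : Summable fun n => a n • UnitAddTorus.mFourier n := by
    refine Summable.of_norm (ha.congr fun n => ?_)
    rw [norm_smul, UnitAddTorus.mFourier_norm, mul_one]
  have h0 : ∑' n, a n • UnitAddTorus.mFourier n = 0 := by
    ext y
    choose x hx using fun i => QuotientAddGroup.mk_surjective (y i)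
    obtain rfl : (fun i => (x i : UnitAddCircle)) = y := funext hx
    have h1 := hs.hasSum.mapL (ContinuousMap.evalCLM ℂ (fun i => (x i : UnitAddCircle)))
    refine h1.tsum_eq.symm.trans ?_
    rw [ContinuousMap.zero_apply, ← h (fun l => 2 * Real.pi * x l.castSucc, 2 * Real.pi * x 3)]
    refine tsum_congr fun n => ?_
    simp only [ContinuousMap.evalCLM_apply, ContinuousMap.smul_apply, smul_eq_mul, mFourier_coe]
  have h1 := hs.hasSum
  rw [h0] at h1
  have h2 := h1.mapL (ContinuousMap.toLp (E := ℂ) 2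
    (MeasureTheory.volume : MeasureTheory.Measure (UnitAddTorus (Fin 4))) ℂ)
  have h3 := h2.mapL (innerSL ℂ (UnitAddTorus.mFourierLp (d := Fin 4) 2 m))
  have h4 := orthonormal_iff_ite.1 (UnitAddTorus.orthonormal_mFourier (d := Fin 4))
  have h5 : HasSum (fun n => if n = m then a m else 0) 0 := by
    rw [map_zero, map_zero] at h3
    refine h3.congr_fun fun n => ?_
    rw [map_smul, map_smul, innerSL_apply_apply]
    have h6 := h4 m n
    rw [UnitAddTorus.mFourierLp] at h6
    rw [smul_eq_mul]
    refine Eq.symm ((congrArg (a n * ·) h6).trans ?_)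
    by_cases hn : n = m
    · subst hn; simp
    · simp [hn, Ne.symm hn]
  exact (hasSum_ite_eq m (a m)).unique h5

theorem mode_periodic_space (Ω : ℝ) (n : Z4) (x : Fin 3 → ℝ) (k : Fin 3 → ℤ) (t : ℝ) :
    mode Ω n (fun i => x i + 2 * Real.pi * k i) t = mode Ω n x t := by
  rw [mode, mode, Complex.exp_eq_exp_iff_exists_int]
  refine ⟨∑ l, sp n l * k l, ?_⟩
  simp only [Fin.sum_univ_three]
  push_cast; ring

theorem mode_periodic_time {Ω : ℝ} (hΩ : Ω ≠ 0) (n : Z4) (x : Fin 3 → ℝ) (t : ℝ) :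
    mode Ω n x (t + 2 * Real.pi / Ω) = mode Ω n x t := by
  rw [mode, mode, Complex.exp_eq_exp_iff_exists_int]
  refine ⟨n 3, ?_⟩
  have e : (n 3 : ℝ) * Ω * (t + 2 * Real.pi / Ω) = (n 3 : ℝ) * Ω * t + n 3 * (2 * Real.pi) := by
    field_simp
  rw [e]
  push_cast; ring

theorem rsynth_periodic_space (Ω : ℝ) (a : Z4 → ℂ) (x : Fin 3 → ℝ) (k : Fin 3 → ℤ) (t : ℝ) :
    rsynth Ω a (fun i => x i + 2 * Real.pi * k i, t) = rsynth Ω a (x, t) := by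
  simp only [rsynth, synth, mode_periodic_space]

theorem rsynth_periodic_time {Ω : ℝ} (hΩ : Ω ≠ 0) (a : Z4 → ℂ) (x : Fin 3 → ℝ) (t : ℝ) :
    rsynth Ω a (x, t + 2 * Real.pi / Ω) = rsynth Ω a (x, t) := by
  simp only [rsynth, synth, mode_periodic_time hΩ]

/-! ### Symmetries of the fields in physical space. -/

namespace SymAction

variable {G : Type*} [Group G] (S : SymAction G)

/-- Orthogonality of `C_g` gives `C_g ñ · C_g x = ñ · x`; the two shifts leave exactly the phase in
`twist`, the time shift being scaled by `1 / Ω`. -/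
theorem mode_move {Ω : ℝ} (hΩ : Ω ≠ 0) (g : G) (n : Z4) (x : Fin 3 → ℝ) (t : ℝ) :
    mode Ω (S.moveIndex g n) (S.CR g *ᵥ x + (2 * Real.pi) • S.shift g)
      (t + 2 * Real.pi * S.timeShift g / Ω) = S.twist g n * mode Ω n x t := by
  have e : ∑ l, (sp (S.moveIndex g n) l : ℝ) * (S.CR g *ᵥ x + (2 * Real.pi) • S.shift g) l +
      (S.moveIndex g n 3 : ℝ) * Ω * (t + 2 * Real.pi * S.timeShift g / Ω) =
      2 * Real.pi * S.phase g n + (∑ l, (sp n l : ℝ) * x l + (n 3 : ℝ) * Ω * t) := by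
    rw [phase, sum_sp_mul_transpose, moveIndex_last, ← S.sum_sp_mul_CR g n x, mul_add,
      mul_add, Finset.mul_sum]
    simp only [Pi.add_apply, Pi.smul_apply, smul_eq_mul, mul_add, Finset.sum_add_distrib]
    have h1 : (n 3 : ℝ) * Ω * (2 * Real.pi * S.timeShift g / Ω) =
        2 * Real.pi * ((n 3 : ℝ) * S.timeShift g) := by field_simp
    have h2 : ∑ l, (sp (S.moveIndex g n) l : ℝ) * (2 * Real.pi * S.shift g l) =
        ∑ l, 2 * Real.pi * ((sp (S.moveIndex g n) l : ℝ) * S.shift g l) :=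
      Finset.sum_congr rfl fun l _ => by ring
    rw [h1, h2]
    ring
  rw [mode, e, twist_eq, mode, ← Complex.exp_add]
  push_cast
  ring_nf

theorem synth_move {Ω : ℝ} (hΩ : Ω ≠ 0) (g : G) (a : Z4 → ℂ) (x : Fin 3 → ℝ) (t : ℝ) :
    synth Ω a (S.CR g *ᵥ x + (2 * Real.pi) • S.shift g, t + 2 * Real.pi * S.timeShift g / Ω) =
      synth Ω (fun n => S.twist g n * a (S.moveIndex g n)) (x, t) := by
  rw [synth, synth, ← (S.moveEquiv g).tsum_eq]
  refine tsum_congr fun n => ?_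
  have := S.mode_move hΩ g n x t
  simp only [moveEquiv, Equiv.coe_fn_mk]
  rw [this]
  ring

theorem synth_vact {Ω : ℝ} (hΩ : Ω ≠ 0) (g : G) (a : FSeq) (m : Fin 3) (x : Fin 3 → ℝ) (t : ℝ) :
    synth Ω (fun n => S.vact g a n m) (x, t) = ((S.ρ g m : ℤ) : ℂ) *
      synth Ω (fun n => a n (S.τ g m))
        (S.CR g *ᵥ x + (2 * Real.pi) • S.shift g, t + 2 * Real.pi * S.timeShift g / Ω) := by
  rw [S.synth_move hΩ, synth, synth, ← tsum_mul_left]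
  exact tsum_congr fun n => by rw [vact]; ring

theorem rsynth_vact {Ω : ℝ} (hΩ : Ω ≠ 0) (g : G) (a : FSeq) (m : Fin 3) (x : Fin 3 → ℝ) (t : ℝ) :
    rsynth Ω (fun n => S.vact g a n m) (x, t) = ((S.ρ g m : ℤ) : ℝ) *
      rsynth Ω (fun n => a n (S.τ g m))
        (S.CR g *ᵥ x + (2 * Real.pi) • S.shift g, t + 2 * Real.pi * S.timeShift g / Ω) := by
  rw [rsynth, S.synth_vact hΩ, rsynth]
  have : ((S.ρ g m : ℤ) : ℂ) = (((S.ρ g m : ℤ) : ℝ) : ℂ) := by push_cast; rfl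
  rw [this, Complex.re_ofReal_mul]

/-- Invariance of the forcing on the level of Fourier coefficients. -/
theorem vact_forceSeq {η : ℝ} {f : Forcing η} (hf : S.InvariantField f.fn) (g : G) :
    S.vact g (forceSeq f.coeff) = forceSeq f.coeff := by
  have hcoe : ∀ z l, (rsynth 1 (fun n => forceSeq f.coeff n l) z : ℂ) =
      synth 1 (fun n => forceSeq f.coeff n l) z := fun z l =>
    coe_rsynth (fun n => congrFun₂ f.cjSeq_forceSeq n l) 1 z
  funext n m
  have hs1 : Summable fun n => ‖S.vact g (forceSeq f.coeff) n m‖ := by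
    refine ((S.moveEquiv g).summable_iff.2 (f.anSeq (S.τ g m)).norm_summable).congr fun n => ?_
    have hρ : ‖((S.ρ g m : ℤ) : ℂ)‖ = 1 := by
      rcases Int.units_eq_one_or (S.ρ g m) with h | h <;> simp [h]
    rw [vact, norm_mul, norm_mul, hρ, norm_twist, one_mul, one_mul]
    rfl
  have hs2 := (f.anSeq m).norm_summable
  have hmode : ∀ {a : Z4 → ℂ} (z : (Fin 3 → ℝ) × ℝ), (Summable fun n => ‖a n‖) →
      Summable fun n => a n * mode 1 n z.1 z.2 := fun z h =>
    Summable.of_norm (by simpa [norm_mode] using h)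
  refine sub_eq_zero.1 (eq_zero_of_synth_eq_zero
    (a := fun n => S.vact g (forceSeq f.coeff) n m - forceSeq f.coeff n m)
    ((hs1.add hs2).of_nonneg_of_le (fun _ => norm_nonneg _) fun _ => norm_sub_le _ _) ?_ n)
  rintro ⟨x, t⟩
  have h1 := congrFun (hf g x) m
  rw [CR_transpose_mulVec, f.fn_eq 1 _ (t + 2 * Real.pi * S.timeShift g / 1), f.fn_eq 1 x t] at h1
  have h2 := S.synth_vact one_ne_zero g (forceSeq f.coeff) m x t
  rw [← hcoe] at h2
  have h3 : synth 1 (fun n => S.vact g (forceSeq f.coeff) n m) (x, t) =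
      synth 1 (fun n => forceSeq f.coeff n m) (x, t) := by
    rw [h2, ← hcoe, ← h1]
    push_cast; rfl
  rw [synth] at h3 ⊢
  simp only [sub_mul]
  rw [(hmode (x, t) hs1).tsum_sub (hmode (x, t) hs2), h3]
  exact sub_self _

theorem curlCoeff_invariant {η : ℝ} {f : Forcing η} (hf : S.InvariantField f.fn) (g : G) :
    S.detC g • S.vact g (curlCoeff f.coeff) = curlCoeff f.coeff :=
  S.curlCoeff_vact g (S.vact_forceSeq hf g)

/-- Contraction with `ñ` cancels the signs of the vector action and leaves a scalar law. -/
theorem presSeq_move {c : (Fin 3 → ℤ) → Fin 3 → ℂ} {u : FSeq} (g : G)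
    (hc : S.vact g (forceSeq c) = forceSeq c) (hu : S.vact g u = u) (n : Z4) :
    S.twist g n * presSeq c u (S.moveIndex g n) = presSeq c u n := by
  have h : starD u u = S.vact g (starD u u) := by rw [← starD_vact, hu]
  rw [presSeq, presSeq, sqNorm_moveIndex, mul_left_comm]
  congr 1
  simp only [dotProduct]
  rw [← Equiv.sum_comp (S.τ g), Finset.mul_sum]
  refine Finset.sum_congr rfl fun m _ => ?_
  have h1 := congrFun₂ h n m
  have h2 := congrFun₂ hc n m
  simp only [Pi.sub_apply, Pi.smul_apply, smul_eq_mul]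
  rw [h1, ← h2, spC_moveIndex_tau, vact, vact]
  ring

theorem actVel_rsynth {Ω : ℝ} (hΩ : Ω ≠ 0) {g : G} {u : FSeq} (hu : S.vact g u = u) :
    S.actVel Ω g (fun x t l => rsynth Ω (fun n => u n l) (x, t)) =
      fun x t l => rsynth Ω (fun n => u n l) (x, t) := by
  funext x t m
  have h := S.rsynth_vact hΩ g u m x t
  rw [hu] at h
  rw [h, actVel, CR_transpose_mulVec]

theorem actPres_rsynth {Ω : ℝ} (hΩ : Ω ≠ 0) {g : G} {a : Z4 → ℂ}
    (ha : ∀ n, S.twist g n * a (S.moveIndex g n) = a n) :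
    S.actPres Ω g (fun x t => rsynth Ω a (x, t)) = fun x t => rsynth Ω a (x, t) := by
  funext x t
  rw [actPres, rsynth, S.synth_move hΩ, funext ha, rsynth]

end SymAction

/-! ### Existence, local uniqueness and conclusion. -/

namespace SymAction

variable {G : Type*} [Group G] [Fintype G] (S : SymAction G) {dom : Set J}

/-- Existence and local uniqueness of a zero of `𝓕^red`. -/
theorem exists_zero_Fred (hdom : S.IsFundamentalDomain dom) {ν η Ωbar : ℝ} (hν : 0 < ν)
    (hη : 1 < η) (f : Forcing η) (φhat : S.RedSeq dom hη) (hΩ : Ωbar ≠ 0) (φbar : S.XRed dom hη)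
    (N : ℕ) (AN : (S.Edag dom ν Ωbar N → ℂ) →ₗ[ℂ] (S.Edag dom ν Ωbar N → ℂ))
    {Y₀ Z₀ Z₁ Z₂ : ℝ} (hY₀ : 0 ≤ Y₀) (hZ₂ : 0 ≤ Z₂)
    (bY₀ : ‖S.Aapp hη hν hΩ N AN (S.Fred hη ν f φhat φbar)‖ ≤ Y₀)
    (bZ₀ : ‖ContinuousLinearMap.id ℂ (S.XRed dom hη)
      - S.Aapp hη hν hΩ N AN ∘L S.Ahat hη ν f φhat N Ωbar φbar‖ ≤ Z₀)
    (bZ₁ : ‖S.Aapp hη hν hΩ N AN ∘L (fderiv ℂ (S.Fred hη ν f φhat) φbar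
      - S.Ahat hη ν f φhat N Ωbar φbar)‖ ≤ Z₁)
    (bZ₂ : ∀ φ : S.XRed dom hη, ‖S.Aapp hη hν hΩ N AN ∘L (fderiv ℂ (S.Fred hη ν f φhat) φ
      - fderiv ℂ (S.Fred hη ν f φhat) φbar)‖ ≤ Z₂ * ‖φ - φbar‖)
    (hsum : Z₀ + Z₁ < 1) (hdisc : 2 * Y₀ * Z₂ < (1 - (Z₀ + Z₁)) ^ 2) :
    ∃ r, ∃ φt ∈ Metric.closedBall φbar r, S.Fred hη ν f φhat φt = 0 ∧
      (∀ ψ ∈ Metric.closedBall φbar r, S.Fred hη ν f φhat ψ = 0 → ψ = φt) ∧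
      (∀ R ∈ Set.Ico (rMin Y₀ Z₀ Z₁ Z₂) (rMax Z₀ Z₁ Z₂), φt ∈ Metric.closedBall φbar R ∧
        ∀ ψ ∈ Metric.closedBall φbar R, S.Fred hη ν f φhat ψ = 0 → ψ = φt) ∧
      φt none ≠ 0 := by
  have bq : ∀ φ : S.XRed dom hη, ‖ContinuousLinearMap.id ℂ (S.XRed dom hη)
      - S.Aapp hη hν hΩ N AN ∘L fderiv ℂ (S.Fred hη ν f φhat) φ‖ ≤
        (Z₀ + Z₁) + Z₂ * ‖φ - φbar‖ := fun φ => by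
    have e : ContinuousLinearMap.id ℂ (S.XRed dom hη)
        - S.Aapp hη hν hΩ N AN ∘L fderiv ℂ (S.Fred hη ν f φhat) φ =
        (ContinuousLinearMap.id ℂ (S.XRed dom hη)
          - S.Aapp hη hν hΩ N AN ∘L S.Ahat hη ν f φhat N Ωbar φbar)
        - S.Aapp hη hν hΩ N AN ∘L (fderiv ℂ (S.Fred hη ν f φhat) φbar
          - S.Ahat hη ν f φhat N Ωbar φbar)
        - S.Aapp hη hν hΩ N AN ∘L (fderiv ℂ (S.Fred hη ν f φhat) φ
          - fderiv ℂ (S.Fred hη ν f φhat) φbar) := by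
      rw [ContinuousLinearMap.comp_sub, ContinuousLinearMap.comp_sub]; abel
    rw [e]
    exact (norm_sub_le _ _).trans
      (add_le_add ((norm_sub_le _ _).trans (add_le_add bZ₀ bZ₁)) (bZ₂ φ))
  have hA : Function.Injective (S.Aapp hη hν hΩ N AN) := by
    refine S.Aapp_injective hη hν hΩ N AN ((bq φbar).trans_lt ?_)
    rw [sub_self, norm_zero, mul_zero, add_zero]
    exact hsum
  obtain ⟨r, hr0, hr, hr1, hrm⟩ := exists_radius hY₀ hZ₂ hsum hdisc
  obtain ⟨φt, hmem, hzero, huniq⟩ := exists_zero_of_quadratic (S.Fred_sub hdom ν f φhat) hA hZ₂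
    bY₀ bq hr hr0 hr1
  refine ⟨r, φt, hmem, hzero, huniq r le_rfl hr1, ?_, ?_⟩
  · rintro R ⟨hR1, hR2⟩
    -- For `Z₂ = 0` division by zero makes `rMin` and `rMax` both zero and the interval empty. The
    -- separate radius `r` keeps existence and uniqueness available in that case.
    have hZ : 0 < Z₂ := by
      refine hZ₂.lt_of_ne' fun h => ?_
      have h1 := hR1.trans_lt hR2
      simp [rMin, rMax, h] at h1
    have hrR : r ≤ R := (hrm hZ.ne').trans_le hR1
    refine ⟨Metric.closedBall_subset_closedBall hrR hmem, huniq R hrR ?_⟩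
    rw [rMax, lt_div_iff₀ hZ] at hR2
    linarith
  -- The zero lies within `r` of `φbar`, where `A ∘ D𝓕` differs from the identity by at most `Z₀ +
  -- Z₁ + Z₂ r < 1`.
  · refine S.freq_ne_zero hdom ν φhat (A := S.Aapp hη hν hΩ N AN) ?_
    rw [← S.fderiv_Fred hdom ν f]
    have h1 : ‖φt - φbar‖ ≤ r := by rw [← dist_eq_norm]; exact hmem
    exact (bq φt).trans_lt ((add_le_add_right (mul_le_mul_of_nonneg_left h1 hZ₂) _).trans_lt hr1)

end SymAction
end
end NSOrbit

open NSOrbit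
theorem mainTheorem5 {G : Type*} [Group G] [Fintype G] (S : SymAction G)
    (dom : Set J) (hdom : S.IsFundamentalDomain dom)
    (ν : ℝ) (hν : 0 < ν) (η : ℝ) (hη : 1 < η)
    (f : Forcing η) (hf : S.InvariantField f.fn)
    (φhat : S.RedSeq dom hη) (hφhat : S.Pr dom (conjSym (S.Sig φhat)) = φhat)
    (Ωbar : ℝ) (hΩ : Ωbar ≠ 0)
    (φbar : S.XRed dom hη) (hφΩ : φbar none = (Ωbar : ℂ))
    (hdiv : φbar ∈ S.XRedDiv dom hη) (hconj : S.redConj φbar = φbar)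
    (N : ℕ) (hN : N ≠ 0)
    (AN : (S.Edag dom ν Ωbar N → ℂ) →ₗ[ℂ] (S.Edag dom ν Ωbar N → ℂ))
    (Y₀ Z₀ Z₁ Z₂ : ℝ) (hY₀ : 0 ≤ Y₀) (hZ₀ : 0 ≤ Z₀) (hZ₁ : 0 ≤ Z₁) (hZ₂ : 0 ≤ Z₂)
    (bY₀ : ‖S.Aapp hη hν hΩ N AN (S.Fred hη ν f φhat φbar)‖ ≤ Y₀)
    (bZ₀ : ‖ContinuousLinearMap.id ℂ (S.XRed dom hη)
      - S.Aapp hη hν hΩ N AN ∘L S.Ahat hη ν f φhat N Ωbar φbar‖ ≤ Z₀)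
    (bZ₁ : ‖S.Aapp hη hν hΩ N AN ∘L (fderiv ℂ (S.Fred hη ν f φhat) φbar
      - S.Ahat hη ν f φhat N Ωbar φbar)‖ ≤ Z₁)
    (bZ₂ : ∀ φ : S.XRed dom hη, ‖S.Aapp hη hν hΩ N AN ∘L (fderiv ℂ (S.Fred hη ν f φhat) φ
      - fderiv ℂ (S.Fred hη ν f φhat) φbar)‖ ≤ Z₂ * ‖φ - φbar‖)
    (hsum : Z₀ + Z₁ < 1) (hdisc : 2 * Y₀ * Z₂ < (1 - (Z₀ + Z₁)) ^ 2) :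
    ∃ φt : S.XRed dom hη,
      S.Fred hη ν f φhat φt = 0 ∧
      (∀ r ∈ Set.Ico (rMin Y₀ Z₀ Z₁ Z₂) (rMax Z₀ Z₁ Z₂),
        φt ∈ Metric.closedBall φbar r ∧
        ∀ ψ ∈ Metric.closedBall φbar r, S.Fred hη ν f φhat ψ = 0 → ψ = φt) ∧
      φt ∈ S.XRedDiv dom hη ∧
      S.redConj φt = φt ∧
      ∃ Ωt : ℝ, φt none = (Ωt : ℂ) ∧ Ωt ≠ 0 ∧
        ∃ (u : (Fin 3 → ℝ) → ℝ → Fin 3 → ℝ) (p : (Fin 3 → ℝ) → ℝ → ℝ),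
          (∀ x t l, HasSum
            (fun n : Z4 => M (ext (S.Sig (S.seqPart φt))) n l * mode Ωt n x t) (u x t l : ℂ)) ∧
          AnalyticOnNhd ℝ (fun z : (Fin 3 → ℝ) × ℝ => u z.1 z.2) Set.univ ∧
          AnalyticOnNhd ℝ (fun z : (Fin 3 → ℝ) × ℝ => p z.1 z.2) Set.univ ∧
          (∀ (k : Fin 3 → ℤ) x t, u (fun i => x i + 2 * Real.pi * k i) t = u x t ∧
            p (fun i => x i + 2 * Real.pi * k i) t = p x t) ∧
          (∀ x t, u x (t + 2 * Real.pi / Ωt) = u x t ∧ p x (t + 2 * Real.pi / Ωt) = p x t) ∧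
          SolvesNS ν f.fn u p ∧
          (∀ g, S.actVel Ωt g u = u ∧ S.actPres Ωt g p = p) := by
  have hfc := S.curlCoeff_invariant hf
  obtain ⟨r, φt, hmem, hzero, huniq, hball, hne⟩ := S.exists_zero_Fred hdom hν hη f φhat hΩ φbar
    N AN hY₀ hZ₂ bY₀ bZ₀ bZ₁ bZ₂ hsum hdisc
  have hcbar : S.conjX hdom φbar = φbar := Subtype.ext hconj
  have hct : S.conjX hdom φt = φt := by
    -- Conjugation is an isometry fixing `φbar`, so the conjugate zero lies in the same ball and
    -- uniqueness applies.
    refine huniq _ ?_ (S.Fred_conjX_eq_zero hdom hfc hφhat hzero)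
    rw [Metric.mem_closedBall, dist_eq_norm] at hmem ⊢
    rwa [← hcbar, ← S.conjX_sub, S.norm_conjX]
  have hredt : S.redConj φt = φt := congrArg Subtype.val hct
  have hreal : cjSeq (S.vort φt) = S.vort φt := by
    rw [← S.vort_conjX hdom, hct]
  have hΩt : φt none = ((φt none).re : ℂ) :=
    (Complex.conj_eq_iff_re.1 (congrFun hredt none)).symm
  have hΩ0 : (φt none).re ≠ 0 := fun h => hne (by rw [hΩt, h, Complex.ofReal_zero])
  set Ωt := (φt none).re with hΩdef
  set ω := S.vort φt with hω
  have hL : InL1 η ω := S.vort_inL1 φt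
  have h0 : ω 0 = 0 := by funext m; simp [hω, SymAction.vort, ext]
  have hvort : ∀ n ≠ 0, ∀ l, vortF ν (curlCoeff f.coeff) (Ωt : ℂ) ω n l = 0 := fun n hn l => by
    rw [← hΩt]
    exact S.vortF_eq_zero hdom hfc hzero (⟨n, hn⟩, l)
  have hdiv0 : ∀ n, spC n ⬝ᵥ ω n = 0 := div_eq_zero hη hν hL h0 hreal hvort
  have hsp : ∀ n, sp n = 0 → ω n = 0 := fun n =>
    eq_zero_of_sp_eq_zero hη hΩ0 hL h0 hdiv0 hvort
  have hu : ∀ l, AnSeq fun n => M ω n l := fun l => ⟨η, hη, (hL.M hη).expDecay l⟩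
  have hP : AnSeq (presSeq f.coeff (M ω)) := AnSeq.presSeq f.anSeq hu
  have hMreal : cjSeq (M ω) = M ω := by rw [← M_cjSeq, hreal]
  -- The determinants from the pseudovector action and from `M` cancel.
  have hMinv : ∀ g, S.vact g (M ω) = M ω := fun g => by
    have h1 := congrArg M (S.vort_gam hdom φt g)
    rwa [M_smul, S.M_vact, smul_smul, S.detC_mul_self, one_smul] at h1
  refine ⟨φt, hzero, hball, ⟨S.Sig (S.seqPart φt), S.summable_Sig φt, S.gam_Sig hdom _, ?_, ?_⟩,
    hredt, Ωt, hΩt, hΩ0, fun x t l => rsynth Ωt (fun n => M ω n l) (x, t),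
    fun x t => rsynth Ωt (presSeq f.coeff (M ω)) (x, t), ?_, ?_, ?_, ?_, ?_, ?_, ?_⟩
  · intro n
    have h1 := hdiv0 n.1
    simpa [dotProduct, spC, hω, SymAction.vort, ext, n.2] using h1
  · exact (S.Pr_Sig hdom _).symm
  · intro x t l
    have h1 := (hu l).hasSum_synth Ωt (x, t)
    rw [← coe_rsynth (fun n => congrFun₂ hMreal n l)] at h1
    exact h1
  · exact fun z _ => analyticAt_pi_iff.2 fun l => (hu l).analyticAt_rsynth Ωt z
  · exact fun z _ => hP.analyticAt_rsynth Ωt z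
  · exact fun k x t => ⟨funext fun l => rsynth_periodic_space _ _ x k t,
      rsynth_periodic_space _ _ x k t⟩
  · exact fun x t => ⟨funext fun l => rsynth_periodic_time hΩ0 _ x t,
      rsynth_periodic_time hΩ0 _ x t⟩
  · exact solvesNS hη hL hreal hdiv0 hsp hvort
  · exact fun g => ⟨S.actVel_rsynth hΩ0 (hMinv g),
      S.actPres_rsynth hΩ0 (S.presSeq_move g (S.vact_forceSeq hf g) (hMinv g))⟩
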